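/- Let $G$ be a connected compact semisimple Lie group with Lie algebra $\mathfrak g$, let $\mathrm{Kil}$ be the negative of its Killing form, let $\mu\in\mathfrak g'$, and let $K$ be the stability subgroup of $\mu$ for the coadjoint action, so that $G/K$ is the coadjoint orbit of $\mu$. Let $\mathfrak k$ be the Lie algebra of $K$ and $\mathfrak m=\mathfrak k^{\perp}$ for $\mathrm{Kil}$. Put $\omega(X,Y)=\mu([X,Y])$, let $\Gamma$ be the operator on $\mathfrak m$ with $\omega(X,Y)=\mathrm{Kil}(\Gamma X,Y)$, let $\Gamma=|\Gamma|J_\diamond$ be its polar decomposition with respect to $\mathrm{Kil}$, and put $g_\diamond(X,Y)=\omega(X,J_\diamond Y)$. This determines a unique pair $(g_\diamond,J_\diamond)$ of an inner product on $\mathfrak m$ and a complex structure orthogonal for it, both invariant under $\mathrm{Ad}(K)$. View the smooth functions on $G/K$ as the smooth right $K$-invariant functions on $G$, and the vector fields on $G/K$ as $$\mathcal T(G/K)=\{V\in C^\infty(G,\mathfrak m): V(xs)=\mathrm{Ad}_s^{-1}V(x)\ \text{ for } x\in G,\ s\in K\},$$ on which $G$ acts by translation and $g_\diamond$, $J_\diamond$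 act pointwise; $V$ differentiates a function $f$ on $G$ (with values in any finite-dimensional vector space) by $(\partial_Vf)(x)=\frac{d}{dt}\big|_{t=0}f(x\exp(tV(x)))$. Let $\mathfrak m_J$ be $\mathfrak m$ with $iX=J_\diamond X$ and the inner product $\langle X,Y\rangle_J=g_\diamond(X,Y)+i\,g_\diamond(J_\diamond X,Y)$. Let $\mathcal S=\bigwedge^*\mathfrak m_J$ be its complex exterior algebra, with the inner product determined by $\langle X_1\wedge\dots\wedge X_p,\,Y_1\wedge\dots\wedge Y_q\rangle=\delta_{pq}\det[\langle X_k,Y_l\rangle_J]$, with the action $\widetilde{\mathrm{Ad}}$ of $K$ by algebra automorphisms extending $\mathrm{Ad}$ on $\mathfrak m_J$, and with the Clifford action $\kappa(X)=i(a(X)+a^\dagger(X))$, where $a^\dagger(X)\varphi=X\wedge\varphi$ and $a(X)(X_1\wedge\dots\wedge X_p)=\sum_j(-1)^{j-1}\langle X,X_j\rangle_J\,X_1\wedge\dots\wedge\widehat{X_j}\wedge\dots\wedge X_p$. For a character $\chi$ of $K$ (a continuous homomorphism from $K$ to the unit circle) let $$\mathcal S(G/K,\chi)=\{\psi\in C^\infty(G,\mathcal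 S):\psi(xs)=\bar\chi(s)\,\widetilde{\mathrm{Ad}}{}_s^{-1}\psi(x)\ \text{ for } x\in G,\ s\in K\},$$ with the inner product $\langle\psi,\varphi\rangle=\int_G\langle\psi(x),\varphi(x)\rangle\,dx$ for a Haar measure on $G$. Let $\nabla$ be any $G$-invariant connection on $\mathcal T(G/K)$ that is compatible with $g_\diamond$ and commutes with $J_\diamond$. Write $\nabla_V=\partial_V+L_V$, so that each $L_V(x)$ is a complex linear endomorphism of $\mathfrak m_J$; extend it to a derivation $L_V^{\mathcal S}(x)$ of the exterior algebra $\mathcal S$, and put $\nabla^{\mathcal S}_V\psi=\partial_V\psi+L_V^{\mathcal S}\psi$ for $\psi\in\mathcal S(G/K,\chi)$. Let $\mathrm{grad}\,\psi=\sum_kU_k\otimes\varphi_k$, with $U_k\in\mathcal T(G/K)$ and $\varphi_k\in\mathcal S(G/K,\chi)$, be the tensor such that $\nabla^{\mathcal S}_V\psi=\sum_kg_\diamond(U_k,V)\varphi_k$ for all $V\in\mathcal T(G/K)$. The Dirac operator of $\nabla$ and $\chi$ is $D^\nabla\psi=\kappa(\mathrm{grad}\,\psi)=\sum_k\kappa(U_k)\varphi_k$;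 it is a well-defined linear operator on $\mathcal S(G/K,\chi)$. Then for every such $\nabla$ and every character $\chi$ of $K$, the Dirac operator $D^\nabla$ on $\mathcal S(G/K,\chi)$ is formally self-adjoint: $$\langle D^\nabla\psi,\varphi\rangle=\langle\psi,D^\nabla\varphi\rangle\qquad\text{for all }\psi,\varphi\in\mathcal S(G/K,\chi).$$ -/

import Mathlib

open scoped Manifold ContDiff

namespace CoadjointDirac

noncomputable section LieGroupPart

variable {E : Type*} [NormedAddCommGroup E] [NormedSpace ℝ E]
  {G : Type*} [TopologicalSpace G] [ChartedSpace E G] [Group G]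

/-- A smooth Lie group is smooth enough for Mathlib's Lie bracket on the tangent space at `1`. -/
instance instLEInftyMinSmoothness : ENat.LEInfty (minSmoothness ℝ 3) :=
  ⟨by rw [minSmoothness_of_isRCLikeNormedField]; exact ENat.LEInfty.out⟩

variable [LieGroup 𝓘(ℝ, E) ∞ G]

set_option linter.unusedSectionVars false

variable (E G) in
/-- The Lie algebra `𝔤` of `G`: the tangent space at `1`, with the bracket of left-invariant
fields. -/
abbrev LieAlg := GroupLieAlgebra 𝓘(ℝ, E) G

lemma contMDiff_conj (g : G) : ContMDiff 𝓘(ℝ, E) 𝓘(ℝ, E) ∞ (fun x : G => g * x * g⁻¹) :=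
  contMDiff_mul_right.comp contMDiff_mul_left

variable (E) in
/-- The adjoint action `Ad_g` on `𝔤`: the derivative at `1` of `x ↦ g x g⁻¹`. -/
def Ad (g : G) : LieAlg E G →ₗ[ℝ] LieAlg E G :=
  (mfderiv 𝓘(ℝ, E) 𝓘(ℝ, E) (fun x : G => g * x * g⁻¹) 1 : E →L[ℝ] E).toLinearMap

lemma mfderiv_congr_point {p q : G} (h : p = q) (f : G → G) (v : E) :
   (mfderiv 𝓘(ℝ, E) 𝓘(ℝ, E) f p : E →L[ℝ] E) v =  (mfderiv 𝓘(ℝ, E) 𝓘(ℝ, E) f q : E →L[ℝ] E) v := by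
  subst h; rfl

lemma Ad_mul_apply (g h : G) (X : LieAlg E G) : Ad E (g * h) X = Ad E g (Ad E h X) := by
  have e : (fun x : G => g * h * x * (g * h)⁻¹) =
      (fun x : G => g * x * g⁻¹) ∘ (fun x : G => h * x * h⁻¹) := by
    ext x; simp [mul_assoc]
  have hg := ((contMDiff_conj (E := E) g).mdifferentiable (by simp)) (h * 1 * h⁻¹)
  have hh := ((contMDiff_conj (E := E) h).mdifferentiable (by simp)) 1
  have key := mfderiv_comp (I := 𝓘(ℝ, E)) (I' := 𝓘(ℝ, E)) (I'' := 𝓘(ℝ, E)) (1 : G) hg hh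
  change (mfderiv 𝓘(ℝ, E) 𝓘(ℝ, E) (fun x : G => g * h * x * (g * h)⁻¹) 1 : E →L[ℝ] E) X = _
  rw [e, key]
  exact mfderiv_congr_point (by simp) _ _

lemma Ad_one_apply (X : LieAlg E G) : Ad E (1 : G) X = X := by
  have e : (fun x : G => 1 * x * 1⁻¹) = id := by ext x; simp
  change (mfderiv 𝓘(ℝ, E) 𝓘(ℝ, E) (fun x : G => 1 * x * 1⁻¹) 1 : E →L[ℝ] E) X = _
  rw [e, mfderiv_id]; rfl

lemma Ad_inv_Ad (g : G) (X : LieAlg E G) : Ad E g⁻¹ (Ad E g X) = X := by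
  rw [← Ad_mul_apply, inv_mul_cancel, Ad_one_apply]

lemma Ad_Ad_inv (g : G) (X : LieAlg E G) : Ad E g (Ad E g⁻¹ X) = X := by
  rw [← Ad_mul_apply, mul_inv_cancel, Ad_one_apply]

lemma mfderiv_conj_comp (g h x : G) (v : E) :
    (mfderiv 𝓘(ℝ, E) 𝓘(ℝ, E) (fun y : G => g * y * g⁻¹) (h * x * h⁻¹) : E →L[ℝ] E)
      ((mfderiv 𝓘(ℝ, E) 𝓘(ℝ, E) (fun y : G => h * y * h⁻¹) x : E →L[ℝ] E) v) =
      (mfderiv 𝓘(ℝ, E) 𝓘(ℝ, E) (fun y : G => (g * h) * y * (g * h)⁻¹) x : E →L[ℝ] E) v := by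
  have e : (fun x : G => g * h * x * (g * h)⁻¹) =
      (fun x : G => g * x * g⁻¹) ∘ (fun x : G => h * x * h⁻¹) := by
    ext x; simp [mul_assoc]
  have hg := ((contMDiff_conj (E := E) g).mdifferentiable (by simp)) (h * x * h⁻¹)
  have hh := ((contMDiff_conj (E := E) h).mdifferentiable (by simp)) x
  rw [e, mfderiv_comp (I := 𝓘(ℝ, E)) (I' := 𝓘(ℝ, E)) (I'' := 𝓘(ℝ, E)) x hg hh]
  rfl

lemma mfderiv_conj_one (x : G) (v : E) :
    (mfderiv 𝓘(ℝ, E) 𝓘(ℝ, E) (fun y : G => (1 : G) * y * (1 : G)⁻¹) x : E →L[ℝ] E) v = v := by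
  have e : (fun x : G => 1 * x * 1⁻¹) = id := by ext x; simp
  rw [e, mfderiv_id]; rfl

lemma mfderiv_conj_mulInvariant (g x : G) (v : LieAlg E G) :
    (mfderiv 𝓘(ℝ, E) 𝓘(ℝ, E) (fun y : G => g * y * g⁻¹) x : E →L[ℝ] E)
      (mulInvariantVectorField v x : E) =
      (mulInvariantVectorField (Ad E g v) (g * x * g⁻¹) : E) := by
  have h1 : MDifferentiableAt 𝓘(ℝ, E) 𝓘(ℝ, E) (fun y : G => x * y) 1 :=
    (contMDiff_mul_left (I := 𝓘(ℝ, E)) (n := ∞)).mdifferentiable (by simp) 1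
  have h2 := ((contMDiff_conj (E := E) g).mdifferentiable (by simp)) (x * 1)
  have h3 : MDifferentiableAt 𝓘(ℝ, E) 𝓘(ℝ, E) (fun y : G => g * x * g⁻¹ * y) (g * 1 * g⁻¹) :=
    (contMDiff_mul_left (I := 𝓘(ℝ, E)) (n := ∞)).mdifferentiable (by simp) _
  have h4 := ((contMDiff_conj (E := E) g).mdifferentiable (by simp)) 1
  have e : (fun y : G => g * y * g⁻¹) ∘ (fun y : G => x * y) =
      (fun y : G => g * x * g⁻¹ * y) ∘ (fun y : G => g * y * g⁻¹) := by
    ext y; simp [mul_assoc]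
  have k1 := mfderiv_comp (I := 𝓘(ℝ, E)) (I' := 𝓘(ℝ, E)) (I'' := 𝓘(ℝ, E)) (1 : G) h2 h1
  have k2 := mfderiv_comp (I := 𝓘(ℝ, E)) (I' := 𝓘(ℝ, E)) (I'' := 𝓘(ℝ, E)) (1 : G) h3 h4
  rw [e, k2] at k1
  have k3 : (mfderiv 𝓘(ℝ, E) 𝓘(ℝ, E) (fun y : G => g * x * g⁻¹ * y) (g * 1 * g⁻¹) : E →L[ℝ] E)
      ((mfderiv 𝓘(ℝ, E) 𝓘(ℝ, E) (fun y : G => g * y * g⁻¹) 1 : E →L[ℝ] E) v) =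
      (mfderiv 𝓘(ℝ, E) 𝓘(ℝ, E) (fun y : G => g * y * g⁻¹) (x * 1) : E →L[ℝ] E)
      ((mfderiv 𝓘(ℝ, E) 𝓘(ℝ, E) (fun y : G => x * y) 1 : E →L[ℝ] E) v) :=
    congrArg (fun A : E →L[ℝ] E => A v) k1
  exact (mfderiv_congr_point (mul_one x).symm _ _).trans
    (k3.symm.trans (mfderiv_congr_point (by simp) _ _))

open VectorField in
lemma mpullback_conj (g : G) (v : LieAlg E G) :
    mpullback 𝓘(ℝ, E) 𝓘(ℝ, E) (fun x : G => g * x * g⁻¹) (mulInvariantVectorField (Ad E g v)) =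
      mulInvariantVectorField v := by
  ext x
  let A : E →L[ℝ] E := mfderiv 𝓘(ℝ, E) 𝓘(ℝ, E) (fun y : G => g * y * g⁻¹) x
  let B : E →L[ℝ] E := mfderiv 𝓘(ℝ, E) 𝓘(ℝ, E) (fun y : G => g⁻¹ * y * g⁻¹⁻¹) (g * x * g⁻¹)
  have hBA : B.comp A = ContinuousLinearMap.id ℝ E := by
    ext w
    change B (A w) = w
    refine (mfderiv_conj_comp g⁻¹ g x w).trans ?_
    rw [inv_mul_cancel]; exact mfderiv_conj_one x w
  have hAB : A.comp B = ContinuousLinearMap.id ℝ E := by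
    ext w
    change A (B w) = w
    have hx : x = g⁻¹ * (g * x * g⁻¹) * g⁻¹⁻¹ := by group
    have : A (B w) = (mfderiv 𝓘(ℝ, E) 𝓘(ℝ, E) (fun y : G => g * y * g⁻¹)
        (g⁻¹ * (g * x * g⁻¹) * g⁻¹⁻¹) : E →L[ℝ] E) (B w) := mfderiv_congr_point hx _ _
    rw [this]
    refine (mfderiv_conj_comp g g⁻¹ (g * x * g⁻¹) w).trans ?_
    rw [mul_inv_cancel]; exact mfderiv_conj_one _ w
  have hinv : A.inverse = B := ContinuousLinearMap.inverse_eq hAB hBA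
  have key := mfderiv_conj_mulInvariant g x v
  change A.inverse (mulInvariantVectorField (Ad E g v) (g * x * g⁻¹) : E) = _
  rw [← key, hinv]
  exact congrArg (fun C : E →L[ℝ] E => C (mulInvariantVectorField v x : E)) hBA

variable [CompleteSpace E]

open VectorField in
lemma Ad_lie (g : G) (X Y : LieAlg E G) : Ad E g ⁅X, Y⁆ = ⁅Ad E g X, Ad E g Y⁆ := by
  have key : mulInvariantVectorField (I := 𝓘(ℝ, E)) ⁅X, Y⁆ =
      mulInvariantVectorField (Ad E g⁻¹ ⁅Ad E g X, Ad E g Y⁆) := by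
    ext x
    rw [GroupLieAlgebra.bracket_def X Y, mulInvariantVector_mlieBracket, ← mpullback_conj g X,
      ← mpullback_conj g Y, ← mpullback_conj g (Ad E g⁻¹ ⁅Ad E g X, Ad E g Y⁆), Ad_Ad_inv,
      GroupLieAlgebra.bracket_def, mulInvariantVector_mlieBracket,
      mpullback_mlieBracket (n := ∞)]
    · exact mdifferentiableAt_mulInvariantVectorField _
    · exact mdifferentiableAt_mulInvariantVectorField _
    · exact (contMDiff_conj g).contMDiffAt
    · rw [minSmoothness_of_isRCLikeNormedField]; exact ENat.LEInfty.out
  have h1 : ∀ v : LieAlg E G, (mulInvariantVectorField (I := 𝓘(ℝ, E)) v (1 : G) : E) = v := by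
    intro v
    have e : (fun y : G => (1 : G) * y) = id := by ext; simp
    change (mfderiv 𝓘(ℝ, E) 𝓘(ℝ, E) (fun y : G => (1 : G) * y) 1 : E →L[ℝ] E) v = v
    rw [e, mfderiv_id]; rfl
  have h2 : ⁅X, Y⁆ = Ad E g⁻¹ ⁅Ad E g X, Ad E g Y⁆ :=
    (h1 _).symm.trans ((congrFun key 1).trans (h1 _))
  rw [h2, Ad_Ad_inv]

/-- `Ad_g` as an automorphism of the Lie algebra. -/
def AdEquiv (g : G) : LieAlg E G ≃ₗ⁅ℝ⁆ LieAlg E G :=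
  { Ad E g with
    map_lie' := fun {X Y} => Ad_lie g X Y
    invFun := Ad E g⁻¹
    left_inv := Ad_inv_Ad g
    right_inv := Ad_Ad_inv g }

variable (E G) in
/-- The negative of the Killing form of `𝔤`. -/
def Kil : LieAlg E G →ₗ[ℝ] LieAlg E G →ₗ[ℝ] ℝ := -killingForm ℝ (LieAlg E G)

lemma Kil_Ad (g : G) (X Y : LieAlg E G) : Kil E G (Ad E g X) (Ad E g Y) = Kil E G X Y := by
  have := LieAlgebra.killingForm_of_equiv_apply (AdEquiv g) X Y
  simp only [Kil, LinearMap.neg_apply, neg_inj]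
  exact this

end LieGroupPart
noncomputable section HermitianPart

/-- An inner product `g` on a real vector space `V` together with an orthogonal complex structure
`J`. -/
structure HermitianStructure (V : Type*) [AddCommGroup V] [Module ℝ V] where
  J : V →ₗ[ℝ] V
  g : V →ₗ[ℝ] V →ₗ[ℝ] ℝ
  J_J : ∀ X, J (J X) = -X
  g_symm : ∀ X Y, g X Y = g Y X
  g_pos : ∀ X, X ≠ 0 → 0 < g X X
  g_J : ∀ X Y, g (J X) (J Y) = g X Y

namespace HermitianStructure

section VS
variable {V : Type*} [AddCommGroup V] [Module ℝ V] (h : HermitianStructure V)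

lemma g_J_left (X Y : V) : h.g (h.J X) Y = -h.g X (h.J Y) := by
  have := h.g_J X (h.J Y)
  rw [h.J_J] at this
  rw [← this]; simp

/-- The complex vector space structure on `V` in which `i X = J X`. -/
@[reducible]
def complexModule : Module ℂ V where
  smul z X := z.re • X + z.im • h.J X
  one_smul X := by
    change (1 : ℂ).re • X + (1 : ℂ).im • h.J X = X
    simp
  mul_smul z w X := by
    change (z * w).re • X + (z * w).im • h.J X =
      z.re • (w.re • X + w.im • h.J X) + z.im • h.J (w.re • X + w.im • h.J X)
    simp only [Complex.mul_re, Complex.mul_im, map_add, map_smul, h.J_J]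
    module
  smul_zero z := by
    change z.re • (0 : V) + z.im • h.J 0 = 0
    simp
  smul_add z X Y := by
    change z.re • (X + Y) + z.im • h.J (X + Y) =
      (z.re • X + z.im • h.J X) + (z.re • Y + z.im • h.J Y)
    simp only [map_add]
    module
  add_smul z w X := by
    change (z + w).re • X + (z + w).im • h.J X =
      (z.re • X + z.im • h.J X) + (w.re • X + w.im • h.J X)
    simp only [Complex.add_re, Complex.add_im]
    module
  zero_smul X := by
    change (0 : ℂ).re • X + (0 : ℂ).im • h.J X = 0
    simp

/-- The complex inner product `⟨X, Y⟩_J = g(X, Y) + i g(J X, Y)`, linear in the second variable. -/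
@[reducible]
def complexCore : @InnerProductSpace.Core ℂ V _ _ h.complexModule :=
  letI := h.complexModule
  { inner := fun X Y => (h.g X Y : ℂ) + (h.g (h.J X) Y : ℂ) * Complex.I
    conj_inner_symm := fun X Y => by
      have := h.g_J_left Y X
      rw [h.g_symm Y (h.J X)] at this
      simp [h.g_symm Y X, this]
    re_inner_nonneg := fun X => by
      by_cases hX : X = 0
      · simp [hX]
      · simpa using (h.g_pos X hX).le
    add_left := fun X Y Z => by
      simp only [map_add, LinearMap.add_apply, Complex.ofReal_add]
      ring
    smul_left := fun X Y z => by
      change ((h.g (z.re • X + z.im • h.J X) Y : ℝ) : ℂ)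
        + ((h.g (h.J (z.re • X + z.im • h.J X)) Y : ℝ) : ℂ) * Complex.I = _
      simp only [map_add, LinearMap.add_apply, map_smul, h.J_J, LinearMap.smul_apply, smul_eq_mul,
        map_neg, LinearMap.neg_apply]
      apply Complex.ext <;> simp
    definite := fun X hX => by
      by_contra hne
      have h1 := h.g_pos X hne
      have h2 := congrArg Complex.re hX
      simp at h2
      exact h1.ne' h2 }

/-- The real vector space `V`, viewed as the complex inner product space `V_J`: `i` acts as `J` and
the inner product is `⟨X, Y⟩_J = g(X, Y) + i g(J X, Y)`; see `smul_toCplx` and `inner_toCplx`. -/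
def Cplx (_h : HermitianStructure V) : Type _ := V

instance instNormedCplx : NormedAddCommGroup h.Cplx :=
  letI := h.complexModule
  @InnerProductSpace.Core.toNormedAddCommGroup ℂ V _ _ _ h.complexCore

instance instInnerCplx : InnerProductSpace ℂ h.Cplx :=
  letI := h.complexModule
  @InnerProductSpace.ofCore ℂ V _ _ _ h.complexCore.toCore

/-- The identity map from `V` to `V_J`. -/
def toCplx : V ≃ₗ[ℝ] h.Cplx where
  toFun X := X
  invFun X := X
  map_add' _ _ := rfl
  map_smul' r X := by
    change r • X = (r : ℂ).re • X + (r : ℂ).im • h.J X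
    simp
  left_inv _ := rfl
  right_inv _ := rfl

lemma smul_toCplx (z : ℂ) (X : V) : z • h.toCplx X = h.toCplx (z.re • X + z.im • h.J X) := rfl

lemma inner_toCplx (X Y : V) :
    inner ℂ (h.toCplx X) (h.toCplx Y) = (h.g X Y : ℂ) + (h.g (h.J X) Y : ℂ) * Complex.I := rfl

instance instFiniteCplx [FiniteDimensional ℝ V] : FiniteDimensional ℂ h.Cplx :=
  haveI : FiniteDimensional ℝ h.Cplx := h.toCplx.finiteDimensional
  FiniteDimensional.right ℝ ℂ h.Cplx

/-- A real endomorphism commuting with `J` is complex linear. -/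
def cplxMap (T : V →ₗ[ℝ] V) (hT : ∀ X, T (h.J X) = h.J (T X)) : h.Cplx →ₗ[ℂ] h.Cplx where
  toFun X := h.toCplx (T (h.toCplx.symm X))
  map_add' X Y := by simp
  map_smul' z X := by
    obtain ⟨X, rfl⟩ := h.toCplx.surjective X
    rw [smul_toCplx]
    simp [smul_toCplx, hT]

end VS
end HermitianStructure

section ExteriorAlgebraPart

variable {M : Type*} [NormedAddCommGroup M] [InnerProductSpace ℂ M]

/-- The algebra homomorphism `φ ↦ φ + ε T(φ)` to the dual numbers over the exterior algebra, where
`T` stands for its extension to a derivation; on vectors it is `X ↦ X + ε T X`. -/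
def extDerivAux (T : M →ₗ[ℂ] M) : ExteriorAlgebra ℂ M →ₐ[ℂ] DualNumber (ExteriorAlgebra ℂ M) :=
  ExteriorAlgebra.lift ℂ
    ⟨(TrivSqZeroExt.inlAlgHom ℂ (ExteriorAlgebra ℂ M) (ExteriorAlgebra ℂ M)).toLinearMap ∘ₗ
        ExteriorAlgebra.ι ℂ +
      ((TrivSqZeroExt.inrHom (ExteriorAlgebra ℂ M) (ExteriorAlgebra ℂ M)).restrictScalars ℂ) ∘ₗ
        ExteriorAlgebra.ι ℂ ∘ₗ T, fun X => by
      have h := ExteriorAlgebra.ι_add_mul_swap (R := ℂ) X (T X)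
      ext
      · simp
      · simp [add_comm, h]⟩

/-- The derivation of the exterior algebra that extends the endomorphism `T` of `M`;
see `extDeriv_ι` and `extDeriv_mul`. -/
def extDeriv (T : M →ₗ[ℂ] M) : ExteriorAlgebra ℂ M →ₗ[ℂ] ExteriorAlgebra ℂ M where
  toFun φ := (extDerivAux T φ).snd
  map_add' := by simp
  map_smul' := by simp

lemma extDerivAux_fst (T : M →ₗ[ℂ] M) (φ : ExteriorAlgebra ℂ M) : (extDerivAux T φ).fst = φ := by
  have : (TrivSqZeroExt.fstHom ℂ (ExteriorAlgebra ℂ M) (ExteriorAlgebra ℂ M)).comp (extDerivAux T) =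
      AlgHom.id ℂ _ := by
    ext X
    simp [extDerivAux]
  exact congrArg (fun f : ExteriorAlgebra ℂ M →ₐ[ℂ] ExteriorAlgebra ℂ M => f φ) this

lemma extDeriv_ι (T : M →ₗ[ℂ] M) (X : M) :
    extDeriv T (ExteriorAlgebra.ι ℂ X) = ExteriorAlgebra.ι ℂ (T X) := by
  simp [extDeriv, extDerivAux]

lemma extDeriv_mul (T : M →ₗ[ℂ] M) (φ ψ : ExteriorAlgebra ℂ M) :
    extDeriv T (φ * ψ) = extDeriv T φ * ψ + φ * extDeriv T ψ := by
  simp [extDeriv, extDerivAux_fst, add_comm]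

lemma liftAlternating_single (p q : ℕ) (f : M [⋀^Fin p]→ₗ[ℂ] ℂ) (Y : Fin q → M) :
    ExteriorAlgebra.liftAlternating (R := ℂ) (Pi.single p f) (ExteriorAlgebra.ιMulti ℂ q Y) =
      if e : p = q then f (fun i => Y (Fin.cast e i)) else 0 := by
  rw [ExteriorAlgebra.liftAlternating_apply_ιMulti]
  split_ifs with e
  · subst e; simp
  · rw [Pi.single_eq_of_ne (Ne.symm e)]; rfl

variable [FiniteDimensional ℂ M]

variable (M) in
/-- The basis of the exterior algebra formed by the products `e_{j₁} ∧ ⋯ ∧ e_{jₚ}`, `j₁ < ⋯ < jₚ`, of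
elements of an orthonormal basis of `M`. -/
def extBasis : Module.Basis (Finset (Fin (Module.finrank ℂ M))) ℂ (ExteriorAlgebra ℂ M) :=
  (stdOrthonormalBasis ℂ M).toBasis.ExteriorAlgebra

/-- The inner product of the exterior algebra, conjugate linear in the first variable. It is the one
determined by `⟨X₁ ∧ ⋯ ∧ X_p, Y₁ ∧ ⋯ ∧ Y_q⟩ = δ_{pq} det ⟨X_k, Y_l⟩`; see `extInner_ιMulti`. -/
def extInner (φ ψ : ExteriorAlgebra ℂ M) : ℂ :=
  ∑ s, starRingEnd ℂ ((extBasis M).repr φ s) * (extBasis M).repr ψ s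

lemma extBasis_repr_ιMulti (t : Finset (Fin (Module.finrank ℂ M))) (q : ℕ) (Y : Fin q → M) :
    (extBasis M).repr (ExteriorAlgebra.ιMulti ℂ q Y) t =
      if e : t.card = q then
        (Matrix.of fun i j => inner ℂ (stdOrthonormalBasis ℂ M
          (Set.powersetCard.ofFinEmbEquiv.symm (Set.powersetCard.ofCard (n := t.card) rfl) j))
          (Y (Fin.cast e i))).det else 0 := by
  have key : (extBasis M).coord t = ExteriorAlgebra.liftAlternating (R := ℂ) (Pi.single t.card
      ((exteriorPower.ιMultiDual ℂ t.card (stdOrthonormalBasis ℂ M).toBasis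
        (Set.powersetCard.ofCard (n := t.card) rfl)).compAlternatingMap
          (exteriorPower.ιMulti ℂ t.card))) := by
    refine (extBasis M).ext fun s => ?_
    rw [Module.Basis.coord_apply, Module.Basis.repr_self]
    by_cases e : s.card = t.card
    · rw [extBasis, ExteriorAlgebra.basis_apply_ofCard _ e, ExteriorAlgebra.ιMulti_family,
        liftAlternating_single, dif_pos rfl]
      by_cases hst : t = s
      · subst hst
        have := exteriorPower.ιMultiDual_apply_diag ℂ t.card (stdOrthonormalBasis ℂ M).toBasis
          (Set.powersetCard.ofCard (n := t.card) rfl)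
        rw [Finsupp.single_eq_same]
        exact this.symm
      · have := exteriorPower.ιMultiDual_apply_nondiag ℂ t.card (stdOrthonormalBasis ℂ M).toBasis
          (Set.powersetCard.ofCard (n := t.card) rfl) (Set.powersetCard.ofCard e)
          (fun h => hst (congrArg Subtype.val h))
        rw [Finsupp.single_eq_of_ne hst]
        exact this.symm
    · rw [extBasis, ExteriorAlgebra.basis_apply_ofCard (n := s.card) _ rfl,
        ExteriorAlgebra.ιMulti_family,
        liftAlternating_single, dif_neg (Ne.symm e),
        Finsupp.single_eq_of_ne (fun h => e (by rw [h]))]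
  have := congrArg (fun f => f (ExteriorAlgebra.ιMulti ℂ q Y)) key
  simp only [Module.Basis.coord_apply] at this
  rw [this, liftAlternating_single]
  split_ifs with e
  · rw [LinearMap.compAlternatingMap_apply, exteriorPower.ιMultiDual_apply_ιMulti]
    congr 1
    ext i j
    simp [OrthonormalBasis.repr_apply_apply]
  · rfl

/-- The formula that determines the inner product of the exterior algebra. -/
lemma extInner_ιMulti (p q : ℕ) (X : Fin p → M) (Y : Fin q → M) :
    extInner (ExteriorAlgebra.ιMulti ℂ p X) (ExteriorAlgebra.ιMulti ℂ q Y) =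
      if e : p = q then (Matrix.of fun k l => inner ℂ (X k) (Y (Fin.cast e l))).det else 0 := by
  have key : ∑ s, starRingEnd ℂ ((extBasis M).repr (ExteriorAlgebra.ιMulti ℂ p X) s) •
      (extBasis M).coord s = ExteriorAlgebra.liftAlternating (R := ℂ) (Pi.single p
        ((exteriorPower.pairingDual ℂ M p (exteriorPower.ιMulti ℂ p
          fun k => (innerₛₗ ℂ (X k) : Module.Dual ℂ M))).compAlternatingMap
            (exteriorPower.ιMulti ℂ p))) := by
    refine (extBasis M).ext fun t => ?_
    simp only [LinearMap.sum_apply, LinearMap.smul_apply, Module.Basis.coord_apply,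
      Module.Basis.repr_self, smul_eq_mul]
    rw [Finset.sum_eq_single t (fun s _ hs => by rw [Finsupp.single_eq_of_ne hs, mul_zero])
      (by simp), Finsupp.single_eq_same, mul_one, extBasis_repr_ιMulti]
    have hb : extBasis M t = ExteriorAlgebra.ιMulti ℂ t.card (fun i => stdOrthonormalBasis ℂ M
        (Set.powersetCard.ofFinEmbEquiv.symm (Set.powersetCard.ofCard (n := t.card) rfl) i)) := by
      rw [extBasis, ExteriorAlgebra.basis_apply_ofCard (n := t.card) _ rfl,
        ← OrthonormalBasis.coe_toBasis]
      rfl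
    rw [hb, liftAlternating_single]
    by_cases e : p = t.card
    · subst e
      rw [dif_pos rfl, dif_pos rfl, LinearMap.compAlternatingMap_apply,
        exteriorPower.pairingDual_ιMulti_ιMulti, RingHom.map_det, ← Matrix.det_transpose]
      congr 1
      ext i j
      simp
    · rw [dif_neg e, dif_neg (Ne.symm e), map_zero]
  have := congrArg (fun f => f (ExteriorAlgebra.ιMulti ℂ q Y)) key
  simp only [LinearMap.sum_apply, LinearMap.smul_apply, Module.Basis.coord_apply,
    smul_eq_mul] at this
  rw [extInner, this, liftAlternating_single]
  split_ifs with e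
  · rw [LinearMap.compAlternatingMap_apply, exteriorPower.pairingDual_ιMulti_ιMulti,
      ← Matrix.det_transpose]
    congr 1
  · rfl

/-- The exterior algebra as an inner product space. -/
@[reducible]
def extCore : InnerProductSpace.Core ℂ (ExteriorAlgebra ℂ M) where
  inner := extInner
  conj_inner_symm φ ψ := by simp [extInner, mul_comm]
  re_inner_nonneg φ := by
    simp only [extInner, map_sum]
    refine Finset.sum_nonneg fun s _ => ?_
    rw [← Complex.normSq_eq_conj_mul_self]
    simpa using Complex.normSq_nonneg _
  add_left φ ψ χ := by simp [extInner, add_mul, Finset.sum_add_distrib]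
  smul_left φ ψ z := by simp [extInner, Finset.mul_sum, mul_assoc]
  definite φ h := by
    have h' : ∑ s, Complex.normSq ((extBasis M).repr φ s) = 0 := by
      have := congrArg Complex.re h
      simp only [extInner, ← Complex.normSq_eq_conj_mul_self] at this
      simpa using this
    rw [Finset.sum_eq_zero_iff_of_nonneg (fun _ _ => Complex.normSq_nonneg _)] at h'
    apply (extBasis M).ext_elem
    intro s
    simpa using h' s

end ExteriorAlgebraPart

section FockOperators

variable {M : Type*} [NormedAddCommGroup M] [InnerProductSpace ℂ M]

/-- The creation operator `φ ↦ X ∧ φ`. -/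
def fockCreate (X : M) : ExteriorAlgebra ℂ M →ₗ[ℂ] ExteriorAlgebra ℂ M :=
  LinearMap.mulLeft ℂ (ExteriorAlgebra.ι ℂ X)

/-- The annihilation operator, `X₁ ∧ ⋯ ∧ X_p ↦ ∑ⱼ (-1)^(j-1) ⟨X, Xⱼ⟩ X₁ ∧ ⋯ X̂ⱼ ⋯ ∧ X_p`;
see `fockAnnihilate_one` and `fockAnnihilate_ι_mul`. -/
def fockAnnihilate (X : M) : ExteriorAlgebra ℂ M →ₗ[ℂ] ExteriorAlgebra ℂ M :=
  CliffordAlgebra.contractLeft (Q := (0 : QuadraticForm ℂ M))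
    (innerₛₗ ℂ X : Module.Dual ℂ M)

lemma fockAnnihilate_one (X : M) : fockAnnihilate X 1 = 0 :=
  CliffordAlgebra.contractLeft_one ..

lemma fockAnnihilate_ι_mul (X Y : M) (φ : ExteriorAlgebra ℂ M) :
    fockAnnihilate X (ExteriorAlgebra.ι ℂ Y * φ) =
      inner ℂ X Y • φ - ExteriorAlgebra.ι ℂ Y * fockAnnihilate X φ :=
  CliffordAlgebra.contractLeft_ι_mul ..

/-- Clifford multiplication by `X`, namely `i` times the sum of annihilation and creation by `X`. -/
def fockClifford (X : M) : ExteriorAlgebra ℂ M →ₗ[ℂ] ExteriorAlgebra ℂ M :=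
  Complex.I • (fockAnnihilate X + fockCreate X)

lemma fockClifford_relation (X Y : M) (φ : ExteriorAlgebra ℂ M) :
    fockClifford X (fockClifford Y φ) + fockClifford Y (fockClifford X φ) =
      (-(inner ℂ X Y + inner ℂ Y X) : ℂ) • φ := by
  have h0 : ExteriorAlgebra.ι ℂ X * (ExteriorAlgebra.ι ℂ Y * φ) +
      ExteriorAlgebra.ι ℂ Y * (ExteriorAlgebra.ι ℂ X * φ) = 0 := by
    rw [← mul_assoc, ← mul_assoc, ← add_mul, ExteriorAlgebra.ι_add_mul_swap, zero_mul]
  have h1 : fockAnnihilate X (fockAnnihilate Y φ) = -fockAnnihilate Y (fockAnnihilate X φ) :=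
    CliffordAlgebra.contractLeft_comm ..
  simp only [fockClifford, fockCreate, LinearMap.smul_apply, LinearMap.add_apply, map_smul, map_add,
    LinearMap.mulLeft_apply, fockAnnihilate_ι_mul, h1, eq_neg_of_add_eq_zero_left h0]
  have hI : Complex.I * Complex.I = -1 := Complex.I_mul_I
  match_scalars
  all_goals first
    | ring1
    | linear_combination (inner ℂ X Y + inner ℂ Y X) * hI

end FockOperators

section Spinors

namespace HermitianStructure
variable {V : Type*} [AddCommGroup V] [Module ℝ V] [FiniteDimensional ℝ V]
  (h : HermitianStructure V)

/-- The space `𝒮` of spinors: the complex exterior algebra of `V_J`, with its inner product. -/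
def Spinor : Type _ := ExteriorAlgebra ℂ h.Cplx

instance instNormedSpinor : NormedAddCommGroup h.Spinor :=
  @InnerProductSpace.Core.toNormedAddCommGroup ℂ (ExteriorAlgebra ℂ h.Cplx) _ _ _ extCore

instance instInnerSpinor : InnerProductSpace ℂ h.Spinor :=
  @InnerProductSpace.ofCore ℂ (ExteriorAlgebra ℂ h.Cplx) _ _ _ extCore.toCore

/-- The identity map from the exterior algebra of `V_J` to the spinors. -/
def toSpinor : ExteriorAlgebra ℂ h.Cplx ≃ₗ[ℂ] h.Spinor where
  toFun φ := φ
  invFun φ := φ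
  map_add' _ _ := rfl
  map_smul' _ _ := rfl
  left_inv _ := rfl
  right_inv _ := rfl

instance instFiniteSpinor : FiniteDimensional ℂ h.Spinor :=
  haveI : FiniteDimensional ℂ (ExteriorAlgebra ℂ h.Cplx) := (extBasis h.Cplx).finiteDimensional_of_finite
  h.toSpinor.finiteDimensional

/-- The spinor `X₁ ∧ ⋯ ∧ X_p`. -/
def wedge (p : ℕ) (X : Fin p → V) : h.Spinor :=
  h.toSpinor (ExteriorAlgebra.ιMulti ℂ p (fun k => h.toCplx (X k)))

/-- The formula that determines the inner product of spinors. -/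
lemma inner_wedge (p q : ℕ) (X : Fin p → V) (Y : Fin q → V) :
    inner ℂ (h.wedge p X) (h.wedge q Y) = if e : p = q then (Matrix.of fun k l =>
      inner ℂ (h.toCplx (X k)) (h.toCplx (Y (Fin.cast e l)))).det else 0 :=
  extInner_ιMulti p q _ _

/-- An operator on the exterior algebra of `V_J`, as an operator on spinors. -/
def onSpinor (T : ExteriorAlgebra ℂ h.Cplx →ₗ[ℂ] ExteriorAlgebra ℂ h.Cplx) :
    h.Spinor →ₗ[ℂ] h.Spinor :=
  h.toSpinor.toLinearMap ∘ₗ T ∘ₗ h.toSpinor.symm.toLinearMap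

/-- The Clifford action `κ(X)` of a vector `X` of `V` on spinors; see `clifford_relation`. -/
def cliffordAction (X : V) : h.Spinor →ₗ[ℂ] h.Spinor := h.onSpinor (fockClifford (h.toCplx X))

/-- The exterior algebra endomorphism of spinors induced by an endomorphism of `V_J`. -/
def spinorMap (T : h.Cplx →ₗ[ℂ] h.Cplx) : h.Spinor →ₗ[ℂ] h.Spinor :=
  h.onSpinor (ExteriorAlgebra.map T).toLinearMap

/-- The exterior algebra derivation of spinors that extends an endomorphism of `V_J`. -/
def spinorDeriv (T : h.Cplx →ₗ[ℂ] h.Cplx) : h.Spinor →ₗ[ℂ] h.Spinor := h.onSpinor (extDeriv T)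

/-- The relation `XY + YX = -2 g(X, Y)`, so that `κ` is a representation of the Clifford algebra. -/
lemma clifford_relation (X Y : V) (φ : h.Spinor) :
    h.cliffordAction X (h.cliffordAction Y φ) + h.cliffordAction Y (h.cliffordAction X φ) =
      (-2 * h.g X Y : ℂ) • φ := by
  have h2 : (-(inner ℂ (h.toCplx X) (h.toCplx Y) + inner ℂ (h.toCplx Y) (h.toCplx X)) : ℂ)
      = -2 * h.g X Y := by
    rw [h.inner_toCplx, h.inner_toCplx, h.g_J_left Y X, h.g_symm Y (h.J X), h.g_symm Y X]
    push_cast; ring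
  rw [← h2]
  exact fockClifford_relation (h.toCplx X) (h.toCplx Y) φ

end HermitianStructure
end Spinors
end HermitianPart
noncomputable section HomogeneousPart

set_option linter.unusedSectionVars false

variable {E : Type*} [NormedAddCommGroup E] [NormedSpace ℝ E]
  {G : Type*} [TopologicalSpace G] [ChartedSpace E G] [Group G] [LieGroup 𝓘(ℝ, E) ∞ G]

/-- The coadjoint action: `(Ad'_g μ)(X) = μ(Ad_{g⁻¹} X)`. -/
def coAd (g : G) (μ : Module.Dual ℝ (LieAlg E G)) : Module.Dual ℝ (LieAlg E G) := μ ∘ₗ Ad E g⁻¹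

/-- The stability subgroup `K` of `μ` for the coadjoint action. -/
def stabilizer (μ : Module.Dual ℝ (LieAlg E G)) : Subgroup G where
  carrier := {s | coAd s μ = μ}
  one_mem' := by
    ext X
    simp [coAd, Ad_one_apply]
  mul_mem' {s t} hs ht := by
    ext X
    have h1 := LinearMap.congr_fun (show coAd s μ = μ from hs) X
    have h2 := LinearMap.congr_fun (show coAd t μ = μ from ht) (Ad E s⁻¹ X)
    simp only [coAd, LinearMap.comp_apply] at h1 h2 ⊢
    rw [mul_inv_rev, Ad_mul_apply, h2, h1]
  inv_mem' {s} hs := by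
    ext X
    have h1 := LinearMap.congr_fun (show coAd s μ = μ from hs) (Ad E s X)
    simp only [coAd, LinearMap.comp_apply, Ad_inv_Ad, inv_inv] at h1 ⊢
    exact h1.symm

variable (E) in
/-- The Lie algebra `𝔨` of a subgroup `K`: the velocities at `0` of the smooth one-parameter subgroups
of `G` that lie in `K`. -/
def lieOf (K : Subgroup G) : Set (LieAlg E G) :=
  {X | ∃ γ : ℝ → G, ContMDiff 𝓘(ℝ, ℝ) 𝓘(ℝ, E) ∞ γ ∧ (∀ s t, γ (s + t) = γ s * γ t) ∧
    (∀ t, γ t ∈ K) ∧ (mfderiv 𝓘(ℝ, ℝ) 𝓘(ℝ, E) γ 0 : ℝ →L[ℝ] E) 1 = X}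

lemma Ad_mem_lieOf {K : Subgroup G} {s : G} (hs : s ∈ K) {X : LieAlg E G} (hX : X ∈ lieOf E K) :
    Ad E s X ∈ lieOf E K := by
  obtain ⟨γ, h1, h2, h3, h4⟩ := hX
  refine ⟨fun t => s * γ t * s⁻¹, (contMDiff_conj s).comp h1, fun a b => by
    simp [h2], fun t => K.mul_mem (K.mul_mem hs (h3 t)) (K.inv_mem hs), ?_⟩
  have h0 : γ 0 = 1 := by simpa using h2 0 0
  have k := mfderiv_comp (I := 𝓘(ℝ, ℝ)) (I' := 𝓘(ℝ, E)) (I'' := 𝓘(ℝ, E)) (0 : ℝ)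
    ((contMDiff_conj (E := E) s).mdifferentiable (by simp) (γ 0))
    (h1.mdifferentiable (by simp) 0)
  change (mfderiv 𝓘(ℝ, ℝ) 𝓘(ℝ, E) ((fun x : G => s * x * s⁻¹) ∘ γ) 0 : ℝ →L[ℝ] E) 1 = _
  rw [k]
  refine (mfderiv_congr_point h0 _ _).trans ?_
  exact congrArg (Ad E s) h4

variable [CompleteSpace E]

variable (E) in
/-- `𝔪`, the orthogonal complement of `𝔨` in `𝔤` for `Kil`. (As a vector space `𝔤` is `E`, whose norm
serves to speak of smooth functions with values in `𝔪`.) -/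
def tangent (K : Subgroup G) : Submodule ℝ E where
  carrier := {X | ∀ Y ∈ lieOf E K, Kil E G Y X = 0}
  zero_mem' Y _ := (Kil E G Y).map_zero
  add_mem' {X X'} hX hX' Y hY := by
    have := (Kil E G Y).map_add X X'
    rw [hX Y hY, hX' Y hY, add_zero] at this
    exact this
  smul_mem' r X hX Y hY := by
    have := (Kil E G Y).map_smul r X
    rw [hX Y hY, smul_zero] at this
    exact this

/-- The adjoint action of `s ∈ K` on `𝔪`. -/
def adTangent {K : Subgroup G} (s : K) : tangent E K →ₗ[ℝ] tangent E K :=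
  LinearMap.restrict (show E →ₗ[ℝ] E from Ad E (s : G)) (fun X hX Y hY => by
    have h1 := hX (Ad E (s : G)⁻¹ Y) (Ad_mem_lieOf (K.inv_mem s.2) hY)
    have h2 := Kil_Ad (s : G) (Ad E (s : G)⁻¹ Y) X
    rw [Ad_Ad_inv, h1] at h2
    exact h2)

variable (E) in
/-- A homogeneous almost Hermitian structure on `G/K`: an inner product and an orthogonal complex
structure on `𝔪`, both invariant under the adjoint action of `K`. -/
structure AlmostHermitian (K : Subgroup G) extends HermitianStructure (tangent E K) where
  J_Ad : ∀ (s : K) X, J (adTangent s X) = adTangent s (J X)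
  g_Ad : ∀ (s : K) X Y, g (adTangent s X) (adTangent s Y) = g X Y

/-- The Kirillov–Kostant–Souriau form `ω(X, Y) = μ([X, Y])`. -/
def kks (μ : Module.Dual ℝ (LieAlg E G)) (X Y : LieAlg E G) : ℝ := μ ⁅X, Y⁆

/-- `H` is the canonical Kähler structure `(g_⋄, J_⋄)` of the coadjoint orbit of `μ`: if `Γ` is the
operator on `𝔪` with `ω(X, Y) = Kil(Γ X, Y)`, then `Γ = |Γ| J_⋄` is its polar decomposition for `Kil`
(`|Γ|` symmetric and positive, `J_⋄` orthogonal), and `g_⋄(X, Y) = ω(X, J_⋄ Y)`. -/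
structure IsKahler (μ : Module.Dual ℝ (LieAlg E G)) (H : AlmostHermitian E (stabilizer μ)) :
    Prop where
  polar : ∃ Γ absΓ : tangent E (stabilizer μ) →ₗ[ℝ] tangent E (stabilizer μ),
    (∀ X Y : tangent E (stabilizer μ), kks μ (X : E) (Y : E) = Kil E G (Γ X : E) (Y : E)) ∧
    (∀ X, Γ X = absΓ (H.J X)) ∧
    (∀ X Y : tangent E (stabilizer μ), Kil E G (absΓ X : E) (Y : E) = Kil E G (X : E) (absΓ Y : E)) ∧
    (∀ X : tangent E (stabilizer μ), 0 ≤ Kil E G (absΓ X : E) (X : E)) ∧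
    (∀ X Y : tangent E (stabilizer μ), Kil E G (H.J X : E) (H.J Y : E) = Kil E G (X : E) (Y : E))
  metric : ∀ X Y : tangent E (stabilizer μ), H.g X Y = kks μ (X : E) (H.J Y : E)

/-- The derivative at `x` of `f` along the left-invariant vector field of `X ∈ 𝔤`, that is, the
derivative of `f (x exp (t X))` at `t = 0`. -/
def dirDeriv {F : Type*} [NormedAddCommGroup F] [NormedSpace ℝ F] (X : E) (f : G → F) (x : G) : F :=
  (mfderiv 𝓘(ℝ, E) 𝓘(ℝ, F) f x : E →L[ℝ] F) (mulInvariantVectorField (X : LieAlg E G) x)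

variable (E) in
/-- The algebra `A` of smooth real functions on `G/K`, as right `K`-invariant functions on `G`. -/
def Functions (K : Subgroup G) : Subalgebra ℝ (G → ℝ) where
  carrier := {f | ContMDiff 𝓘(ℝ, E) 𝓘(ℝ, ℝ) ∞ f ∧ ∀ (x : G) (s : K), f (x * s) = f x}
  mul_mem' {f f'} hf hf' := ⟨hf.1.mul hf'.1, fun x s => by simp [hf.2, hf'.2]⟩
  add_mem' {f f'} hf hf' := ⟨hf.1.add hf'.1, fun x s => by simp [hf.2, hf'.2]⟩
  algebraMap_mem' r := ⟨contMDiff_const, fun _ _ => rfl⟩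

variable (E) in
/-- The tangent vector fields of `G/K`: the smooth `V : G → 𝔪` with `V(x s) = Ad_s⁻¹ V(x)` for `s ∈ K`. -/
def VectorFields (K : Subgroup G) : Submodule ℝ (G → tangent E K) where
  carrier := {V | ContMDiff 𝓘(ℝ, E) 𝓘(ℝ, tangent E K) ∞ V ∧
    ∀ (x : G) (s : K), V (x * s) = adTangent s⁻¹ (V x)}
  zero_mem' := ⟨contMDiff_const, fun _ _ => by simp⟩
  add_mem' {V W} hV hW := ⟨hV.1.add hW.1, fun x s => by simp [hV.2, hW.2]⟩
  smul_mem' r V hV := ⟨by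
    have := (ContinuousLinearMap.contMDiff (n := ∞)
      (r • ContinuousLinearMap.id ℝ (tangent E K))).comp hV.1
    exact this, fun x s => by simp [hV.2]⟩

/-- The product of a vector field by a function on `G/K`. -/
def mulField {K : Subgroup G} (f : Functions E K) (V : VectorFields E K) : VectorFields E K :=
  ⟨fun x => f.1 x • V.1 x, ⟨f.2.1.smul V.2.1, fun x s => by simp [f.2.2, V.2.2]⟩⟩

/-- The action of `G` on vector fields by translation: `(λ_y V)(x) = V(y⁻¹ x)`. -/
def translate {K : Subgroup G} (y : G) (V : VectorFields E K) : VectorFields E K :=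
  ⟨fun x => V.1 (y⁻¹ * x), ⟨V.2.1.comp contMDiff_mul_left, fun x s => by
    change V.1 (y⁻¹ * (x * s)) = adTangent s⁻¹ (V.1 (y⁻¹ * x))
    rw [← mul_assoc, V.2.2]⟩⟩

/-- The derivative `δ_V f` of a function on `G/K` along a vector field. -/
def diffFun {K : Subgroup G} (V : VectorFields E K) (f : Functions E K) (x : G) : ℝ :=
  dirDeriv (V.1 x : E) f.1 x

variable (E) in
/-- A connection on the tangent bundle of `G/K`: `∇_V W` is `toFun V W`. -/
structure Connection (K : Subgroup G) where
  toFun : VectorFields E K → VectorFields E K → VectorFields E K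
  add_left : ∀ V V' W, toFun (V + V') W = toFun V W + toFun V' W
  smul_left : ∀ f V W, toFun (mulField f V) W = mulField f (toFun V W)
  add_right : ∀ V W W', toFun V (W + W') = toFun V W + toFun V W'
  leibniz : ∀ V (f : Functions E K) W x,
    (toFun V (mulField f W)).1 x = diffFun V f x • W.1 x + f.1 x • (toFun V W).1 x

variable [FiniteDimensional ℝ E]

/-- The pointwise action of `J` on vector fields. -/
def AlmostHermitian.JField {K : Subgroup G} (H : AlmostHermitian E K) (V : VectorFields E K) :
    VectorFields E K :=
  ⟨fun x => H.J (V.1 x), ⟨(LinearMap.toContinuousLinearMap H.J).contMDiff.comp V.2.1, fun x s => by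
    change H.J (V.1 (x * s)) = adTangent s⁻¹ (H.J (V.1 x))
    rw [V.2.2, H.J_Ad]⟩⟩

namespace Connection
variable {K : Subgroup G}

/-- `∇` is `G`-invariant. -/
def IsInvariant (D : Connection E K) : Prop :=
  ∀ y V W, translate y (D.toFun V W) = D.toFun (translate y V) (translate y W)

/-- `∇` is compatible with the Riemannian metric: `δ_U g(V, W) = g(∇_U V, W) + g(V, ∇_U W)`. -/
def IsCompatible (D : Connection E K) (H : AlmostHermitian E K) : Prop :=
  ∀ (U V W : VectorFields E K) (x : G),
    dirDeriv (U.1 x : E) (fun z => H.g (V.1 z) (W.1 z)) x =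
      H.g ((D.toFun U V).1 x) (W.1 x) + H.g (V.1 x) ((D.toFun U W).1 x)

/-- `∇` commutes with `J`. -/
def CommutesWithJ (D : Connection E K) (H : AlmostHermitian E K) : Prop :=
  ∀ V W, D.toFun V (H.JField W) = H.JField (D.toFun V W)

/-- The endomorphism `L_V(x)` of `𝔪_J` with `(∇_V W - ∇ᶜ_V W)(x) = L_V(x) (W(x))` for all `W`, where
`(∇ᶜ_V W)(x)` is the derivative of `W` at `x` along `V(x)` (the canonical connection). It exists when
`∇` commutes with `J`, because `∇ - ∇ᶜ` is linear over the functions on `G/K`, and it is unique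
because every vector of `𝔪` is the value at `x` of a vector field. -/
def form (D : Connection E K) (H : AlmostHermitian E K) (V : VectorFields E K) (x : G) :
    H.Cplx →ₗ[ℂ] H.Cplx :=
  Classical.epsilon fun T => ∀ W : VectorFields E K,
    T (H.toCplx (W.1 x)) = H.toCplx ((D.toFun V W).1 x - dirDeriv (V.1 x : E) W.1 x)

end Connection

namespace AlmostHermitian
variable {K : Subgroup G}

/-- The action of `s ∈ K` on spinors induced by its adjoint action on `𝔪_J`. -/
def spinorAd (H : AlmostHermitian E K) (s : K) : H.Spinor →ₗ[ℂ] H.Spinor :=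
  H.spinorMap (H.cplxMap (adTangent s) (fun X => (H.J_Ad s X).symm))

/-- The spinor fields on `G/K` for the character `χ` of `K`: the smooth `ψ : G → 𝒮` such that
`ψ(x s) = χ̄(s) Ad_s⁻¹ ψ(x)` for `s ∈ K`. -/
def SpinorFields (H : AlmostHermitian E K) (χ : K →ₜ* Circle) : Submodule ℂ (G → H.Spinor) where
  carrier := {ψ | ContMDiff 𝓘(ℝ, E) 𝓘(ℝ, H.Spinor) ∞ ψ ∧
    ∀ (x : G) (s : K), ψ (x * s) = starRingEnd ℂ (χ s : ℂ) • H.spinorAd s⁻¹ (ψ x)}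
  zero_mem' := ⟨contMDiff_const, fun _ _ => by simp⟩
  add_mem' {ψ φ} hψ hφ := ⟨hψ.1.add hφ.1, fun x s => by simp [hψ.2, hφ.2]⟩
  smul_mem' z ψ hψ := ⟨by
    have := ((ContinuousLinearMap.restrictScalars ℝ
      (z • ContinuousLinearMap.id ℂ H.Spinor)).contMDiff (n := ∞)).comp hψ.1
    exact this, fun x s => by simp [hψ.2, smul_comm z]⟩

/-- The connection on spinor fields induced by `∇`: `∇ˢ_V ψ = ∇ᶜ_V ψ + L_V ψ`, where `∇ᶜ_V ψ` is the
derivative of `ψ` along `V` and `L_V(x)` acts on spinors as a derivation. -/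
def spinorConnection (H : AlmostHermitian E K) (D : Connection E K) (V : VectorFields E K)
    (ψ : G → H.Spinor) (x : G) : H.Spinor :=
  dirDeriv (V.1 x : E) ψ x + H.spinorDeriv (D.form H V x) (ψ x)

/-- `𝒟` is the Dirac operator of `∇` and `χ`, that is `𝒟 ψ = κ(grad ψ)`. Here `grad ψ = ∑ₖ Uₖ ⊗ φₖ` is
the tensor that the metric identifies with `V ↦ ∇ˢ_V ψ`, so `∇ˢ_V ψ = ∑ₖ g(Uₖ, V) φₖ` for all `V`, and
`κ(grad ψ) = ∑ₖ κ(Uₖ) φₖ`. -/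
def IsDirac (H : AlmostHermitian E K) (D : Connection E K) (χ : K →ₜ* Circle)
    (𝒟 : H.SpinorFields χ →ₗ[ℂ] H.SpinorFields χ) : Prop :=
  ∀ ψ : H.SpinorFields χ, ∃ (n : ℕ) (U : Fin n → VectorFields E K) (φ : Fin n → H.SpinorFields χ),
    (∀ (V : VectorFields E K) (x : G),
      H.spinorConnection D V ψ.1 x = ∑ k, (H.g ((U k).1 x) (V.1 x) : ℂ) • (φ k).1 x) ∧
    ∀ x, (𝒟 ψ).1 x = ∑ k, H.cliffordAction ((U k).1 x) ((φ k).1 x)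

/-- `⟨𝒟 ψ, φ⟩ = ⟨ψ, 𝒟 φ⟩` for all spinor fields, for the `L²` inner product given by the invariant
measure `ν`; the integrand is a right `K`-invariant function, and its integral over `G/K` is the
integral over `G`. -/
def IsFormallySelfAdjoint [MeasurableSpace G] (ν : MeasureTheory.Measure G) (H : AlmostHermitian E K)
    (χ : K →ₜ* Circle) (𝒟 : H.SpinorFields χ →ₗ[ℂ] H.SpinorFields χ) : Prop :=
  ∀ ψ φ : H.SpinorFields χ,
    ∫ x, inner ℂ ((𝒟 ψ).1 x) (φ.1 x) ∂ν = ∫ x, inner ℂ (ψ.1 x) ((𝒟 φ).1 x) ∂ν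

end AlmostHermitian
end HomogeneousPart

end CoadjointDirac
open CoadjointDirac

/-! Lifted to `G`, the problem gets constant coefficients. The difference between ∇ and the plain
derivative ∂ is linear over the functions on G/K in both arguments, and G-invariance makes it a
single bilinear map A on 𝔪 (`Connection.tensor`, `Connection.IsInvariant.diff_eq`). Compatibility
with g makes A(X) skew, commutation with J makes it complex linear, and K-equivariance of fields
makes A equivariant. For a fixed g-orthonormal basis e_j of 𝔪 the Dirac operator is ∑ κ(e_j)(∂_{e_j}
+ A(e_j)) (`IsDirac.apply_eq`), even though the constant functions e_j are in general not vector
fields on G/K.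

On the exterior algebra, κ(X) and the derivation extending a skew-Hermitian T are both
skew-Hermitian, and their commutator is κ(TX) (`extInner_fockClifford`, `extInner_extDeriv`,
`extDeriv_fockClifford`). So, pointwise on `G`, ⟨Dψ, φ⟩ − ⟨ψ, Dφ⟩ = −∑ ∂_{e_j}⟨ψ, κ(e_j)φ⟩ + ⟨ψ, κ(∑
A(e_j)e_j)φ⟩. The derivatives integrate to zero, because left-invariant fields generate right
translations and Haar measure on a compact group is right invariant (`integral_dirDeriv`). The
vector ∑ A(e_j)e_j does not depend on the orthonormal basis, so K fixes it. But K contains the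
one-parameter group of the element Z that represents μ for Kil, and a vector of 𝔪 commuting with Z
lies in 𝔨 ∩ 𝔪 = 0 (`eq_zero_of_adE_fixed`). No condition on the torsion is needed.

The existence and uniqueness claims rest on two facts. First, averaging over `G` shows that Kil is
positive definite (`kilE_isInner`); since 𝔨 is the kernel of ω on 𝔤 (`mem_lieOf_stabilizer_iff`), ω
is nondegenerate on 𝔪, and its polar decomposition exists, is unique, and is therefore K-invariant.
Second, the projections to 𝔪 of a fixed orthonormal basis of 𝔤 give finitely many global fields that
span every tangent space (`field_eq_sum`), which replaces local frames and cut-off functions. -/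

namespace CoadjointDirac

/-! ### Derivatives along left-invariant fields and their behaviour under translations. -/

noncomputable section LieGroupCalculus

set_option linter.unusedSectionVars false
set_option linter.style.haveILetI false

variable {E : Type*} [NormedAddCommGroup E] [NormedSpace ℝ E]
  {G : Type*} [TopologicalSpace G] [ChartedSpace E G] [Group G]
  {F : Type*} [NormedAddCommGroup F] [NormedSpace ℝ F]
  {F' : Type*} [NormedAddCommGroup F'] [NormedSpace ℝ F']

/-- At a constant base point the change of tangent coordinates is that of a chart with itself.
Smoothness of a family of derivatives then means smoothness of a map into `E →L[ℝ] F`. -/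
lemma inTangentCoordinates_const {N : Type*} [IsManifold 𝓘(ℝ, E) 1 G] (p : G) (A : N → E →L[ℝ] F)
    (f : N → F) (x₀ : N) :
    inTangentCoordinates 𝓘(ℝ, E) 𝓘(ℝ, F) (fun _ : N => p) f A x₀ = A := by
  ext1 x
  refine (inTangentCoordinates_eq (I := 𝓘(ℝ, E)) (I' := 𝓘(ℝ, F)) (fun _ : N => p) f A (x₀ := x₀)
    (x := x) (mem_chart_source E p) (by
      rw [chartAt_self_eq]; exact Set.mem_univ _)).trans ?_
  ext v
  simp only [ContinuousLinearMap.comp_apply]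
  rw [(tangentBundleCore 𝓘(ℝ, E) G).coordChange_self _ _ (mem_chart_source E p)]
  simp

variable [LieGroup 𝓘(ℝ, E) ∞ G]

lemma mdifferentiableAt_mul_left (x y : G) :
    MDifferentiableAt 𝓘(ℝ, E) 𝓘(ℝ, E) (fun y : G => x * y) y :=
  (contMDiff_mul_left (I := 𝓘(ℝ, E)) (n := ∞)).mdifferentiable (by simp) y

lemma mdifferentiableAt_mul_right (x y : G) :
    MDifferentiableAt 𝓘(ℝ, E) 𝓘(ℝ, E) (fun y : G => y * x) y :=
  (contMDiff_mul_right (I := 𝓘(ℝ, E)) (n := ∞)).mdifferentiable (by simp) y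

lemma mdifferentiableAt_conj (x y : G) :
    MDifferentiableAt 𝓘(ℝ, E) 𝓘(ℝ, E) (fun y : G => x * y * x⁻¹) y :=
  (contMDiff_conj x).mdifferentiable (by simp) y

lemma mulInvariantVectorField_one (v : LieAlg E G) :
    (mulInvariantVectorField (I := 𝓘(ℝ, E)) v (1 : G) : E) = v := by
  have e : (fun y : G => (1 : G) * y) = id := by ext; simp
  change (mfderiv 𝓘(ℝ, E) 𝓘(ℝ, E) (fun y : G => (1 : G) * y) 1 : E →L[ℝ] E) v = v
  rw [e, mfderiv_id]; rfl

lemma dirDeriv_one (X : E) (f : G → F) :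
    dirDeriv X f 1 = (mfderiv 𝓘(ℝ, E) 𝓘(ℝ, F) f 1 : E →L[ℝ] F) X :=
  congrArg (mfderiv 𝓘(ℝ, E) 𝓘(ℝ, F) f 1 : E →L[ℝ] F) (mulInvariantVectorField_one (G := G) X)

/-- The chain rule moves the derivative to the identity, where the direction no longer varies with
`x`. -/
lemma dirDeriv_eq_translate (X : E) {f : G → F} {x : G}
    (hf : MDifferentiableAt 𝓘(ℝ, E) 𝓘(ℝ, F) f x) :
    dirDeriv X f x = (mfderiv 𝓘(ℝ, E) 𝓘(ℝ, F) (fun y => f (x * y)) 1 : E →L[ℝ] F) X := by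
  have hf' : MDifferentiableAt 𝓘(ℝ, E) 𝓘(ℝ, F) f (x * 1) := by rwa [mul_one]
  have k := mfderiv_comp (I := 𝓘(ℝ, E)) (I' := 𝓘(ℝ, E)) (I'' := 𝓘(ℝ, F)) (1 : G) hf'
    (mdifferentiableAt_mul_left x 1)
  change _ = (mfderiv 𝓘(ℝ, E) 𝓘(ℝ, F) (f ∘ fun y => x * y) 1 : E →L[ℝ] F) X
  rw [k, mul_one]
  rfl

/-- The derivative at `1` of a function on `G`. -/
def derivOne (f : G → F) : E →L[ℝ] F := mfderiv 𝓘(ℝ, E) 𝓘(ℝ, F) f 1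

/-- The derivative at `1` of a self-map of `G`, read in the charts at `1` and at the image of `1`. -/
def derivOneSelf (f : G → G) : E →L[ℝ] E := mfderiv 𝓘(ℝ, E) 𝓘(ℝ, E) f 1

lemma dirDeriv_eq_derivOne (X : E) {f : G → F} {x : G}
    (hf : MDifferentiableAt 𝓘(ℝ, E) 𝓘(ℝ, F) f x) :
    dirDeriv X f x = derivOne (fun y => f (x * y)) X := dirDeriv_eq_translate X hf

lemma dirDeriv_one_eq_derivOne (X : E) (f : G → F) : dirDeriv X f 1 = derivOne f X :=
  dirDeriv_one X f

/-- All the maps fix `1`, so source and target charts stay the same and both coordinate changes are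
trivial. -/
lemma inTangentCoordinates_derivOneSelf [IsManifold 𝓘(ℝ, E) 1 G] (f : G → G → G)
    (hf : ∀ x, f x 1 = 1) (x₀ : G) :
    inTangentCoordinates 𝓘(ℝ, E) 𝓘(ℝ, E) (fun _ : G => (1 : G)) (fun x : G => f x 1)
      (fun x => mfderiv 𝓘(ℝ, E) 𝓘(ℝ, E) (f x) 1) x₀ = fun x => derivOneSelf (f x) := by
  ext1 z
  refine (inTangentCoordinates_eq (I := 𝓘(ℝ, E)) (I' := 𝓘(ℝ, E)) (fun _ : G => (1 : G))
    (fun x : G => f x 1) (fun x => derivOneSelf (f x)) (x₀ := x₀)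
    (x := z) (mem_chart_source E _) (by rw [hf, hf]; exact mem_chart_source E _)).trans ?_
  ext v
  simp only [ContinuousLinearMap.comp_apply]
  rw [(tangentBundleCore 𝓘(ℝ, E) G).coordChange_self _ _ (mem_chart_source E (1 : G)), hf, hf,
    (tangentBundleCore 𝓘(ℝ, E) G).coordChange_self _ _ (mem_chart_source E (1 : G))]

lemma contMDiffAt_derivOne {f : G → G → F} {x : G}
    (hf : ContMDiffAt (𝓘(ℝ, E).prod 𝓘(ℝ, E)) 𝓘(ℝ, F) ∞ (Function.uncurry f) (x, 1)) :
    ContMDiffAt 𝓘(ℝ, E) 𝓘(ℝ, E →L[ℝ] F) ∞ (fun z => derivOne (E := E) (f z)) x := by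
  haveI : IsManifold 𝓘(ℝ, E) 1 G := IsManifold.of_le (n := ∞) (by simp)
  have h2 := ContMDiffAt.mfderiv (m := ∞) (n := ∞) f (fun _ => (1 : G)) hf
    contMDiffAt_const (by simp)
  rw [← inTangentCoordinates_const (1 : G) (fun z : G => derivOne (E := E) (f z))
    (fun z : G => f z 1) x]
  exact h2

lemma contMDiffAt_comp_mul {f : G → F} {x y : G}
    (hf : ContMDiffAt 𝓘(ℝ, E) 𝓘(ℝ, F) ∞ f (x * y)) :
    ContMDiffAt (𝓘(ℝ, E).prod 𝓘(ℝ, E)) 𝓘(ℝ, F) ∞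
      (Function.uncurry fun x y : G => f (x * y)) (x, y) :=
  ContMDiffAt.comp (g := f) (x, y) hf (contMDiff_mul 𝓘(ℝ, E) ∞).contMDiffAt

lemma ContMDiffAt.dirDeriv (X : E) {f : G → F} {x : G}
    (hf : ContMDiffAt 𝓘(ℝ, E) 𝓘(ℝ, F) ∞ f x) :
    ContMDiffAt 𝓘(ℝ, E) 𝓘(ℝ, F) ∞ (CoadjointDirac.dirDeriv X f) x := by
  have h2' := contMDiffAt_derivOne (f := fun x y : G => f (x * y))
    (contMDiffAt_comp_mul (x := x) (y := 1) (by rwa [mul_one]))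
  have h3 : ContMDiffAt 𝓘(ℝ, E) 𝓘(ℝ, F) ∞ (fun z => derivOne (E := E) (fun y => f (z * y)) X) x :=
    (ContinuousLinearMap.apply ℝ F X).contMDiff.contMDiffAt.comp x h2'
  refine h3.congr_of_eventuallyEq ?_
  -- Only smoothness of finite order at a point spreads to a neighbourhood; order 1 is enough to
  -- translate the derivative at nearby points.
  filter_upwards [(contMDiffAt_iff_contMDiffAt_nhds (n := 1) (by simp)).1 (hf.of_le (by simp))] with z hz
  exact dirDeriv_eq_derivOne X (hz.mdifferentiableAt (by simp))

lemma ContMDiff.dirDeriv (X : E) {f : G → F} (hf : ContMDiff 𝓘(ℝ, E) 𝓘(ℝ, F) ∞ f) :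
    ContMDiff 𝓘(ℝ, E) 𝓘(ℝ, F) ∞ (CoadjointDirac.dirDeriv X f) :=
  fun x => ContMDiffAt.dirDeriv X (hf x)

lemma dirDeriv_add_vec (X Y : E) (f : G → F) (x : G) :
    dirDeriv (X + Y) f x = dirDeriv X f x + dirDeriv Y f x := by
  have h := congrFun (mulInvariantVectorField_add (I := 𝓘(ℝ, E)) (G := G) X Y) x
  exact (congrArg (mfderiv 𝓘(ℝ, E) 𝓘(ℝ, F) f x : E →L[ℝ] F) h).trans (map_add _ _ _)

lemma dirDeriv_smul_vec (c : ℝ) (X : E) (f : G → F) (x : G) :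
    dirDeriv (c • X) f x = c • dirDeriv X f x := by
  have h := congrFun (mulInvariantVectorField_smul (I := 𝓘(ℝ, E)) (G := G) c X) x
  exact (congrArg (mfderiv 𝓘(ℝ, E) 𝓘(ℝ, F) f x : E →L[ℝ] F) h).trans (map_smul _ _ _)

/-- The derivative of `f` at `x` as a linear function of the direction. -/
def dirDerivₗ (f : G → F) (x : G) : E →ₗ[ℝ] F where
  toFun X := dirDeriv X f x
  map_add' X Y := dirDeriv_add_vec X Y f x
  map_smul' c X := dirDeriv_smul_vec c X f x

lemma dirDeriv_congr {X : E} {f f' : G → F} {x : G} (h : f =ᶠ[nhds x] f') :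
    dirDeriv X f x = dirDeriv X f' x := by
  unfold dirDeriv
  rw [h.mfderiv_eq]
  rfl

lemma dirDeriv_const (X : E) (c : F) (x : G) : dirDeriv X (fun _ : G => c) x = 0 := by
  unfold dirDeriv
  rw [mfderiv_const]; rfl

lemma dirDeriv_clm_comp (X : E) (A : F →L[ℝ] F') {f : G → F} {x : G}
    (hf : MDifferentiableAt 𝓘(ℝ, E) 𝓘(ℝ, F) f x) :
    dirDeriv X (fun y => A (f y)) x = A (dirDeriv X f x) := by
  have h := (A.hasMFDerivAt (x := f x)).comp x hf.hasMFDerivAt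
  unfold dirDeriv
  change (mfderiv 𝓘(ℝ, E) 𝓘(ℝ, F') (A ∘ f) x : E →L[ℝ] F') _ = _
  rw [h.mfderiv]; rfl

lemma dirDeriv_add (X : E) {f f' : G → F} {x : G}
    (hf : MDifferentiableAt 𝓘(ℝ, E) 𝓘(ℝ, F) f x) (hf' : MDifferentiableAt 𝓘(ℝ, E) 𝓘(ℝ, F) f' x) :
    dirDeriv X (fun y => f y + f' y) x = dirDeriv X f x + dirDeriv X f' x := by
  have h := hf.hasMFDerivAt.add hf'.hasMFDerivAt
  unfold dirDeriv
  change (mfderiv 𝓘(ℝ, E) 𝓘(ℝ, F) (f + f') x : E →L[ℝ] F) _ = _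
  rw [h.mfderiv]; rfl

lemma dirDeriv_bilin {F₁ F₂ : Type*} [NormedAddCommGroup F₁] [NormedSpace ℝ F₁]
    [NormedAddCommGroup F₂] [NormedSpace ℝ F₂] (X : E) (B : F₁ →L[ℝ] F₂ →L[ℝ] F) {f : G → F₁}
    {f' : G → F₂} {x : G}
    (hf : MDifferentiableAt 𝓘(ℝ, E) 𝓘(ℝ, F₁) f x) (hf' : MDifferentiableAt 𝓘(ℝ, E) 𝓘(ℝ, F₂) f' x) :
    dirDeriv X (fun y => B (f y) (f' y)) x = B (dirDeriv X f x) (f' x) + B (f x) (dirDeriv X f' x) := by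
  have hB : HasFDerivAt (fun p : F₁ × F₂ => B p.1 p.2) (B.deriv₂ (f x, f' x)) (f x, f' x) :=
    B.hasFDerivAt_of_bilinear (hasFDerivAt_fst) (hasFDerivAt_snd) |>.congr_fderiv (by ext <;> simp)
  have h1 : HasMFDerivAt 𝓘(ℝ, E) 𝓘(ℝ, F₁ × F₂) (fun y => (f y, f' y)) x
      ((mfderiv 𝓘(ℝ, E) 𝓘(ℝ, F₁) f x : E →L[ℝ] F₁).prod
        (mfderiv 𝓘(ℝ, E) 𝓘(ℝ, F₂) f' x : E →L[ℝ] F₂)) := by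
    rw [modelWithCornersSelf_prod, ← chartedSpaceSelf_prod]
    exact hf.hasMFDerivAt.prodMk hf'.hasMFDerivAt
  have h := HasMFDerivAt.comp (I' := 𝓘(ℝ, F₁ × F₂)) x hB.hasMFDerivAt h1
  unfold dirDeriv
  change (mfderiv 𝓘(ℝ, E) 𝓘(ℝ, F) ((fun p : F₁ × F₂ => B p.1 p.2) ∘ fun y => (f y, f' y)) x : E →L[ℝ] F) _ = _
  rw [h.mfderiv, add_comm]; rfl

lemma dirDeriv_comp_mul_left (X : E) (y : G) {f : G → F} {x : G}
    (hf : MDifferentiableAt 𝓘(ℝ, E) 𝓘(ℝ, F) f (y * x)) :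
    dirDeriv X (fun z => f (y * z)) x = dirDeriv X f (y * x) := by
  have hf' : MDifferentiableAt 𝓘(ℝ, E) 𝓘(ℝ, F) (fun z => f (y * z)) x :=
    hf.comp x (mdifferentiableAt_mul_left y x)
  rw [dirDeriv_eq_derivOne X hf, dirDeriv_eq_derivOne X hf']
  simp only [mul_assoc]

variable (E) in
/-- The adjoint action on the model space, which is the underlying vector space of `𝔤`. -/
def adE (g : G) : E →ₗ[ℝ] E := Ad E g

/-- From x y s = (x s)(s⁻¹ y s): right translation twists a left-invariant direction by the adjoint
action. This is the source of K-equivariance of ∂. -/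
lemma dirDeriv_comp_mul_right (X : E) (s : G) {f : G → F} {x : G}
    (hf : MDifferentiableAt 𝓘(ℝ, E) 𝓘(ℝ, F) f (x * s)) :
    dirDeriv X (fun z => f (z * s)) x = dirDeriv (adE E s⁻¹ X) f (x * s) := by
  have hf' : MDifferentiableAt 𝓘(ℝ, E) 𝓘(ℝ, F) (fun z => f (z * s)) x :=
    hf.comp x (mdifferentiableAt_mul_right s x)
  rw [dirDeriv_eq_translate _ hf, dirDeriv_eq_translate X hf']
  have e : (fun y : G => f (x * y * s)) =
      (fun y => f (x * s * y)) ∘ fun y => s⁻¹ * y * s⁻¹⁻¹ := by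
    ext y; simp [mul_assoc]
  have hg : MDifferentiableAt 𝓘(ℝ, E) 𝓘(ℝ, F) (fun y => f (x * s * y)) (s⁻¹ * 1 * s⁻¹⁻¹) := by
    refine MDifferentiableAt.comp (I' := 𝓘(ℝ, E)) (g := f) _ ?_ (mdifferentiableAt_mul_left _ _)
    simpa using hf
  have k := mfderiv_comp (I := 𝓘(ℝ, E)) (I' := 𝓘(ℝ, E)) (I'' := 𝓘(ℝ, F)) (1 : G) hg
    (mdifferentiableAt_conj s⁻¹ 1)
  rw [e, k]
  have h1 : s⁻¹ * 1 * s⁻¹⁻¹ = 1 := by simp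
  -- The base point s⁻¹·1·s equals `1` only propositionally; every tangent space is `E`, so the
  -- derivative may be carried across the equality.
  have : ∀ p : G, p = 1 → ∀ v : E,
    (mfderiv 𝓘(ℝ, E) 𝓘(ℝ, F) (fun y => f (x * s * y)) p : E →L[ℝ] F) v =
    (mfderiv 𝓘(ℝ, E) 𝓘(ℝ, F) (fun y => f (x * s * y)) 1 : E →L[ℝ] F) v := by
    rintro p rfl v; rfl
  exact this _ h1 _

lemma contMDiff_Ad (X : E) : ContMDiff 𝓘(ℝ, E) 𝓘(ℝ, E) ∞ (fun g : G => adE E g X) := by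
  haveI : IsManifold 𝓘(ℝ, E) 1 G := IsManifold.of_le (n := ∞) (by simp)
  intro x
  have h1 : ContMDiffAt (𝓘(ℝ, E).prod 𝓘(ℝ, E)) 𝓘(ℝ, E) ∞
      (Function.uncurry fun x y : G => x * y * x⁻¹) (x, 1) :=
    ((contMDiff_fst.mul contMDiff_snd).mul contMDiff_fst.inv).contMDiffAt
  have h2 := ContMDiffAt.mfderiv (m := ∞) (n := ∞) (fun x y : G => x * y * x⁻¹) (fun _ => (1 : G)) h1
    contMDiffAt_const (by simp)
  have h3 : ContMDiffAt 𝓘(ℝ, E) 𝓘(ℝ, E →L[ℝ] E) ∞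
      (fun x => derivOneSelf (E := E) (fun y : G => x * y * x⁻¹)) x := by
    rw [← inTangentCoordinates_derivOneSelf (fun x y : G => x * y * x⁻¹) (by simp) x]
    exact h2
  exact (ContinuousLinearMap.apply ℝ E X).contMDiff.contMDiffAt.comp x h3

end LieGroupCalculus

/-! ### The bracket in a chart, and the derivative of the adjoint representation. -/

noncomputable section BracketFormula

set_option linter.unusedSectionVars false
set_option linter.style.haveILetI false

variable {E : Type*} [NormedAddCommGroup E] [NormedSpace ℝ E]
  {F : Type*} [NormedAddCommGroup F] [NormedSpace ℝ F]

lemma fderiv_partial_right {f : E × E → F} {a b : E} (hf : DifferentiableAt ℝ f (a, b)) (Y : E) :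
    fderiv ℝ (fun v => f (a, v)) b Y = fderiv ℝ f (a, b) (0, Y) := by
  have h := hf.hasFDerivAt.comp b ((hasFDerivAt_const a b).prodMk (hasFDerivAt_id b))
  have h' : HasFDerivAt (fun v => f (a, v)) _ b := h
  rw [h'.fderiv]
  simp

lemma fderiv_partial_left {f : E × E → F} {a b : E} (hf : DifferentiableAt ℝ f (a, b)) (X : E) :
    fderiv ℝ (fun u => f (u, b)) a X = fderiv ℝ f (a, b) (X, 0) := by
  have h0 : HasFDerivAt (fun u : E => (u, b)) _ a :=
    (hasFDerivAt_id (𝕜 := ℝ) a).prodMk (hasFDerivAt_const b a)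
  have h := HasFDerivAt.comp (g := f) a hf.hasFDerivAt h0
  have h' : HasFDerivAt (fun u => f (u, b)) _ a := h
  rw [h'.fderiv]
  simp

/-- Equality of mixed partial derivatives. -/
lemma fderiv_partial_comm {f : E × E → F} {a b : E} (hf : ContDiffAt ℝ ∞ f (a, b)) (X Y : E) :
    fderiv ℝ (fun u => fderiv ℝ (fun v => f (u, v)) b Y) a X =
      fderiv ℝ (fun v => fderiv ℝ (fun u => f (u, v)) a X) b Y := by
  have hd : ∀ᶠ p in nhds (a, b), DifferentiableAt ℝ f p := by
    filter_upwards [(hf.of_le (m := 1) (by simp)).eventually (by simp)] with p hp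
    exact hp.differentiableAt (by simp)
  -- The inner partial derivative is about to be differentiated, so its expression by the total
  -- derivative is needed on a neighbourhood.
  have h1 : (fun u => fderiv ℝ (fun v => f (u, v)) b Y) =ᶠ[nhds a]
      fun u => fderiv ℝ f (u, b) (0, Y) := by
    have hc : Filter.Tendsto (fun u : E => (u, b)) (nhds a) (nhds (a, b)) :=
      (Continuous.prodMk_left b).tendsto a
    filter_upwards [hc.eventually hd] with u hu
    exact fderiv_partial_right hu Y
  have h2 : (fun v => fderiv ℝ (fun u => f (u, v)) a X) =ᶠ[nhds b]
      fun v => fderiv ℝ f (a, v) (X, 0) := by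
    have hc : Filter.Tendsto (fun v : E => (a, v)) (nhds b) (nhds (a, b)) :=
      (Continuous.prodMk_right a).tendsto b
    filter_upwards [hc.eventually hd] with v hv
    exact fderiv_partial_left hv X
  have hf' : DifferentiableAt ℝ (fderiv ℝ f) (a, b) :=
    (hf.fderiv_right (m := 1) (by norm_cast)).differentiableAt (by simp)
  have h1' : DifferentiableAt ℝ (fun p => fderiv ℝ f p (0, Y)) (a, b) := hf'.clm_apply (by fun_prop)
  have h2' : DifferentiableAt ℝ (fun p => fderiv ℝ f p (X, 0)) (a, b) := hf'.clm_apply (by fun_prop)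
  rw [h1.fderiv_eq, h2.fderiv_eq, fderiv_partial_left (f := fun p => fderiv ℝ f p (0, Y)) h1',
    fderiv_partial_right (f := fun p => fderiv ℝ f p (X, 0)) h2']
  have hs : IsSymmSndFDerivAt ℝ f (a, b) := hf.isSymmSndFDerivAt (by
    rw [minSmoothness_of_isRCLikeNormedField]; exact ENat.LEInfty.out)
  rw [fderiv_clm_apply hf' (by fun_prop), fderiv_clm_apply hf' (by fun_prop)]
  simpa using hs.eq (X, 0) (0, Y)

variable {G : Type*} [TopologicalSpace G] [ChartedSpace E G] [Group G]

lemma derivOne_eq_fderiv {f : G → F} (hf : MDifferentiableAt 𝓘(ℝ, E) 𝓘(ℝ, F) f 1) :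
    derivOne f = fderiv ℝ (f ∘ (extChartAt 𝓘(ℝ, E) (1 : G)).symm) (extChartAt 𝓘(ℝ, E) (1 : G) 1) := by
  refine (if_pos hf).trans ?_
  simp [writtenInExtChartAt]
  rfl

variable [LieGroup 𝓘(ℝ, E) ∞ G]

lemma contMDiffAt_chart_one : ∀ᶠ x in nhds (1 : G),
    ContMDiffAt 𝓘(ℝ, E) 𝓘(ℝ, E) ∞ (extChartAt 𝓘(ℝ, E) (1 : G)) x := by
  filter_upwards [chart_source_mem_nhds E (1 : G)] with x hx
  exact contMDiffAt_extChartAt' hx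

/-- The tangent space at `1` is identified with `E` through this very chart. -/
lemma derivOne_chart : derivOne (E := E) (extChartAt 𝓘(ℝ, E) (1 : G)) = ContinuousLinearMap.id ℝ E := by
  haveI : IsManifold 𝓘(ℝ, E) 1 G := IsManifold.of_le (n := ∞) (by simp)
  exact mfderiv_extChartAt_self

/-- In the chart, (g, h) ↦ φ(g h) is a smooth function near a point of `E × E`, and its mixed
partial derivatives agree. This is the comparison between left-invariant and right-invariant fields
at the identity. -/
lemma derivOne_comm :
    let φ := extChartAt 𝓘(ℝ, E) (1 : G)
    ∀ X Y : E, derivOne (fun g => derivOne (E := E) (fun h => φ (g * h)) Y) X =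
      derivOne (fun h => derivOne (E := E) (fun g => φ (g * h)) X) Y := by
  intro φ X Y
  have hφ : ContMDiffAt 𝓘(ℝ, E) 𝓘(ℝ, E) ∞ φ (1 : G) := contMDiffAt_chart_one.self_of_nhds
  have hφ1 : ContMDiffAt 𝓘(ℝ, E) 𝓘(ℝ, E) ∞ φ ((1 : G) * 1) := by rwa [mul_one]
  have hc : ContinuousAt φ.symm (φ 1) := continuousAt_extChartAt_symm (1 : G)
  have hc1 : φ.symm (φ 1) = 1 := extChartAt_to_inv (1 : G)
  have hsymm : ContMDiffAt 𝓘(ℝ, E) 𝓘(ℝ, E) ∞ φ.symm (φ 1) := by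
    have := contMDiffOn_extChartAt_symm (I := 𝓘(ℝ, E)) (n := ∞) (1 : G)
    exact this.contMDiffAt (extChartAt_target_mem_nhds (1 : G))
  set f : E × E → E := fun p => φ (φ.symm p.1 * φ.symm p.2) with hf
  have hfs : ContDiffAt ℝ ∞ f (φ 1, φ 1) := by
    rw [← contMDiffAt_iff_contDiffAt]
    have h1 : ContMDiffAt 𝓘(ℝ, E × E) 𝓘(ℝ, E) ∞ (fun p : E × E => φ.symm p.1) (φ 1, φ 1) :=
      ContMDiffAt.comp (φ 1, φ 1) (g := φ.symm) hsymm contDiff_fst.contMDiff.contMDiffAt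
    have h2 : ContMDiffAt 𝓘(ℝ, E × E) 𝓘(ℝ, E) ∞ (fun p : E × E => φ.symm p.2) (φ 1, φ 1) :=
      ContMDiffAt.comp (φ 1, φ 1) (g := φ.symm) hsymm contDiff_snd.contMDiff.contMDiffAt
    refine ContMDiffAt.comp (φ 1, φ 1) (g := φ) ?_ (h1.mul h2)
    simpa only [hc1] using hφ1
  have hev : ∀ᶠ u in nhds (φ 1), MDifferentiableAt 𝓘(ℝ, E) 𝓘(ℝ, E) φ (φ.symm u) := by
    have : ∀ᶠ x in nhds (φ.symm (φ 1)), ContMDiffAt 𝓘(ℝ, E) 𝓘(ℝ, E) ∞ φ x := by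
      rw [hc1]; exact contMDiffAt_chart_one
    filter_upwards [hc.eventually this] with u hu
    exact hu.mdifferentiableAt (by simp)
  have hL : MDifferentiableAt 𝓘(ℝ, E) 𝓘(ℝ, E)
      (fun g => derivOne (E := E) (fun h => φ (g * h)) Y) (1 : G) := by
    have := contMDiffAt_derivOne (f := fun x y : G => φ (x * y)) (contMDiffAt_comp_mul hφ1)
    exact ((ContinuousLinearMap.apply ℝ E Y).contMDiff.contMDiffAt.comp (1 : G)
      this).mdifferentiableAt (n := ∞) (by simp)
  have hR : MDifferentiableAt 𝓘(ℝ, E) 𝓘(ℝ, E)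
      (fun h => derivOne (E := E) (fun g => φ (g * h)) X) (1 : G) := by
    have := contMDiffAt_derivOne (f := fun x y : G => φ (y * x)) (x := 1)
      (ContMDiffAt.comp (g := φ) ((1 : G), (1 : G)) hφ1 (contMDiff_snd.mul contMDiff_fst).contMDiffAt)
    exact ((ContinuousLinearMap.apply ℝ E X).contMDiff.contMDiffAt.comp (1 : G)
      this).mdifferentiableAt (n := ∞) (by simp)
  have key := fderiv_partial_comm hfs X Y
  rw [derivOne_eq_fderiv hL, derivOne_eq_fderiv hR]
  have e1 : ((fun g => derivOne (E := E) (fun h => φ (g * h)) Y) ∘ φ.symm) =ᶠ[nhds (φ 1)]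
      fun u => fderiv ℝ (fun v => f (u, v)) (φ 1) Y := by
    filter_upwards [hev] with u hu
    have : MDifferentiableAt 𝓘(ℝ, E) 𝓘(ℝ, E) (fun h => φ (φ.symm u * h)) 1 :=
      MDifferentiableAt.comp (I' := 𝓘(ℝ, E)) (g := φ) (1 : G) (by rwa [mul_one])
        (mdifferentiableAt_mul_left _ _)
    simp only [Function.comp_apply]
    rw [derivOne_eq_fderiv this]
    rfl
  have e2 : ((fun h => derivOne (E := E) (fun g => φ (g * h)) X) ∘ φ.symm) =ᶠ[nhds (φ 1)]
      fun v => fderiv ℝ (fun u => f (u, v)) (φ 1) X := by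
    filter_upwards [hev] with u hu
    have : MDifferentiableAt 𝓘(ℝ, E) 𝓘(ℝ, E) (fun h => φ (h * φ.symm u)) 1 :=
      MDifferentiableAt.comp (I' := 𝓘(ℝ, E)) (g := φ) (1 : G) (by rwa [one_mul])
        (mdifferentiableAt_mul_right _ _)
    simp only [Function.comp_apply]
    rw [derivOne_eq_fderiv this]
    rfl
  rw [e1.fderiv_eq, e2.fderiv_eq]
  exact key

variable [CompleteSpace E]

variable (G) in
/-- The bracket of `𝔤` on the model space. -/
def brE (X Y : E) : E := @Bracket.bracket (LieAlg E G) (LieAlg E G) _ X Y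

/-- In the chart at `1` the left-invariant field of Z has components `dirDeriv Z φ`, with value Z at
the centre; the bracket of vector fields on `E` then gives the formula. -/
lemma brE_eq_derivOne (X Y : E) :
    let φ := extChartAt 𝓘(ℝ, E) (1 : G)
    brE G X Y = derivOne (dirDeriv Y φ) X - derivOne (dirDeriv X φ) Y := by
  intro φ
  haveI : IsManifold 𝓘(ℝ, E) 1 G := IsManifold.of_le (n := ∞) (by simp)
  have hφ : ContMDiffAt 𝓘(ℝ, E) 𝓘(ℝ, E) ∞ φ (1 : G) := contMDiffAt_chart_one.self_of_nhds
  have hc1 : φ.symm (φ 1) = 1 := extChartAt_to_inv (1 : G)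
  obtain ⟨pb, hpb0⟩ : ∃ pb : E → E → E, ∀ Z, pb Z = VectorField.mpullbackWithin 𝓘(ℝ, E) 𝓘(ℝ, E) φ.symm
      (mulInvariantVectorField (I := 𝓘(ℝ, E)) (G := G) Z) (Set.range 𝓘(ℝ, E)) := ⟨_, fun _ => rfl⟩
  have hpb : ∀ Z : E, pb Z =ᶠ[nhds (φ 1)] (dirDeriv Z φ) ∘ φ.symm := by
    intro Z
    filter_upwards [extChartAt_target_mem_nhds (I := 𝓘(ℝ, E)) (1 : G)] with u hu
    -- The derivatives of the chart and of its inverse are mutually inverse, so pulling back by the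
    -- inverse chart is pushing forward by the chart.
    have hinv := ContinuousLinearMap.inverse_eq
      (mfderivWithin_extChartAt_symm_comp_mfderiv_extChartAt hu)
      (mfderiv_extChartAt_comp_mfderivWithin_extChartAt_symm hu)
    rw [hpb0]
    exact congrArg (fun A : E →L[ℝ] E =>
      A (mulInvariantVectorField (I := 𝓘(ℝ, E)) (G := G) Z (φ.symm u))) hinv
  have hd : ∀ Z : E, MDifferentiableAt 𝓘(ℝ, E) 𝓘(ℝ, E) (dirDeriv Z φ) (1 : G) := fun Z =>
    (ContMDiffAt.dirDeriv Z hφ).mdifferentiableAt (by simp)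
  have hv : ∀ Z : E, dirDeriv Z φ (1 : G) = Z := by
    intro Z
    rw [dirDeriv_one]
    exact congrArg (fun A : E →L[ℝ] E => A Z) (derivOne_chart (E := E) (G := G))
  have h0 : brE G X Y = VectorField.lieBracket ℝ ((dirDeriv X φ) ∘ φ.symm)
      ((dirDeriv Y φ) ∘ φ.symm) (φ 1) := by
    refine Eq.trans ?_ ((hpb X).lieBracket_vectorField_eq (hpb Y))
    have h1 : mfderiv 𝓘(ℝ, E) 𝓘(ℝ, E) φ (1 : G) = ContinuousLinearMap.id ℝ E :=
      derivOne_chart (E := E) (G := G)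
    obtain ⟨Q, hQ⟩ : ∃ Q : E, Q = VectorField.lieBracketWithin ℝ (pb X) (pb Y)
          (φ.symm ⁻¹' Set.univ ∩ Set.range 𝓘(ℝ, E)) (φ 1) := ⟨_, rfl⟩
    have h2 : brE G X Y = (fun A : E →L[ℝ] E => A.inverse Q) (mfderiv 𝓘(ℝ, E) 𝓘(ℝ, E) φ (1 : G)) := by
      rw [hQ, hpb0, hpb0]; rfl
    refine h2.trans ((congrArg (fun A : E →L[ℝ] E => A.inverse Q) h1).trans ?_)
    rw [ContinuousLinearMap.inverse_id, ← VectorField.lieBracketWithin_univ, hQ]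
    simp
  rw [h0, VectorField.lieBracket_eq, derivOne_eq_fderiv (hd X), derivOne_eq_fderiv (hd Y)]
  simp only [Function.comp_apply, hc1, hv]
  rfl

/-- The derivative of the adjoint representation is the bracket. -/
lemma derivOne_adE (X Y : E) : derivOne (fun g : G => adE E g Y) X = brE G X Y := by
  set φ := extChartAt 𝓘(ℝ, E) (1 : G) with hφdef
  have hφ : ContMDiffAt 𝓘(ℝ, E) 𝓘(ℝ, E) ∞ φ (1 : G) := contMDiffAt_chart_one.self_of_nhds
  have hφ1 : ContMDiffAt 𝓘(ℝ, E) 𝓘(ℝ, E) ∞ φ ((1 : G) * 1) := by rwa [mul_one]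
  have hL : ∀ Z : E, dirDeriv Z φ =ᶠ[nhds (1 : G)] fun g => derivOne (E := E) (fun h => φ (g * h)) Z := by
    intro Z
    filter_upwards [contMDiffAt_chart_one (E := E) (G := G)] with g hg
    exact dirDeriv_eq_derivOne Z (hg.mdifferentiableAt (by simp))
  -- By g h = (g h g⁻¹) g, the left-invariant field of Y agrees at g with the right-invariant field
  -- of Ad_g Y.
  have hLR : dirDeriv Y φ =ᶠ[nhds (1 : G)]
      fun g => derivOne (E := E) (fun k => φ (k * g)) (adE E g Y) := by
    filter_upwards [contMDiffAt_chart_one (E := E) (G := G), hL Y] with g hg hg'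
    rw [hg']
    have hm : MDifferentiableAt 𝓘(ℝ, E) 𝓘(ℝ, E) φ g := hg.mdifferentiableAt (by simp)
    have h1 : g * 1 * g⁻¹ = 1 := by simp
    have e : (fun h : G => φ (g * h)) = (fun k => φ (k * g)) ∘ fun h => g * h * g⁻¹ := by
      ext h; simp
    have hk : MDifferentiableAt 𝓘(ℝ, E) 𝓘(ℝ, E) (fun k => φ (k * g)) (g * 1 * g⁻¹) :=
      MDifferentiableAt.comp (I' := 𝓘(ℝ, E)) (g := φ) _ (by rwa [h1, one_mul])
        (mdifferentiableAt_mul_right _ _)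
    have k := mfderiv_comp (I := 𝓘(ℝ, E)) (I' := 𝓘(ℝ, E)) (I'' := 𝓘(ℝ, E)) (1 : G) hk
      (mdifferentiableAt_conj g 1)
    rw [e]
    unfold derivOne
    rw [k]
    have : ∀ p : G, p = 1 → ∀ v : E,
      (mfderiv 𝓘(ℝ, E) 𝓘(ℝ, E) (fun k => φ (k * g)) p : E →L[ℝ] E) v =
      (mfderiv 𝓘(ℝ, E) 𝓘(ℝ, E) (fun k => φ (k * g)) 1 : E →L[ℝ] E) v := by
      rintro p rfl v; rfl
    exact this _ h1 _
  have hR : MDifferentiableAt 𝓘(ℝ, E) 𝓘(ℝ, E →L[ℝ] E)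
      (fun g => derivOne (E := E) (fun k => φ (k * g))) (1 : G) :=
    (contMDiffAt_derivOne (f := fun x y : G => φ (y * x)) (x := 1)
      (ContMDiffAt.comp (g := φ) ((1 : G), (1 : G)) hφ1
        (contMDiff_snd.mul contMDiff_fst).contMDiffAt)).mdifferentiableAt (by simp)
  have hA : MDifferentiableAt 𝓘(ℝ, E) 𝓘(ℝ, E) (fun g : G => adE E g Y) (1 : G) :=
    (contMDiff_Ad (G := G) Y).mdifferentiable (by simp) 1
  have hdR : dirDeriv X (fun g : G => derivOne (E := E) (fun k => φ (k * g))) 1 Y =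
      derivOne (dirDeriv X φ) Y := by
    have h1 := dirDeriv_clm_comp X (ContinuousLinearMap.apply ℝ E Y) hR
    simp only [ContinuousLinearMap.apply_apply] at h1
    rw [← h1, dirDeriv_one]
    have h2 : derivOne (fun g : G => derivOne (E := E) (fun k => φ (k * g)) Y) X =
      derivOne (fun g => derivOne (E := E) (fun h => φ (g * h)) X) Y := (derivOne_comm Y X).symm
    refine h2.trans ?_
    have h3 : derivOne (E := E) (dirDeriv X φ) =
        derivOne (fun g => derivOne (E := E) (fun h => φ (g * h)) X) := (hL X).mfderiv_eq
    rw [h3]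
  -- Product rule for `hLR` at `1`: the first term is the one subtracted in the bracket formula, and
  -- the derivative of Ad remains.
  have h3 : derivOne (dirDeriv Y φ) X = derivOne (dirDeriv X φ) Y +
      derivOne (fun g : G => adE E g Y) X := by
    have h4 := dirDeriv_bilin X (ContinuousLinearMap.id ℝ (E →L[ℝ] E)) hR hA
    simp only [ContinuousLinearMap.id_apply] at h4
    have e1 : adE E (1 : G) Y = Y := Ad_one_apply Y
    rw [e1, hdR] at h4
    have h5 := dirDeriv_congr (X := X) hLR
    rw [dirDeriv_one] at h5
    refine h5.trans (h4.trans ?_)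
    have e2 : (fun k : G => φ (k * 1)) = φ := by ext k; simp
    rw [e2, derivOne_chart, dirDeriv_one]
    rfl
  have := brE_eq_derivOne (G := G) X Y
  rw [this, ← hφdef, h3]
  abel

end BracketFormula

/-! ### One-parameter subgroups as integral curves of left-invariant fields. -/

noncomputable section OneParameterGroups

set_option linter.unusedSectionVars false
set_option linter.style.haveILetI false

variable {E : Type*} [NormedAddCommGroup E] [NormedSpace ℝ E]
  {G : Type*} [TopologicalSpace G] [ChartedSpace E G] [Group G] [LieGroup 𝓘(ℝ, E) ∞ G]
  {F : Type*} [NormedAddCommGroup F] [NormedSpace ℝ F]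

variable (G) in
/-- The left-invariant vector field of a vector of the model space. -/
abbrev leftField (X : E) (x : G) : TangentSpace 𝓘(ℝ, E) x :=
  mulInvariantVectorField (I := 𝓘(ℝ, E)) (X : LieAlg E G) x

lemma contMDiff_leftField (X : E) : ContMDiff 𝓘(ℝ, E) 𝓘(ℝ, E).tangent 1
    (fun x : G => (⟨x, leftField G X x⟩ : TangentBundle 𝓘(ℝ, E) G)) :=
  (contMDiff_mulInvariantVectorField (I := 𝓘(ℝ, E)) (G := G) (X : LieAlg E G)).of_le (by
    rw [minSmoothness_of_isRCLikeNormedField]; norm_num)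

lemma mfderiv_mul_left_leftField (X : E) (x y : G) :
    (mfderiv 𝓘(ℝ, E) 𝓘(ℝ, E) (fun z : G => x * z) y : E →L[ℝ] E) (leftField G X y) =
      leftField G X (x * y) := by
  have hx : MDifferentiableAt 𝓘(ℝ, E) 𝓘(ℝ, E) (fun z : G => x * z) (y * 1) :=
    mdifferentiableAt_mul_left x _
  have k := mfderiv_comp (I := 𝓘(ℝ, E)) (I' := 𝓘(ℝ, E)) (I'' := 𝓘(ℝ, E)) (1 : G) hx
    (mdifferentiableAt_mul_left y 1)
  have e : (fun z : G => x * z) ∘ (fun z : G => y * z) = fun z => x * y * z := by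
    ext z; simp [mul_assoc]
  rw [e] at k
  have k' : (mfderiv 𝓘(ℝ, E) 𝓘(ℝ, E) (fun z : G => x * y * z) 1 : E →L[ℝ] E) X =
      (mfderiv 𝓘(ℝ, E) 𝓘(ℝ, E) (fun z : G => x * z) (y * 1) : E →L[ℝ] E)
        ((mfderiv 𝓘(ℝ, E) 𝓘(ℝ, E) (fun z : G => y * z) 1 : E →L[ℝ] E) X) :=
    congrArg (fun A : E →L[ℝ] E => A X) k
  exact (mfderiv_congr_point (mul_one y).symm _ _).trans k'.symm

lemma hasMFDerivAt_translate {X : E} {γ : ℝ → G} {t : ℝ} (x : G) {s : Set ℝ}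
    (h : HasMFDerivWithinAt 𝓘(ℝ, ℝ) 𝓘(ℝ, E) γ s t
      ((1 : ℝ →L[ℝ] ℝ).smulRight (leftField G X (γ t)))) :
    HasMFDerivWithinAt 𝓘(ℝ, ℝ) 𝓘(ℝ, E) (fun t => x * γ t) s t
      ((1 : ℝ →L[ℝ] ℝ).smulRight (leftField G X (x * γ t))) := by
  have h1 := (mdifferentiableAt_mul_left (E := E) x (γ t)).hasMFDerivAt.comp_hasMFDerivWithinAt t h
  refine h1.congr_mfderiv (ContinuousLinearMap.ext_ring ?_)
  change (mfderiv 𝓘(ℝ, E) 𝓘(ℝ, E) (fun z : G => x * z) (γ t) : E →L[ℝ] E)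
    ((1 : ℝ) • leftField G X (γ t) : E) = ((1 : ℝ) • leftField G X (x * γ t) : E)
  rw [one_smul, one_smul]
  exact mfderiv_mul_left_leftField X x (γ t)

lemma IsMIntegralCurve.translate {X : E} {γ : ℝ → G} (h : IsMIntegralCurve γ (leftField G X)) (x : G) :
    IsMIntegralCurve (fun t => x * γ t) (leftField G X) := fun t => by
  exact hasMFDerivWithinAt_univ.1 (hasMFDerivAt_translate x (hasMFDerivWithinAt_univ.2 (h t)))

lemma IsMIntegralCurve.hasDerivAt_comp {X : E} {γ : ℝ → G} (h : IsMIntegralCurve γ (leftField G X))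
    {f : G → F} {t : ℝ} (hf : MDifferentiableAt 𝓘(ℝ, E) 𝓘(ℝ, F) f (γ t)) :
    HasDerivAt (fun t => f (γ t)) (dirDeriv X f (γ t)) t := by
  have h1 := hf.hasMFDerivAt.comp t (h t)
  let A : E →L[ℝ] F := mfderiv 𝓘(ℝ, E) 𝓘(ℝ, F) f (γ t)
  let B : ℝ →L[ℝ] E := (1 : ℝ →L[ℝ] ℝ).smulRight (leftField G X (γ t))
  have h2 : HasFDerivAt (fun t => f (γ t)) (A.comp B) t := h1.hasFDerivAt
  refine h2.hasDerivAt.congr_deriv ?_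
  symm
  change _ = (mfderiv 𝓘(ℝ, E) 𝓘(ℝ, F) f (γ t) : E →L[ℝ] F) ((1 : ℝ) • leftField G X (γ t) : E)
  rw [one_smul]
  rfl

/-- Along the curve, f has derivative `dirDeriv X f`, which is again smooth, so the order of
differentiability can be raised by induction. -/
lemma IsMIntegralCurve.contDiffOn_comp {X : E} {γ : ℝ → G}
    (h : IsMIntegralCurve γ (leftField G X)) {U : Set G} (hU : IsOpen U) (n : ℕ) :
    ∀ f : G → F, (∀ x ∈ U, ContMDiffAt 𝓘(ℝ, E) 𝓘(ℝ, F) ∞ f x) →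
      ContDiffOn ℝ n (fun t => f (γ t)) (γ ⁻¹' U) := by
  have hV : IsOpen (γ ⁻¹' U) := hU.preimage h.continuous
  have hder : ∀ f : G → F, (∀ x ∈ U, ContMDiffAt 𝓘(ℝ, E) 𝓘(ℝ, F) ∞ f x) → ∀ t ∈ γ ⁻¹' U,
      HasDerivAt (fun t => f (γ t)) (dirDeriv X f (γ t)) t := fun f hf t ht =>
    h.hasDerivAt_comp ((hf _ ht).mdifferentiableAt (by simp))
  induction n with
  | zero =>
    intro f hf
    rw [Nat.cast_zero, contDiffOn_zero]
    exact fun t ht => (hder f hf t ht).continuousAt.continuousWithinAt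
  | succ n ih =>
    intro f hf
    rw [Nat.cast_succ, contDiffOn_succ_iff_deriv_of_isOpen hV]
    refine ⟨fun t ht => (hder f hf t ht).differentiableAt.differentiableWithinAt, by simp, ?_⟩
    refine (ih (dirDeriv X f) fun x hx => ContMDiffAt.dirDeriv X (hf x hx)).congr ?_
    exact fun t ht => (hder f hf t ht).deriv

/-- An integral curve is a priori only differentiable, whereas `lieOf` asks for smooth one-parameter
subgroups. The previous lemma is applied to the chart at the point reached. -/
lemma IsMIntegralCurve.contMDiff {X : E} {γ : ℝ → G} (h : IsMIntegralCurve γ (leftField G X)) :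
    ContMDiff 𝓘(ℝ, ℝ) 𝓘(ℝ, E) ∞ γ := by
  haveI : IsManifold 𝓘(ℝ, E) 1 G := IsManifold.of_le (n := ∞) (by simp)
  intro t
  rw [contMDiffAt_iff_target]
  refine ⟨h.continuous.continuousAt, ?_⟩
  rw [contMDiffAt_iff_contDiffAt, contDiffAt_infty]
  intro n
  have hU : IsOpen (chartAt E (γ t)).source := (chartAt E (γ t)).open_source
  refine (IsMIntegralCurve.contDiffOn_comp h hU n (extChartAt 𝓘(ℝ, E) (γ t)) fun x hx =>
    contMDiffAt_extChartAt' hx).contDiffAt ?_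
  exact (hU.preimage h.continuous).mem_nhds (mem_chart_source E (γ t))

/-- Existence of the one-parameter subgroup with a given velocity. -/
lemma exists_oneParameterGroup [CompleteSpace E] [T2Space G] (X : E) :
    ∃ γ : ℝ → G, IsMIntegralCurve γ (leftField G X) ∧ ∀ s t, γ (s + t) = γ s * γ t := by
  haveI : IsManifold 𝓘(ℝ, E) 1 G := IsManifold.of_le (n := ∞) (by simp)
  obtain ⟨γ₀, h0, h1⟩ := exists_isMIntegralCurveAt_of_contMDiffAt_boundaryless (t₀ := 0)
    ((contMDiff_leftField (G := G) X).contMDiffAt (x := 1))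
  obtain ⟨ε, hε, h2⟩ := isMIntegralCurveAt_iff'.1 h1
  rw [Real.ball_eq_Ioo, zero_sub, zero_add] at h2
  -- Left translates of the local curve through `1` give every point the same lifetime ε, which
  -- makes the field complete.
  obtain ⟨γ, h3, h4⟩ := exists_isMIntegralCurve_of_isMIntegralCurveOn (contMDiff_leftField (G := G) X)
    hε (fun x => ⟨fun t => x * γ₀ t, by simp [h0], fun t ht => hasMFDerivAt_translate x (h2 t ht)⟩) 1
  refine ⟨γ, h4, fun s t => ?_⟩
  -- The curves γ(s + t) and γ(s)γ(t) both integrate the field and start at γ(s), so they coincide.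
  have h5 : IsMIntegralCurve (fun t => γ (s + t)) (leftField G X) := by
    have := h4.comp_add s
    simpa only [Function.comp_def, add_comm] using this
  have := isMIntegralCurve_Ioo_eq_of_contMDiff_boundaryless (t₀ := 0) (contMDiff_leftField (G := G) X) h5
    (h4.translate (γ s)) (by simp [h3])
  exact congrFun this t

lemma IsMIntegralCurve.mfderiv_zero {X : E} {γ : ℝ → G} (h : IsMIntegralCurve γ (leftField G X))
    (h0 : γ 0 = 1) : (mfderiv 𝓘(ℝ, ℝ) 𝓘(ℝ, E) γ 0 : ℝ →L[ℝ] E) 1 = X := by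
  have : (mfderiv 𝓘(ℝ, ℝ) 𝓘(ℝ, E) γ 0 : ℝ →L[ℝ] E) 1 = (1 : ℝ) • (leftField G X (γ 0) : E) :=
    congrArg (fun A : ℝ →L[ℝ] E => A 1) (h 0).mfderiv
  rw [this, one_smul]
  have e : ∀ p : G, p = 1 → (leftField G X p : E) = X := by
    rintro p rfl; exact mulInvariantVectorField_one (G := G) X
  exact e _ h0

/-- Uses only the velocity at 0, not the equation of an integral curve, so that it applies to the
curves provided by `lieOf`. -/
lemma hasDerivAt_comp_of_velocity {X : E} {γ : ℝ → G} (hγ : ContMDiff 𝓘(ℝ, ℝ) 𝓘(ℝ, E) ∞ γ)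
    (h0 : γ 0 = 1) (hX : (mfderiv 𝓘(ℝ, ℝ) 𝓘(ℝ, E) γ 0 : ℝ →L[ℝ] E) 1 = X) {f : G → F}
    (hf : MDifferentiableAt 𝓘(ℝ, E) 𝓘(ℝ, F) f 1) :
    HasDerivAt (fun t => f (γ t)) (derivOne f X) 0 := by
  have hf' : MDifferentiableAt 𝓘(ℝ, E) 𝓘(ℝ, F) f (γ 0) := by rwa [h0]
  have h1 := hf'.hasMFDerivAt.comp 0 ((hγ.mdifferentiable (by simp)) 0).hasMFDerivAt
  let A : E →L[ℝ] F := mfderiv 𝓘(ℝ, E) 𝓘(ℝ, F) f (γ 0)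
  let B : ℝ →L[ℝ] E := mfderiv 𝓘(ℝ, ℝ) 𝓘(ℝ, E) γ 0
  have h2 : HasFDerivAt (fun t => f (γ t)) (A.comp B) 0 := h1.hasFDerivAt
  refine h2.hasDerivAt.congr_deriv ?_
  symm
  change _ = (mfderiv 𝓘(ℝ, E) 𝓘(ℝ, F) f (γ 0) : E →L[ℝ] F)
    ((mfderiv 𝓘(ℝ, ℝ) 𝓘(ℝ, E) γ 0 : ℝ →L[ℝ] E) 1)
  rw [hX]
  have e : ∀ p : G, p = 1 → (mfderiv 𝓘(ℝ, E) 𝓘(ℝ, F) f 1 : E →L[ℝ] F) X =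
    (mfderiv 𝓘(ℝ, E) 𝓘(ℝ, F) f p : E →L[ℝ] F) X := by
    rintro p rfl; rfl
  exact e _ h0

end OneParameterGroups

/-! ### Right invariance of Haar measure and integration of derivatives. -/

noncomputable section HaarIntegration
open MeasureTheory

set_option linter.unusedSectionVars false
set_option linter.style.haveILetI false

/-- A right translate of ν is still left invariant, hence a multiple of ν; both have the same total
mass, which is finite and nonzero, so the factor is 1. -/
lemma isMulRightInvariant_of_compact {G : Type*} [TopologicalSpace G] [Group G] [IsTopologicalGroup G]
    [CompactSpace G] [SecondCountableTopology G] [MeasurableSpace G] [BorelSpace G] (ν : Measure G) [ν.IsHaarMeasure] :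
    ν.IsMulRightInvariant := by
  refine ⟨fun g => ?_⟩
  have h1 := Measure.isMulLeftInvariant_eq_smul_of_innerRegular (ν.map (· * g)) ν
  have h2 := congrArg (fun m : Measure G => m Set.univ) h1
  simp only [Measure.smul_apply] at h2
  rw [Measure.map_apply (by fun_prop) MeasurableSet.univ, Set.preimage_univ] at h2
  have h3 : ν Set.univ ≠ 0 := by
    have : (Set.univ : Set G).Nonempty := ⟨1, trivial⟩
    exact (isOpen_univ.measure_pos ν this).ne'
  have h4 : ν Set.univ ≠ ⊤ := isCompact_univ.measure_ne_top
  have h5 : ((Measure.haarScalarFactor (ν.map (· * g)) ν : NNReal) : ENNReal) = 1 := by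
    have h6 : ((Measure.haarScalarFactor (ν.map (· * g)) ν : NNReal) : ENNReal) * ν Set.univ =
      1 * ν Set.univ := by rw [one_mul]; exact h2.symm
    exact (ENNReal.mul_left_inj h3 h4).1 h6
  have h6 : Measure.haarScalarFactor (ν.map (· * g)) ν = 1 := by exact_mod_cast h5
  rw [h1, h6, one_smul]

variable {E : Type*} [NormedAddCommGroup E] [NormedSpace ℝ E] [FiniteDimensional ℝ E]
  {G : Type*} [TopologicalSpace G] [ChartedSpace E G]
  {F : Type*} [NormedAddCommGroup F] [NormedSpace ℝ F]

lemma secondCountable_of_compact (E : Type*) [NormedAddCommGroup E] [NormedSpace ℝ E]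
    [FiniteDimensional ℝ E] (G : Type*) [TopologicalSpace G] [ChartedSpace E G] [CompactSpace G] :
    SecondCountableTopology G :=
  haveI : ProperSpace E := FiniteDimensional.proper ℝ E
  ChartedSpace.secondCountable_of_sigmaCompact E G

variable [Group G] [LieGroup 𝓘(ℝ, E) ∞ G] [CompactSpace G] [MeasurableSpace G] [BorelSpace G]

lemma integrable_of_continuous (ν : Measure G) [ν.IsHaarMeasure] {f : G → F} (hf : Continuous f) :
    Integrable f ν :=
  hf.integrable_of_hasCompactSupport (HasCompactSupport.of_compactSpace f)

/-- The integral of a derivative along a left-invariant vector field vanishes. -/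
lemma integral_dirDeriv [CompleteSpace E] [T2Space G]
    (ν : Measure G) [ν.IsHaarMeasure] (X : E) {f : G → F} (hf : ContMDiff 𝓘(ℝ, E) 𝓘(ℝ, F) ∞ f) :
    ∫ x, dirDeriv X f x ∂ν = 0 := by
  -- With values in an incomplete space the Bochner integral is 0 by convention.
  by_cases hF : CompleteSpace F
  swap
  · simp [integral, hF]
  haveI := secondCountable_of_compact E G
  haveI : IsTopologicalGroup G := topologicalGroup_of_lieGroup 𝓘(ℝ, E) ∞
  haveI : ν.IsMulRightInvariant := isMulRightInvariant_of_compact ν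
  obtain ⟨γ, hγ, hmul⟩ := exists_oneParameterGroup (G := G) X
  have hγ0 : γ 0 = 1 := by simpa using hmul 0 0
  have hder : ∀ x t, HasDerivAt (fun t => f (x * γ t)) (dirDeriv X f (x * γ t)) t := fun x t =>
    IsMIntegralCurve.hasDerivAt_comp (hγ.translate x) (hf.mdifferentiable (by simp) _)
  have hdc : Continuous (dirDeriv X f) := (ContMDiff.dirDeriv X hf).continuous
  obtain ⟨C, hC⟩ : ∃ C, ∀ x, ‖dirDeriv X f x‖ ≤ C := by
    obtain ⟨C, hC⟩ := isCompact_univ.exists_bound_of_continuousOn hdc.continuousOn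
    exact ⟨C, fun x => hC x trivial⟩
  haveI : IsFiniteMeasure ν := ⟨isCompact_univ.measure_lt_top⟩
  -- Differentiation under the integral of f(x γ(t)); by compactness a constant dominates the
  -- derivatives.
  have key := (hasDerivAt_integral_of_dominated_loc_of_deriv_le (μ := ν) (s := Set.univ)
    (F := fun t x => f (x * γ t)) (F' := fun t x => dirDeriv X f (x * γ t)) (x₀ := 0)
    (bound := fun _ => C) Filter.univ_mem
    (Filter.Eventually.of_forall fun t =>
      (integrable_of_continuous ν (hf.continuous.comp (continuous_mul_const _))).1)
    (integrable_of_continuous ν (hf.continuous.comp (continuous_mul_const _)))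
    (integrable_of_continuous ν (hdc.comp (continuous_mul_const _))).1
    (Filter.Eventually.of_forall fun x t _ => hC _) (integrable_const C)
    (Filter.Eventually.of_forall fun x t _ => hder x t)).2
  -- Right invariance makes the integral independent of t.
  have hconst : (fun t => ∫ x, f (x * γ t) ∂ν) = fun _ => ∫ x, f x ∂ν := by
    ext t; exact integral_mul_right_eq_self f (γ t)
  rw [hconst] at key
  have := key.unique (hasDerivAt_const _ _)
  simpa [hγ0] using this

end HaarIntegration

/-! ### Linear algebra of a positive definite form. -/

noncomputable section InnerProducts

set_option linter.style.haveILetI false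

variable {V : Type*} [AddCommGroup V] [Module ℝ V]

/-- A positive definite symmetric bilinear form. -/
structure IsInner (B : V →ₗ[ℝ] V →ₗ[ℝ] ℝ) : Prop where
  symm : ∀ X Y, B X Y = B Y X
  pos : ∀ X, X ≠ 0 → 0 < B X X

namespace IsInner
variable {B : V →ₗ[ℝ] V →ₗ[ℝ] ℝ} (hB : IsInner B)
include hB

lemma nonneg (X : V) : 0 ≤ B X X := by
  by_cases h : X = 0
  · simp [h]
  · exact (hB.pos X h).le

lemma eq_zero {X : V} (h : B X X = 0) : X = 0 := by
  by_contra hX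
  exact (hB.pos X hX).ne' h

lemma eq_zero_of_forall {X : V} (h : ∀ Y, B X Y = 0) : X = 0 := hB.eq_zero (h X)

lemma ext {X Y : V} (h : ∀ Z, B X Z = B Y Z) : X = Y := by
  rw [← sub_eq_zero]
  exact hB.eq_zero_of_forall fun Z => by rw [map_sub, LinearMap.sub_apply, h, sub_self]

/-- The inner product space structure given by a positive definite form. -/
@[reducible]
def core : InnerProductSpace.Core ℝ V where
  inner X Y := B X Y
  conj_inner_symm X Y := by simp [hB.symm X Y]
  re_inner_nonneg X := by simpa using hB.nonneg X
  add_left X Y Z := by simp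
  smul_left X Y r := by simp
  definite X h := hB.eq_zero h

variable [FiniteDimensional ℝ V]

lemma exists_orthonormal_basis : ∃ b : Module.Basis (Fin (Module.finrank ℝ V)) ℝ V,
    ∀ i j, B (b i) (b j) = if i = j then 1 else 0 := by
  letI := @InnerProductSpace.Core.toNormedAddCommGroup ℝ V _ _ _ hB.core
  letI : InnerProductSpace ℝ V := @InnerProductSpace.ofCore ℝ V _ _ _ hB.core.toCore
  refine ⟨(stdOrthonormalBasis ℝ V).toBasis, fun i j => ?_⟩
  simp only [OrthonormalBasis.coe_toBasis]
  exact orthonormal_iff_ite.1 (stdOrthonormalBasis ℝ V).orthonormal i j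

lemma exists_eigenbasis (A : V →ₗ[ℝ] V) (hA : ∀ X Y, B (A X) Y = B X (A Y)) :
    ∃ (b : Module.Basis (Fin (Module.finrank ℝ V)) ℝ V) (c : Fin (Module.finrank ℝ V) → ℝ),
    (∀ i j, B (b i) (b j) = if i = j then 1 else 0) ∧ ∀ i, A (b i) = c i • b i := by
  letI := @InnerProductSpace.Core.toNormedAddCommGroup ℝ V _ _ _ hB.core
  letI : InnerProductSpace ℝ V := @InnerProductSpace.ofCore ℝ V _ _ _ hB.core.toCore
  have hs : A.IsSymmetric := hA
  refine ⟨(hs.eigenvectorBasis rfl).toBasis, hs.eigenvalues rfl, fun i j => ?_, fun i => ?_⟩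
  · simp only [OrthonormalBasis.coe_toBasis]
    exact orthonormal_iff_ite.1 (hs.eigenvectorBasis rfl).orthonormal i j
  · simp

omit hB [FiniteDimensional ℝ V] in
lemma apply_eq_repr {ι : Type*} [Fintype ι] [DecidableEq ι] {b : Module.Basis ι ℝ V}
    (hb : ∀ i j, B (b i) (b j) = if i = j then 1 else 0) (i : ι) (X : V) :
    B (b i) X = b.repr X i := by
  conv_lhs => rw [← b.sum_repr X]
  simp only [map_sum, map_smul, hb, smul_eq_mul, mul_ite, mul_one, mul_zero]
  simp

omit hB [FiniteDimensional ℝ V] in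
lemma sum_smul_eq {ι : Type*} [Fintype ι] [DecidableEq ι] {b : Module.Basis ι ℝ V}
    (hb : ∀ i j, B (b i) (b j) = if i = j then 1 else 0) (X : V) : ∑ i, B (b i) X • b i = X := by
  simp only [apply_eq_repr hb, b.sum_repr]

omit hB [FiniteDimensional ℝ V] in
lemma trace_eq {ι : Type*} [Fintype ι] [DecidableEq ι] {b : Module.Basis ι ℝ V}
    (hb : ∀ i j, B (b i) (b j) = if i = j then 1 else 0) (A : V →ₗ[ℝ] V) :
    LinearMap.trace ℝ V A = ∑ i, B (b i) (A (b i)) := by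
  rw [LinearMap.trace_eq_matrix_trace ℝ b, Matrix.trace]
  simp [LinearMap.toMatrix_apply, apply_eq_repr hb]

/-- The square of a nonzero skew operator has negative trace. -/
lemma trace_sq_neg {A : V →ₗ[ℝ] V} (hA : ∀ X Y, B (A X) Y = -B X (A Y)) (h0 : A ≠ 0) :
    LinearMap.trace ℝ V (A ∘ₗ A) < 0 := by
  obtain ⟨b, hb⟩ := hB.exists_orthonormal_basis
  rw [trace_eq hb, ← neg_pos, ← Finset.sum_neg_distrib]
  -- The diagonal entries of −A² are the squared lengths of the vectors A b_i.
  have h1 : ∀ i, -B (b i) ((A ∘ₗ A) (b i)) = B (A (b i)) (A (b i)) := fun i => by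
    rw [LinearMap.comp_apply, hA]
  simp only [h1]
  by_contra hneg
  have h2 : ∑ i, B (A (b i)) (A (b i)) = 0 :=
    le_antisymm (not_lt.1 hneg) (Finset.sum_nonneg fun i _ => hB.nonneg _)
  rw [Finset.sum_eq_zero_iff_of_nonneg fun i _ => hB.nonneg _] at h2
  exact h0 (b.ext fun i => by simpa using hB.eq_zero (h2 i (Finset.mem_univ i)))

end IsInner
end InnerProducts

/-! ### Positivity of the negative Killing form of a compact semisimple group. -/

noncomputable section KillingForm
open MeasureTheory

/-- The Killing form is negative definite as soon as there is an invariant inner product. -/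
lemma killingForm_neg_of_invariant {L : Type*} [LieRing L] [LieAlgebra ℝ L] [FiniteDimensional ℝ L]
    [LieAlgebra.IsSemisimple ℝ L] {B : L →ₗ[ℝ] L →ₗ[ℝ] ℝ} (hB : IsInner B)
    (hinv : ∀ X Y Z : L, B ⁅X, Y⁆ Z = -B Y ⁅X, Z⁆) {X : L} (hX : X ≠ 0) :
    killingForm ℝ L X X < 0 := by
  rw [killingForm_apply_apply]
  refine hB.trace_sq_neg (fun Y Z => hinv X Y Z) fun h0 => hX ?_
  -- If ad X vanishes then X is central, and a semisimple algebra has trivial centre.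
  have h1 : X ∈ LieAlgebra.center ℝ L := by
    rw [← LieAlgebra.self_module_ker_eq_center, LieModule.mem_ker]
    intro Y
    exact LinearMap.congr_fun h0 Y
  rw [LieAlgebra.center_eq_bot] at h1
  exact (LieSubmodule.mem_bot _).1 h1

set_option linter.unusedSectionVars false
set_option linter.style.haveILetI false

variable {E : Type*} [NormedAddCommGroup E] [NormedSpace ℝ E] [FiniteDimensional ℝ E] [CompleteSpace E]
  {G : Type*} [TopologicalSpace G] [ChartedSpace E G] [Group G] [LieGroup 𝓘(ℝ, E) ∞ G]

lemma adE_mul (g h : G) (X : E) : adE E (g * h) X = adE E g (adE E h X) := Ad_mul_apply g h X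
lemma adE_one (X : E) : adE E (1 : G) X = X := Ad_one_apply X
lemma adE_inv_adE (g : G) (X : E) : adE E g⁻¹ (adE E g X) = X := Ad_inv_Ad g X
lemma adE_adE_inv (g : G) (X : E) : adE E g (adE E g⁻¹ X) = X := Ad_Ad_inv g X

lemma continuous_adE (X : E) : Continuous fun g : G => adE E g X := (contMDiff_Ad X).continuous

lemma mdifferentiableAt_adE (X : E) (g : G) :
    MDifferentiableAt 𝓘(ℝ, E) 𝓘(ℝ, E) (fun g : G => adE E g X) g :=
  (contMDiff_Ad X).mdifferentiable (by simp) g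

/-- A form invariant under the adjoint action is invariant under the bracket. -/
lemma bracket_skew_of_invariant {B : E →ₗ[ℝ] E →ₗ[ℝ] ℝ}
    (hB : ∀ (g : G) X Y, B (adE E g X) (adE E g Y) = B X Y) (Z X Y : E) :
    B (brE G Z X) Y = -B X (brE G Z Y) := by
  let B' : E →L[ℝ] E →L[ℝ] ℝ := LinearMap.toContinuousLinearMap
    (LinearMap.toContinuousLinearMap.toLinearMap ∘ₗ B)
  have h := dirDeriv_bilin Z B' (mdifferentiableAt_adE X (1 : G)) (mdifferentiableAt_adE Y (1 : G))
  have e : (fun g : G => B' (adE E g X) (adE E g Y)) = fun _ => B X Y := by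
    ext g; exact hB g X Y
  rw [e, dirDeriv_const, adE_one, adE_one, dirDeriv_one_eq_derivOne, dirDeriv_one_eq_derivOne,
    derivOne_adE, derivOne_adE] at h
  exact eq_neg_of_add_eq_zero_left h.symm

variable [T2Space G] [CompactSpace G] [MeasurableSpace G] [BorelSpace G]

/-- The coordinate inner product of any basis is averaged over the group; compactness makes the
integral converge. -/
lemma exists_invariant_inner (ν : Measure G) [ν.IsHaarMeasure] :
    ∃ B : E →ₗ[ℝ] E →ₗ[ℝ] ℝ, IsInner B ∧ ∀ (g : G) X Y, B (adE E g X) (adE E g Y) = B X Y := by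
  haveI := secondCountable_of_compact E G
  haveI : IsTopologicalGroup G := topologicalGroup_of_lieGroup 𝓘(ℝ, E) ∞
  haveI : ν.IsMulRightInvariant := isMulRightInvariant_of_compact ν
  let b := Module.finBasis ℝ E
  let D : E → E → ℝ := fun X Y => ∑ i, b.repr X i * b.repr Y i
  have hDc : Continuous fun p : E × E => D p.1 p.2 := by
    have : ∀ i, Continuous fun X : E => b.repr X i := fun i =>
      (LinearMap.continuous_of_finiteDimensional (b.coord i))
    exact continuous_finsetSum _ fun i _ => ((this i).comp continuous_fst).mul
      ((this i).comp continuous_snd)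
  have hcont : ∀ X Y, Continuous fun g : G => D (adE E g X) (adE E g Y) := fun X Y =>
    hDc.comp ((continuous_adE X).prodMk (continuous_adE Y))
  have hint : ∀ X Y, Integrable (fun g : G => D (adE E g X) (adE E g Y)) ν := fun X Y =>
    integrable_of_continuous ν (hcont X Y)
  let B : E →ₗ[ℝ] E →ₗ[ℝ] ℝ := LinearMap.mk₂ ℝ (fun X Y => ∫ g : G, D (adE E g X) (adE E g Y) ∂ν)
    (fun X X' Y => by
      rw [← integral_add (hint _ _) (hint _ _)]
      congr 1; ext g; simp [D, add_mul, Finset.sum_add_distrib])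
    (fun c X Y => by
      rw [smul_eq_mul, ← integral_const_mul]
      congr 1; ext g; simp [D, Finset.mul_sum, mul_assoc])
    (fun X Y Y' => by
      rw [← integral_add (hint _ _) (hint _ _)]
      congr 1; ext g; simp [D, mul_add, Finset.sum_add_distrib])
    (fun c X Y => by
      rw [smul_eq_mul, ← integral_const_mul]
      congr 1; ext g; simp only [D, map_smul, Finsupp.smul_apply, smul_eq_mul, Finset.mul_sum]
      exact Finset.sum_congr rfl fun i _ => by ring)
  have hDnn : ∀ X, 0 ≤ D X X := fun X => Finset.sum_nonneg fun i _ => mul_self_nonneg _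
  refine ⟨B, ⟨fun X Y => ?_, fun X hX => ?_⟩, fun h X Y => ?_⟩
  · change ∫ g : G, D (adE E g X) (adE E g Y) ∂ν = ∫ g : G, D (adE E g Y) (adE E g X) ∂ν
    simp only [D, mul_comm]
  · change 0 < ∫ g : G, D (adE E g X) (adE E g X) ∂ν
    refine (hcont X X).integral_pos_of_hasCompactSupport_nonneg_nonzero
      (HasCompactSupport.of_compactSpace _) (fun g => hDnn _) (x := 1) ?_
    rw [adE_one]
    intro h0
    rw [Finset.sum_eq_zero_iff_of_nonneg fun i _ => mul_self_nonneg _] at h0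
    exact hX (b.ext_elem fun i => by simpa using h0 i (Finset.mem_univ i))
  · change ∫ g : G, D (adE E g (adE E h X)) (adE E g (adE E h Y)) ∂ν = ∫ g : G, D (adE E g X) (adE E g Y) ∂ν
    -- Replacing X, Y by Ad_h X, Ad_h Y moves g to g h in the integrand, so right invariance is the
    -- one required.
    rw [← integral_mul_right_eq_self (fun g : G => D (adE E g X) (adE E g Y)) h]
    simp only [adE_mul]

variable (E G) in
/-- The negative of the Killing form on the model space. -/
def kilE : E →ₗ[ℝ] E →ₗ[ℝ] ℝ := Kil E G

/-- For the averaged inner product every ad X is skew, so the trace of (ad X)² is negative unless ad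
X = 0, which semisimplicity excludes for X ≠ 0. -/
lemma kilE_isInner [LieAlgebra.IsSemisimple ℝ (LieAlg E G)] (ν : Measure G) [ν.IsHaarMeasure] :
    IsInner (kilE E G) := by
  obtain ⟨B, hB, hinv⟩ := exists_invariant_inner (E := E) ν
  refine ⟨fun X Y => ?_, fun X hX => ?_⟩
  · change -(killingForm ℝ (LieAlg E G) X Y) = -(killingForm ℝ (LieAlg E G) Y X)
    exact congrArg Neg.neg (LieModule.traceForm_comm ℝ (LieAlg E G) (LieAlg E G) X Y)
  · change 0 < -(killingForm ℝ (LieAlg E G) X X)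
    have hfin : @FiniteDimensional ℝ (LieAlg E G) _ LieRing.toAddCommGroup LieAlgebra.toModule :=
      ‹FiniteDimensional ℝ E›
    exact neg_pos.2 (@killingForm_neg_of_invariant (LieAlg E G) _ _ hfin _ B ⟨hB.symm, hB.pos⟩
      (fun X Y Z => bracket_skew_of_invariant hinv X Y Z) X hX)

end KillingForm

/-! ### Orthogonal projections and representing vectors. -/

noncomputable section OrthogonalProjections

variable {V : Type*} [AddCommGroup V] [Module ℝ V]

namespace IsInner
variable {B : V →ₗ[ℝ] V →ₗ[ℝ] ℝ} (hB : IsInner B)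
include hB

lemma restrict (W : Submodule ℝ V) : IsInner (B.domRestrict₁₂ W W) :=
  ⟨fun X Y => hB.symm X Y, fun X hX => hB.pos X fun h => hX (Subtype.ext h)⟩

variable [FiniteDimensional ℝ V]

lemma exists_projection (W : Submodule ℝ V) :
    ∃ P : V →ₗ[ℝ] W, ∀ (X : V) (w : W), B (P X : V) w = B X w := by
  obtain ⟨b, hb⟩ := (hB.restrict W).exists_orthonormal_basis
  refine ⟨∑ i, (B (b i : V)).smulRight (b i), fun X w => ?_⟩
  have hw := sum_smul_eq hb w
  have hw' : ∑ i, B (b i : V) w • (b i : V) = w := by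
    have := congrArg (Subtype.val) hw
    simp only [Submodule.coe_sum, Submodule.coe_smul] at this
    exact this
  conv_rhs => rw [← hw']
  simp only [LinearMap.sum_apply, LinearMap.smulRight_apply, Submodule.coe_sum, Submodule.coe_smul,
    map_sum, map_smul, LinearMap.smul_apply, smul_eq_mul]
  exact Finset.sum_congr rfl fun i _ => by rw [hB.symm X, mul_comm]

lemma exists_representing (l : V →ₗ[ℝ] ℝ) : ∃ Z, ∀ X, B Z X = l X := by
  obtain ⟨b, hb⟩ := hB.exists_orthonormal_basis
  refine ⟨∑ i, l (b i) • b i, fun X => ?_⟩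
  conv_rhs => rw [← sum_smul_eq hb X]
  simp only [map_sum, map_smul, LinearMap.sum_apply, LinearMap.smul_apply, smul_eq_mul]
  exact Finset.sum_congr rfl fun i _ => mul_comm _ _

end IsInner
end OrthogonalProjections

/-! ### The Lie algebra of the stabilizer and nondegeneracy of ω on 𝔪. -/

noncomputable section StabilizerAlgebra
open MeasureTheory

set_option linter.unusedSectionVars false
set_option linter.style.haveILetI false

variable {E : Type*} [NormedAddCommGroup E] [NormedSpace ℝ E] [FiniteDimensional ℝ E] [CompleteSpace E]
  {G : Type*} [TopologicalSpace G] [ChartedSpace E G] [Group G] [LieGroup 𝓘(ℝ, E) ∞ G]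

/-- A functional on `𝔤`, as a functional on the model space. -/
def dualE (μ : Module.Dual ℝ (LieAlg E G)) : E →ₗ[ℝ] ℝ := μ

lemma dualE_adE_of_mem {μ : Module.Dual ℝ (LieAlg E G)} {s : G} (hs : s ∈ stabilizer μ) (Y : E) :
    dualE μ (adE E s Y) = dualE μ Y := by
  have h := LinearMap.congr_fun (show coAd s⁻¹ μ = μ from (stabilizer μ).inv_mem hs) Y
  have h' : dualE μ (adE E s⁻¹⁻¹ Y) = dualE μ Y := h
  rwa [inv_inv] at h'

lemma mem_stabilizer_of {μ : Module.Dual ℝ (LieAlg E G)} {s : G}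
    (h : ∀ Y, dualE μ (adE E s Y) = dualE μ Y) : s ∈ stabilizer μ := by
  rw [← inv_inv s]
  refine (stabilizer μ).inv_mem ?_
  refine LinearMap.ext fun Y => ?_
  have := h Y
  rw [← inv_inv s] at this
  exact this

lemma brE_skew (X Y : E) : brE G X Y = -brE G Y X :=
  (lie_skew (L := LieAlg E G) X Y).symm

lemma brE_self (X : E) : brE G X X = 0 := lie_self (L := LieAlg E G) X

variable (G) in
lemma brE_add_right (X Y Z : E) : brE G X (Y + Z) = brE G X Y + brE G X Z :=
  lie_add (L := LieAlg E G) (M := LieAlg E G) X Y Z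

variable (G) in
lemma brE_smul_right (c : ℝ) (X Y : E) : brE G X (c • Y) = c • brE G X Y :=
  lie_smul (L := LieAlg E G) (M := LieAlg E G) c X Y

variable (G) in
lemma brE_add_left (X Y Z : E) : brE G (X + Y) Z = brE G X Z + brE G Y Z :=
  add_lie (L := LieAlg E G) (M := LieAlg E G) X Y Z

variable (G) in
lemma brE_smul_left (c : ℝ) (X Y : E) : brE G (c • X) Y = c • brE G X Y :=
  smul_lie (L := LieAlg E G) (M := LieAlg E G) c X Y

lemma adE_brE (g : G) (X Y : E) : adE E g (brE G X Y) = brE G (adE E g X) (adE E g Y) := Ad_lie g X Y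

/-- The Kirillov–Kostant–Souriau form on the model space. -/
def kksE (μ : Module.Dual ℝ (LieAlg E G)) : E →ₗ[ℝ] E →ₗ[ℝ] ℝ :=
  LinearMap.mk₂ ℝ (fun X Y => dualE μ (brE G X Y))
    (fun X X' Y => by rw [brE_add_left, map_add]) (fun c X Y => by rw [brE_smul_left, map_smul])
    (fun X Y Y' => by rw [brE_add_right, map_add]) (fun c X Y => by rw [brE_smul_right, map_smul])

lemma kksE_skew (μ : Module.Dual ℝ (LieAlg E G)) (X Y : E) : kksE μ X Y = -kksE μ Y X := by
  change dualE μ (brE G X Y) = -dualE μ (brE G Y X)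
  rw [brE_skew, map_neg]

lemma kksE_adE {μ : Module.Dual ℝ (LieAlg E G)} {s : G} (hs : s ∈ stabilizer μ) (X Y : E) :
    kksE μ (adE E s X) (adE E s Y) = kksE μ X Y := by
  change dualE μ (brE G (adE E s X) (adE E s Y)) = dualE μ (brE G X Y)
  rw [← adE_brE, dualE_adE_of_mem hs]

lemma kilE_adE (g : G) (X Y : E) : kilE E G (adE E g X) (adE E g Y) = kilE E G X Y := Kil_Ad g X Y

lemma kilE_brE (Z X Y : E) : kilE E G (brE G Z X) Y = -kilE E G X (brE G Z Y) :=
  bracket_skew_of_invariant (fun g X Y => kilE_adE g X Y) Z X Y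

lemma hasDerivAt_adE_of_mem_lieOf {K : Subgroup G} {X : E} (hX : X ∈ lieOf E K) :
    ∃ γ : ℝ → G, (∀ t, γ t ∈ K) ∧ ∀ Y, HasDerivAt (fun t => adE E (γ t) Y) (brE G X Y) 0 := by
  obtain ⟨γ, h1, h2, h3, h4⟩ := hX
  refine ⟨γ, h3, fun Y => ?_⟩
  have := hasDerivAt_comp_of_velocity h1 (by simpa using h2 0 0) h4 (mdifferentiableAt_adE Y (1 : G))
  rwa [derivOne_adE] at this

variable [T2Space G]

/-- If γ stays in the stabilizer, μ(Ad_{γ(t)} Y) is constant, and its derivative at 0 is ω(X, Y).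
Conversely, for the one-parameter group of X the derivative at t is ω(X, Ad_{γ(t)} Y) = 0. In
particular 𝔨, defined as a set of velocities, is a subspace. -/
lemma mem_lieOf_stabilizer_iff {μ : Module.Dual ℝ (LieAlg E G)} {X : E} :
    X ∈ lieOf E (stabilizer μ) ↔ ∀ Y, kksE μ X Y = 0 := by
  constructor
  · intro hX Y
    obtain ⟨γ, h1, h2⟩ := hasDerivAt_adE_of_mem_lieOf hX
    have h3 := (LinearMap.toContinuousLinearMap (dualE μ)).hasFDerivAt.comp_hasDerivAt 0 (h2 Y)
    have h4 : (LinearMap.toContinuousLinearMap (dualE μ)) ∘ (fun t => adE E (γ t) Y) =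
        fun _ => dualE μ Y := by
      ext t; exact dualE_adE_of_mem (h1 t) Y
    rw [h4] at h3
    exact h3.unique (hasDerivAt_const _ _)
  · intro hX
    obtain ⟨γ, h1, h2⟩ := exists_oneParameterGroup (G := G) X
    have h0 : γ 0 = 1 := by simpa using h2 0 0
    have hv := h1.mfderiv_zero h0
    refine ⟨γ, h1.contMDiff, h2, fun t => mem_stabilizer_of fun Y => ?_, hv⟩
    have hd : ∀ t, HasDerivAt (fun t => dualE μ (adE E (γ t) Y)) 0 t := by
      intro t
      have h3 := hasDerivAt_comp_of_velocity h1.contMDiff h0 hv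
        (mdifferentiableAt_adE (adE E (γ t) Y) (1 : G))
      rw [derivOne_adE] at h3
      have h4 := (LinearMap.toContinuousLinearMap (dualE μ)).hasFDerivAt.comp_hasDerivAt 0 h3
      have h5 : (LinearMap.toContinuousLinearMap (dualE μ)) (brE G X (adE E (γ t) Y)) = 0 := hX _
      rw [h5] at h4
      -- γ(s) = γ(s − t)γ(t) reduces the derivative at t to one at 0.
      have h6 := HasDerivAt.comp_sub_const (f := (LinearMap.toContinuousLinearMap (dualE μ)) ∘
        fun s => adE E (γ s) (adE E (γ t) Y)) t t (by rw [sub_self]; exact h4)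
      refine h6.congr_of_eventuallyEq (Filter.Eventually.of_forall fun s => ?_)
      change _ = dualE μ (adE E (γ (s - t)) (adE E (γ t) Y))
      rw [← adE_mul, ← h2, sub_add_cancel]
    have h6 := is_const_of_deriv_eq_zero (fun t => (hd t).differentiableAt) (fun t => (hd t).deriv) t 0
    simpa only [h0, adE_one] using h6

/-- The Lie algebra of the stabilizer, as a subspace of the model space. -/
def stabSubmodule (μ : Module.Dual ℝ (LieAlg E G)) : Submodule ℝ E := LinearMap.ker (kksE μ)

lemma mem_stabSubmodule {μ : Module.Dual ℝ (LieAlg E G)} {X : E} :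
    X ∈ stabSubmodule μ ↔ ∀ Y, kksE μ X Y = 0 := by
  rw [stabSubmodule, LinearMap.mem_ker]
  exact ⟨fun h Y => by rw [h]; rfl, fun h => LinearMap.ext h⟩

lemma mem_tangent_stabilizer_iff {μ : Module.Dual ℝ (LieAlg E G)} {X : E} :
    X ∈ tangent E (stabilizer μ) ↔ ∀ Y ∈ stabSubmodule μ, kilE E G Y X = 0 := by
  constructor
  · intro h Y hY
    exact h Y ((mem_lieOf_stabilizer_iff (E := E)).2 (mem_stabSubmodule.1 hY))
  · intro h Y hY
    exact h Y ((mem_stabSubmodule (E := E)).2 ((mem_lieOf_stabilizer_iff (E := E)).1 hY))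

variable (hK : IsInner (kilE E G))
include hK

lemma eq_zero_of_mem_both {μ : Module.Dual ℝ (LieAlg E G)} {X : E}
    (h1 : X ∈ stabSubmodule μ) (h2 : X ∈ tangent E (stabilizer μ)) : X = 0 :=
  hK.eq_zero (mem_tangent_stabilizer_iff.1 h2 X h1)

/-- ω vanishes on 𝔨 × 𝔤, so a vector of 𝔪 that is ω-orthogonal to 𝔪 is ω-orthogonal to 𝔨 + 𝔪 = 𝔤. It
then lies in 𝔨 ∩ 𝔪, which is zero because Kil is definite. -/
lemma eq_zero_of_kksE_tangent {μ : Module.Dual ℝ (LieAlg E G)} {X : E}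
    (hX : X ∈ tangent E (stabilizer μ))
    (h : ∀ Y ∈ tangent E (stabilizer μ), kksE μ X Y = 0) : X = 0 := by
  refine eq_zero_of_mem_both hK (mem_stabSubmodule.2 fun Y => ?_) hX
  obtain ⟨P, hP⟩ := hK.exists_projection (stabSubmodule μ)
  have h1 : Y - P Y ∈ tangent E (stabilizer μ) := mem_tangent_stabilizer_iff.2 fun Z hZ => by
    rw [map_sub, hK.symm Z, hK.symm Z, hP Y ⟨Z, hZ⟩, sub_self]
  have h2 : kksE μ X (P Y : E) = 0 := by
    rw [kksE_skew, mem_stabSubmodule.1 (P Y).2, neg_zero]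
  have h3 := h _ h1
  rwa [map_sub, h2, sub_zero] at h3

/-- The stabilizer fixes no nonzero tangent vector of the coadjoint orbit at its base point. -/
lemma eq_zero_of_adE_fixed {μ : Module.Dual ℝ (LieAlg E G)} {Y : E}
    (hY : Y ∈ tangent E (stabilizer μ)) (hfix : ∀ s ∈ stabilizer μ, adE E s Y = Y) : Y = 0 := by
  obtain ⟨Z, hZ⟩ := hK.exists_representing (dualE μ)
  -- ω(Z, X) = Kil(Z, [Z, X]) = −Kil([Z, Z], X) = 0, so the vector that represents μ lies in 𝔨.
  have hZk : Z ∈ lieOf E (stabilizer μ) := mem_lieOf_stabilizer_iff.2 fun X => by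
    change dualE μ (brE G Z X) = 0
    have h := kilE_brE (G := G) Z Z X
    rw [brE_self, map_zero, LinearMap.zero_apply, hZ] at h
    linarith
  obtain ⟨γ, h1, h2⟩ := hasDerivAt_adE_of_mem_lieOf hZk
  have h3 : brE G Z Y = 0 := by
    have h4 := h2 Y
    have h5 : (fun t => adE E (γ t) Y) = fun _ => Y := by
      ext t; exact hfix _ (h1 t)
    rw [h5] at h4
    exact h4.unique (hasDerivAt_const _ _)
  -- Since [Z, Y] = 0, ω(Y, X) = Kil(Z, [Y, X]) = −Kil([Y, Z], X) = 0, which puts Y in 𝔨 as well as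
  -- in 𝔪.
  refine eq_zero_of_mem_both hK (mem_stabSubmodule.2 fun X => ?_) hY
  change dualE μ (brE G Y X) = 0
  have h := kilE_brE (G := G) Y Z X
  rw [brE_skew, h3, neg_zero, map_zero, LinearMap.zero_apply, hZ] at h
  linarith

end StabilizerAlgebra

/-! ### Existence and uniqueness of the polar decomposition of a nondegenerate skew form. -/

noncomputable section PolarDecomposition

variable {V : Type*} [AddCommGroup V] [Module ℝ V]

/-- `Om(X, Y) = B(P J X, Y)`, with `P` symmetric and nonnegative and `J` an orthogonal complex
structure for `B`. -/
structure IsPolar (B Om : V →ₗ[ℝ] V →ₗ[ℝ] ℝ) (J P : V →ₗ[ℝ] V) : Prop where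
  J_J : ∀ X, J (J X) = -X
  eq : ∀ X Y, Om X Y = B (P (J X)) Y
  symm : ∀ X Y, B (P X) Y = B X (P Y)
  nonneg : ∀ X, 0 ≤ B (P X) X
  orth : ∀ X Y, B (J X) (J Y) = B X Y

variable {B Om : V →ₗ[ℝ] V →ₗ[ℝ] ℝ}

/-- A nonnegative square root acts on an eigenvector with positive eigenvalue as the root. -/
lemma IsInner.sqrt_apply (hB : IsInner B) {P : V →ₗ[ℝ] V} (hP : ∀ X, 0 ≤ B (P X) X) {c : ℝ}
    (hc : 0 < c) {v : V} (hv : P (P v) = c • v) : P v = Real.sqrt c • v := by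
  rw [← sub_eq_zero]
  apply hB.eq_zero
  set w := P v - Real.sqrt c • v with hw
  -- (P + √c)w = (P² − c)v = 0; pairing with w gives a sum of two nonnegative terms equal to zero.
  have h1 : P w + Real.sqrt c • w = 0 := by
    have h2 : Real.sqrt c * Real.sqrt c = c := Real.mul_self_sqrt hc.le
    rw [hw, map_sub, map_smul, hv, smul_sub, smul_smul, h2]
    abel
  have h3 : B (P w) w + Real.sqrt c * B w w = 0 := by
    have := congrArg (fun x => B x w) h1
    simpa using this
  have h4 := hP w
  have h5 := mul_nonneg (Real.sqrt_nonneg c) (hB.nonneg w)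
  have h6 : Real.sqrt c * B w w = 0 := by linarith
  exact (mul_eq_zero.1 h6).resolve_left (Real.sqrt_pos.2 hc).ne'

variable (hB : IsInner B) (hOm : ∀ X Y, Om X Y = -Om Y X)

include hB hOm in
-- Skewness of ω: the adjoint of PJ is −JP, and it must equal −PJ.
lemma IsPolar.comm {J P : V →ₗ[ℝ] V} (h : IsPolar B Om J P) (X : V) : P (J X) = J (P X) := by
  refine hB.ext fun Y => ?_
  have h1 : ∀ X Y, B (J X) Y = -B X (J Y) := fun X Y => by
    have := h.orth X (J Y)
    rw [h.J_J, map_neg] at this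
    linarith
  rw [h1, ← h.eq, hOm, h.eq, h.symm (J Y), hB.symm (J Y)]

variable [FiniteDimensional ℝ V]

include hB hOm in
-- As P commutes with J, (PJ)² = −P², so ω determines P². On an eigenbasis of P² the nonnegative
-- root is forced, and nondegeneracy makes P injective, so J can be recovered from PJ.
lemma IsPolar.unique (hnd : ∀ X, (∀ Y, Om X Y = 0) → X = 0) {J P J' P' : V →ₗ[ℝ] V}
    (h : IsPolar B Om J P) (h' : IsPolar B Om J' P') : J = J' ∧ P = P' := by
  have hfac : ∀ X, P (J X) = P' (J' X) := fun X => hB.ext fun Y => by rw [← h.eq, ← h'.eq]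
  have hsq : ∀ {J P : V →ₗ[ℝ] V}, IsPolar B Om J P → ∀ X, P (J (P (J X))) = -P (P X) := by
    intro J P h X
    rw [← h.comm hB hOm (J X), h.J_J, map_neg, map_neg]
  have hPP : ∀ X, P (P X) = P' (P' X) := fun X => by
    rw [← neg_inj, ← hsq h, ← hsq h', hfac, hfac]
  have hinj : ∀ X, P X = 0 → X = 0 := fun X hX => by
    have h1 : J X = 0 := hnd _ fun Y => by
      rw [h.eq, h.J_J, map_neg, hX]; simp
    have h2 := h.J_J X
    rw [h1, map_zero] at h2
    exact neg_eq_zero.1 h2.symm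
  obtain ⟨b, c, hb, hc⟩ := hB.exists_eigenbasis (P ∘ₗ P) fun X Y => by
    simp only [LinearMap.comp_apply]; rw [h.symm, h.symm]
  have hcpos : ∀ i, 0 < c i := fun i => by
    have h1 : B ((P ∘ₗ P) (b i)) (b i) = c i := by rw [hc]; simp [hb]
    rw [← h1, LinearMap.comp_apply, h.symm]
    exact hB.pos _ fun h0 => b.ne_zero i (hinj _ h0)
  have hP : P = P' := b.ext fun i => by
    rw [hB.sqrt_apply h.nonneg (hcpos i) (hc i),
      hB.sqrt_apply h'.nonneg (hcpos i) (by rw [← hPP]; exact hc i)]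
  refine ⟨LinearMap.ext fun X => ?_, hP⟩
  rw [← sub_eq_zero]
  apply hinj
  rw [map_sub, hfac, hP, sub_self]

include hB hOm in
-- The operator Γ of ω is skew and injective, so −Γ² is positive. Take P = √(−Γ²), Q = P⁻¹ and J =
-- QΓ. The strict positivity of P is kept because it becomes positivity of the metric.
lemma exists_isPolar (hnd : ∀ X, (∀ Y, Om X Y = 0) → X = 0) :
    ∃ J P : V →ₗ[ℝ] V, IsPolar B Om J P ∧ ∀ X, X ≠ 0 → 0 < B (P X) X := by
  obtain ⟨e, he⟩ := hB.exists_orthonormal_basis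
  let Γ : V →ₗ[ℝ] V := ∑ i, (Om.flip (e i)).smulRight (e i)
  have hΓ : ∀ X Y, Om X Y = B (Γ X) Y := fun X Y => by
    conv_lhs => rw [← IsInner.sum_smul_eq he Y]
    simp only [Γ, LinearMap.sum_apply, LinearMap.smulRight_apply, map_sum, map_smul,
      LinearMap.smul_apply, smul_eq_mul, LinearMap.flip_apply]
    exact Finset.sum_congr rfl fun i _ => mul_comm _ _
  have hΓs : ∀ X Y, B (Γ X) Y = -B X (Γ Y) := fun X Y => by
    rw [← hΓ, hOm, hΓ, hB.symm]
  have hΓ0 : ∀ X, Γ X = 0 → X = 0 := fun X hX => hnd X fun Y => by rw [hΓ, hX]; simp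
  obtain ⟨b, c, hb, hc⟩ := hB.exists_eigenbasis (-(Γ ∘ₗ Γ)) fun X Y => by
    simp only [LinearMap.neg_apply, LinearMap.comp_apply, map_neg]
    rw [hΓs, hΓs, neg_neg]
  have hc' : ∀ i, Γ (Γ (b i)) = -(c i • b i) := fun i => by
    rw [← hc i]; simp
  have hcpos : ∀ i, 0 < c i := fun i => by
    have h1 : B (Γ (b i)) (Γ (b i)) = c i := by
      rw [hΓs, hc']; simp [hb]
    rw [← h1]
    exact hB.pos _ fun h0 => b.ne_zero i (hΓ0 _ h0)
  let P : V →ₗ[ℝ] V := b.constr ℝ fun i => Real.sqrt (c i) • b i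
  let Q : V →ₗ[ℝ] V := b.constr ℝ fun i => (Real.sqrt (c i))⁻¹ • b i
  have hPb : ∀ i, P (b i) = Real.sqrt (c i) • b i := fun i => b.constr_basis ..
  have hQb : ∀ i, Q (b i) = (Real.sqrt (c i))⁻¹ • b i := fun i => b.constr_basis ..
  have hspos : ∀ i, 0 < Real.sqrt (c i) := fun i => Real.sqrt_pos.2 (hcpos i)
  have hPQ : ∀ X, P (Q X) = X := fun X => LinearMap.congr_fun (f := P ∘ₗ Q) (g := LinearMap.id)
    (b.ext fun i => by
      simp only [LinearMap.comp_apply, hQb, map_smul, hPb, smul_smul, LinearMap.id_apply]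
      rw [inv_mul_cancel₀ (hspos i).ne', one_smul]) X
  have hQP : ∀ X, Q (P X) = X := fun X => LinearMap.congr_fun (f := Q ∘ₗ P) (g := LinearMap.id)
    (b.ext fun i => by
      simp only [LinearMap.comp_apply, hQb, map_smul, hPb, smul_smul, LinearMap.id_apply]
      rw [mul_inv_cancel₀ (hspos i).ne', one_smul]) X
  have hPP : ∀ X, P (P X) = -Γ (Γ X) := fun X =>
    LinearMap.congr_fun (f := P ∘ₗ P) (g := -(Γ ∘ₗ Γ)) (b.ext fun i => by
      rw [hc]
      simp only [LinearMap.comp_apply, map_smul, hPb, smul_smul]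
      rw [Real.mul_self_sqrt (hcpos i).le]) X
  have hBP : ∀ X Y, B (P X) Y = ∑ i, Real.sqrt (c i) * (B (b i) X * B (b i) Y) := fun X Y => by
    conv_lhs => rw [← IsInner.sum_smul_eq hb X]
    simp only [map_sum, map_smul, hPb, LinearMap.sum_apply, LinearMap.smul_apply, smul_eq_mul]
    exact Finset.sum_congr rfl fun i _ => by ring
  have hPs : ∀ X Y, B (P X) Y = B X (P Y) := fun X Y => by
    rw [hB.symm X, hBP, hBP]
    exact Finset.sum_congr rfl fun i _ => by ring
  have hPn : ∀ X, 0 ≤ B (P X) X := fun X => by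
    rw [hBP]
    exact Finset.sum_nonneg fun i _ => mul_nonneg (Real.sqrt_nonneg _) (mul_self_nonneg _)
  -- Γ b_i is again an eigenvector of P² = −Γ² with eigenvalue c_i, so P multiplies it by √c_i.
  have hPΓ : ∀ X, P (Γ X) = Γ (P X) := fun X =>
    LinearMap.congr_fun (f := P ∘ₗ Γ) (g := Γ ∘ₗ P) (b.ext fun i => by
      simp only [LinearMap.comp_apply, hPb, map_smul]
      refine hB.sqrt_apply hPn (hcpos i) ?_
      rw [hPP, hc', map_neg, neg_neg, map_smul]) X
  have hQΓ : ∀ X, Q (Γ X) = Γ (Q X) := fun X => by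
    conv_lhs => rw [← hPQ X, ← hPΓ, hQP]
  have hJJ : ∀ X, Q (Γ (Q (Γ X))) = -X := fun X => by
    rw [← hQΓ, ← hQP (-X), ← hQP (P (-X)), map_neg, map_neg, hPP, neg_neg]
  have hJJ' : ∀ X, Q (Q (Γ (Γ X))) = -X := fun X => by rw [hQΓ, hJJ]
  have hpos : ∀ X, X ≠ 0 → 0 < B (P X) X := fun X hX => by
    refine (hPn X).lt_of_ne fun h0 => hX ?_
    rw [hBP, eq_comm, Finset.sum_eq_zero_iff_of_nonneg
      fun i _ => mul_nonneg (Real.sqrt_nonneg _) (mul_self_nonneg _)] at h0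
    rw [← IsInner.sum_smul_eq hb X]
    refine Finset.sum_eq_zero fun i hi => ?_
    rw [mul_self_eq_zero.1 ((mul_eq_zero.1 (h0 i hi)).resolve_left (hspos i).ne'), zero_smul]
  refine ⟨Q ∘ₗ Γ, P, ⟨hJJ, fun X Y => by rw [LinearMap.comp_apply, hPQ, hΓ], hPs, hPn, fun X Y => ?_⟩, hpos⟩
  simp only [LinearMap.comp_apply]
  -- Q is symmetric and commutes with the skew Γ, so B(QΓX, QΓY) = −B(X, Q²Γ²Y) = B(X, Y).
  have hQs : ∀ X Y, B (Q X) Y = B X (Q Y) := fun X Y => by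
    conv_lhs => rw [← hPQ Y, ← hPs, hPQ]
  rw [hQs, hΓs, ← hQΓ, ← hQΓ, hJJ', map_neg, neg_neg]

end PolarDecomposition

/-! ### The canonical Kähler structure of the coadjoint orbit. -/

noncomputable section KahlerStructure

set_option linter.unusedSectionVars false
set_option linter.style.haveILetI false

variable {E : Type*} [NormedAddCommGroup E] [NormedSpace ℝ E] [FiniteDimensional ℝ E] [CompleteSpace E]
  {G : Type*} [TopologicalSpace G] [ChartedSpace E G] [Group G] [LieGroup 𝓘(ℝ, E) ∞ G]

lemma coe_adTangent {K : Subgroup G} (s : K) (X : tangent E K) :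
    (adTangent s X : E) = adE E (s : G) X := rfl

lemma adTangent_inv_adTangent {K : Subgroup G} (s : K) (X : tangent E K) :
    adTangent s⁻¹ (adTangent s X) = X := Subtype.ext (adE_inv_adE (s : G) (X : E))

lemma adTangent_adTangent_inv {K : Subgroup G} (s : K) (X : tangent E K) :
    adTangent s (adTangent s⁻¹ X) = X := Subtype.ext (adE_adE_inv (s : G) (X : E))

variable (E) in
/-- The negative of the Killing form on `𝔪`. -/
def kilT (K : Subgroup G) : tangent E K →ₗ[ℝ] tangent E K →ₗ[ℝ] ℝ :=
  (kilE E G).domRestrict₁₂ (tangent E K) (tangent E K)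

/-- The Kirillov–Kostant–Souriau form on `𝔪`. -/
def kksT (μ : Module.Dual ℝ (LieAlg E G)) :
    tangent E (stabilizer μ) →ₗ[ℝ] tangent E (stabilizer μ) →ₗ[ℝ] ℝ :=
  (kksE μ).domRestrict₁₂ (tangent E (stabilizer μ)) (tangent E (stabilizer μ))

lemma kilT_apply {K : Subgroup G} (X Y : tangent E K) : kilT E K X Y = kilE E G (X : E) (Y : E) := rfl

lemma kilT_adTangent {K : Subgroup G} (s : K) (X Y : tangent E K) :
    kilT E K (adTangent s X) (adTangent s Y) = kilT E K X Y := kilE_adE (s : G) (X : E) (Y : E)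

lemma kilT_adTangent_left {K : Subgroup G} (s : K) (X Y : tangent E K) :
    kilT E K (adTangent s X) Y = kilT E K X (adTangent s⁻¹ Y) := by
  rw [← kilT_adTangent s X, adTangent_adTangent_inv]

lemma kksT_skew (μ : Module.Dual ℝ (LieAlg E G)) (X Y : tangent E (stabilizer μ)) :
    kksT μ X Y = -kksT μ Y X := kksE_skew μ _ _

lemma kksT_adTangent {μ : Module.Dual ℝ (LieAlg E G)} (s : stabilizer μ)
    (X Y : tangent E (stabilizer μ)) :
    kksT μ (adTangent s X) (adTangent s Y) = kksT μ X Y := kksE_adE s.2 (X : E) (Y : E)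

lemma IsKahler.isPolar {μ : Module.Dual ℝ (LieAlg E G)} {H : AlmostHermitian E (stabilizer μ)}
    (h : IsKahler μ H) : ∃ P, IsPolar (kilT E (stabilizer μ)) (kksT μ) H.J P := by
  obtain ⟨Γ, P, h1, h2, h3, h4, h5⟩ := h.polar
  refine ⟨P, H.J_J, fun X Y => ?_, h3, h4, h5⟩
  rw [← h2]
  exact h1 X Y

/-- The adjoint action of the stabilizer preserves both Kil and ω, so it carries polar
decompositions to polar decompositions. -/
lemma IsPolar.conj {μ : Module.Dual ℝ (LieAlg E G)}
    {J P : tangent E (stabilizer μ) →ₗ[ℝ] tangent E (stabilizer μ)}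
    (h : IsPolar (kilT E (stabilizer μ)) (kksT μ) J P) (s : stabilizer μ) :
    IsPolar (kilT E (stabilizer μ)) (kksT μ) (adTangent s ∘ₗ J ∘ₗ adTangent s⁻¹)
      (adTangent s ∘ₗ P ∘ₗ adTangent s⁻¹) where
  J_J X := by
    simp only [LinearMap.comp_apply, adTangent_inv_adTangent, h.J_J, map_neg, adTangent_adTangent_inv]
  eq X Y := by
    simp only [LinearMap.comp_apply, adTangent_inv_adTangent, kilT_adTangent_left]
    rw [← h.eq, kksT_adTangent]
  symm X Y := by
    simp only [LinearMap.comp_apply, kilT_adTangent_left]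
    rw [h.symm, kilT_adTangent_left, inv_inv]
  nonneg X := by
    simp only [LinearMap.comp_apply, kilT_adTangent_left]
    exact h.nonneg _
  orth X Y := by
    simp only [LinearMap.comp_apply, kilT_adTangent, h.orth]

variable (hK : IsInner (kilE E G))
include hK

lemma kilT_isInner (K : Subgroup G) : IsInner (kilT E K) := hK.restrict _

variable [T2Space G]

lemma eq_zero_of_kksT {μ : Module.Dual ℝ (LieAlg E G)} (X : tangent E (stabilizer μ))
    (h : ∀ Y, kksT μ X Y = 0) : X = 0 :=
  Subtype.ext (eq_zero_of_kksE_tangent hK X.2 fun Y hY => h ⟨Y, hY⟩)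

/-- Uniqueness identifies the decomposition with its conjugate by Ad_s; invariance under K needs no
further argument. -/
lemma IsPolar.comm_adTangent {μ : Module.Dual ℝ (LieAlg E G)}
    {J P : tangent E (stabilizer μ) →ₗ[ℝ] tangent E (stabilizer μ)}
    (h : IsPolar (kilT E (stabilizer μ)) (kksT μ) J P) (s : stabilizer μ)
    (X : tangent E (stabilizer μ)) :
    J (adTangent s X) = adTangent s (J X) ∧ P (adTangent s X) = adTangent s (P X) := by
  obtain ⟨h1, h2⟩ := h.unique (kilT_isInner hK _) (kksT_skew μ) (eq_zero_of_kksT hK) (h.conj s)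
  constructor
  · conv_lhs => rw [h1]
    simp only [LinearMap.comp_apply, adTangent_inv_adTangent]
  · conv_lhs => rw [h2]
    simp only [LinearMap.comp_apply, adTangent_inv_adTangent]

lemma IsKahler.ext {μ : Module.Dual ℝ (LieAlg E G)} {H H' : AlmostHermitian E (stabilizer μ)}
    (h : IsKahler μ H) (h' : IsKahler μ H') : H = H' := by
  obtain ⟨P, hP⟩ := h.isPolar
  obtain ⟨P', hP'⟩ := h'.isPolar
  have hJ := (hP.unique (kilT_isInner hK _) (kksT_skew μ) (eq_zero_of_kksT hK) hP').1
  have hg : H.g = H'.g := LinearMap.ext₂ fun X Y => by rw [h.metric, h'.metric, hJ]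
  obtain ⟨⟨J, g, _, _, _, _⟩, _, _⟩ := H
  obtain ⟨⟨J', g', _, _, _, _⟩, _, _⟩ := H'
  simp only at hJ hg
  subst hJ hg
  rfl

lemma existsUnique_isKahler (μ : Module.Dual ℝ (LieAlg E G)) :
    ∃! H : AlmostHermitian E (stabilizer μ), IsKahler μ H := by
  obtain ⟨J, P, hP, hpos⟩ := exists_isPolar (kilT_isInner hK (stabilizer μ)) (kksT_skew μ)
    (eq_zero_of_kksT hK)
  have hc := hP.comm (kilT_isInner hK _) (kksT_skew μ)
  let H : AlmostHermitian E (stabilizer μ) :=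
    { J := J
      -- ω(X, JY) = Kil(PJX, JY) = Kil(JPX, JY) = Kil(PX, Y), so this is the metric prescribed by ω
      -- and J.
      g := kilT E (stabilizer μ) ∘ₗ P
      J_J := hP.J_J
      g_symm := fun X Y => by
        rw [LinearMap.comp_apply, LinearMap.comp_apply, hP.symm, (kilT_isInner hK _).symm]
      g_pos := hpos
      g_J := fun X Y => by
        rw [LinearMap.comp_apply, LinearMap.comp_apply, hc, hP.orth]
      J_Ad := fun s X => (hP.comm_adTangent hK s X).1
      g_Ad := fun s X Y => by
        rw [LinearMap.comp_apply, LinearMap.comp_apply, (hP.comm_adTangent hK s X).2, kilT_adTangent] }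
  have hH : IsKahler μ H :=
    { polar := ⟨P ∘ₗ J, P, fun X Y => hP.eq X Y, fun X => rfl, hP.symm, hP.nonneg, hP.orth⟩
      metric := fun X Y => by
        change kilT E (stabilizer μ) (P X) Y = kksT μ X (J Y)
        rw [hP.eq, hc, hP.orth] }
  exact ⟨H, hH, fun H' hH' => hH'.ext hK hH⟩

end KahlerStructure

/-! ### Creation, annihilation, Clifford action and derivations on the exterior algebra. -/

noncomputable section FockSpace

variable {M : Type*} [NormedAddCommGroup M] [InnerProductSpace ℂ M]

lemma exterior_induction {P : ExteriorAlgebra ℂ M → Prop} (one : P 1)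
    (add : ∀ φ ψ, P φ → P ψ → P (φ + ψ)) (smul : ∀ (z : ℂ) φ, P φ → P (z • φ))
    (mul : ∀ X φ, P φ → P (ExteriorAlgebra.ι ℂ X * φ)) (φ : ExteriorAlgebra ℂ M) : P φ := by
  induction φ using CliffordAlgebra.left_induction with
  | algebraMap r =>
    rw [Algebra.algebraMap_eq_smul_one]
    exact smul r 1 one
  | add φ ψ h1 h2 => exact add φ ψ h1 h2
  | ι_mul φ X h => exact mul X φ h

lemma extDeriv_one (T : M →ₗ[ℂ] M) : extDeriv T 1 = 0 := by
  have h := extDeriv_mul T 1 1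
  simp only [one_mul, mul_one] at h
  exact left_eq_add.1 h

lemma extDeriv_ι_mul (T : M →ₗ[ℂ] M) (X : M) (φ : ExteriorAlgebra ℂ M) :
    extDeriv T (ExteriorAlgebra.ι ℂ X * φ) =
      ExteriorAlgebra.ι ℂ (T X) * φ + ExteriorAlgebra.ι ℂ X * extDeriv T φ := by
  rw [extDeriv_mul, extDeriv_ι]

lemma extDeriv_add (T T' : M →ₗ[ℂ] M) (φ : ExteriorAlgebra ℂ M) :
    extDeriv (T + T') φ = extDeriv T φ + extDeriv T' φ := by
  induction φ using exterior_induction with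
  | one => simp only [extDeriv_one, add_zero]
  | add φ ψ h1 h2 => simp only [map_add, h1, h2]; abel
  | smul z φ h => simp only [map_smul, h, smul_add]
  | mul X φ h => simp only [extDeriv_ι_mul, h, LinearMap.add_apply, map_add, add_mul, mul_add]; abel

lemma extDeriv_smul (z : ℂ) (T : M →ₗ[ℂ] M) (φ : ExteriorAlgebra ℂ M) :
    extDeriv (z • T) φ = z • extDeriv T φ := by
  induction φ using exterior_induction with
  | one => simp only [extDeriv_one, smul_zero]
  | add φ ψ h1 h2 => simp only [map_add, h1, h2, smul_add]
  | smul w φ h => rw [map_smul, map_smul, h, smul_comm]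
  | mul X φ h =>
    simp only [extDeriv_ι_mul, h, LinearMap.smul_apply, map_smul, smul_add, smul_mul_assoc,
      mul_smul_comm]

lemma extDeriv_map {S T T' : M →ₗ[ℂ] M} (h : ∀ X, S (T X) = T' (S X)) (φ : ExteriorAlgebra ℂ M) :
    ExteriorAlgebra.map S (extDeriv T φ) = extDeriv T' (ExteriorAlgebra.map S φ) := by
  induction φ using exterior_induction with
  | one => simp only [extDeriv_one, map_one, map_zero]
  | add φ ψ h1 h2 => simp only [map_add, h1, h2]
  | smul w φ h => simp only [map_smul, h]
  | mul X φ h' =>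
    simp only [extDeriv_ι_mul, map_add, map_mul, ExteriorAlgebra.map_apply_ι, h', h]

lemma fockAnnihilate_map {S : M →ₗ[ℂ] M} (h : ∀ X Y, inner ℂ (S X) (S Y) = inner ℂ X Y) (X : M)
    (φ : ExteriorAlgebra ℂ M) :
    ExteriorAlgebra.map S (fockAnnihilate X φ) = fockAnnihilate (S X) (ExteriorAlgebra.map S φ) := by
  induction φ using exterior_induction with
  | one => simp only [fockAnnihilate_one, map_one, map_zero]
  | add φ ψ h1 h2 => simp only [map_add, h1, h2]
  | smul w φ h => simp only [map_smul, h]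
  | mul Y φ h' =>
    simp only [fockAnnihilate_ι_mul, map_sub, map_mul, map_smul, ExteriorAlgebra.map_apply_ι, h', h]

/-- On X ∧-products the commutator produces −⟨X, TY⟩, which is ⟨TX, Y⟩ exactly because T is
skew-Hermitian. -/
lemma extDeriv_fockAnnihilate {T : M →ₗ[ℂ] M} (h : ∀ X Y, inner ℂ (T X) Y = -inner ℂ X (T Y)) (X : M)
    (φ : ExteriorAlgebra ℂ M) :
    extDeriv T (fockAnnihilate X φ) = fockAnnihilate X (extDeriv T φ) + fockAnnihilate (T X) φ := by
  induction φ using exterior_induction with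
  | one => simp only [fockAnnihilate_one, extDeriv_one, map_zero, add_zero]
  | add φ ψ h1 h2 => simp only [map_add, h1, h2]; abel
  | smul w φ h => simp only [map_smul, h, smul_add]
  | mul Y φ h' =>
    simp only [fockAnnihilate_ι_mul, extDeriv_ι_mul, map_add, map_sub, map_smul, h', h, mul_add,
      neg_smul]
    abel

/-- The commutator of the derivation with κ(X) is κ(TX); it gives the spin connection its Leibniz
rule for Clifford multiplication. -/
lemma extDeriv_fockClifford {T : M →ₗ[ℂ] M} (h : ∀ X Y, inner ℂ (T X) Y = -inner ℂ X (T Y)) (X : M)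
    (φ : ExteriorAlgebra ℂ M) :
    extDeriv T (fockClifford X φ) = fockClifford X (extDeriv T φ) + fockClifford (T X) φ := by
  simp only [fockClifford, fockCreate, LinearMap.smul_apply, LinearMap.add_apply, map_smul, map_add,
    LinearMap.mulLeft_apply, extDeriv_ι_mul, extDeriv_fockAnnihilate h, ← smul_add]
  congr 1
  abel

lemma fockClifford_map {S : M →ₗ[ℂ] M} (h : ∀ X Y, inner ℂ (S X) (S Y) = inner ℂ X Y) (X : M)
    (φ : ExteriorAlgebra ℂ M) :
    ExteriorAlgebra.map S (fockClifford X φ) = fockClifford (S X) (ExteriorAlgebra.map S φ) := by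
  simp only [fockClifford, fockCreate, LinearMap.smul_apply, LinearMap.add_apply, map_smul, map_add,
    LinearMap.mulLeft_apply, map_mul, ExteriorAlgebra.map_apply_ι, fockAnnihilate_map h]

lemma fockAnnihilate_add (X Y : M) (φ : ExteriorAlgebra ℂ M) :
    fockAnnihilate (X + Y) φ = fockAnnihilate X φ + fockAnnihilate Y φ := by
  simp only [fockAnnihilate, map_add, LinearMap.add_apply]

lemma fockAnnihilate_smul (z : ℂ) (X : M) (φ : ExteriorAlgebra ℂ M) :
    fockAnnihilate (z • X) φ = starRingEnd ℂ z • fockAnnihilate X φ := by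
  simp only [fockAnnihilate, LinearMap.map_smulₛₗ, LinearMap.smul_apply,
    RingHom.id_apply]

lemma fockClifford_add (X Y : M) (φ : ExteriorAlgebra ℂ M) :
    fockClifford (X + Y) φ = fockClifford X φ + fockClifford Y φ := by
  simp only [fockClifford, fockCreate, LinearMap.smul_apply, LinearMap.add_apply,
    LinearMap.mulLeft_apply, fockAnnihilate_add, map_add, add_mul, ← smul_add]
  congr 1
  abel

/-- Creation is linear and annihilation conjugate linear in the vector, so their sum admits only
real scalars. -/
lemma fockClifford_smul_real (r : ℝ) (X : M) (φ : ExteriorAlgebra ℂ M) :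
    fockClifford ((r : ℂ) • X) φ = (r : ℂ) • fockClifford X φ := by
  simp only [fockClifford, fockCreate, LinearMap.smul_apply, LinearMap.add_apply,
    LinearMap.mulLeft_apply, fockAnnihilate_smul, map_smul, smul_mul_assoc, Complex.conj_ofReal,
    ← smul_add]
  rw [smul_comm]

/-- The closed form, with signs, is what a Laplace expansion of the determinant can be matched with.
-/
lemma fockAnnihilate_ιMulti (X : M) (q : ℕ) (Y : Fin (q + 1) → M) :
    fockAnnihilate X (ExteriorAlgebra.ιMulti ℂ (q + 1) Y) =
      ∑ j : Fin (q + 1), ((-1) ^ (j : ℕ) * inner ℂ X (Y j) : ℂ) •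
        ExteriorAlgebra.ιMulti ℂ q (fun i => Y (j.succAbove i)) := by
  induction q with
  | zero =>
    rw [ExteriorAlgebra.ιMulti_succ_apply, fockAnnihilate_ι_mul, ExteriorAlgebra.ιMulti_zero_apply,
      fockAnnihilate_one]
    simp
  | succ q ih =>
    rw [ExteriorAlgebra.ιMulti_succ_apply, fockAnnihilate_ι_mul, ih,
      Fin.sum_univ_succ (n := q + 1)]
    simp only [Fin.val_zero, pow_zero, one_mul, Fin.zero_succAbove, Fin.val_succ, pow_succ]
    rw [sub_eq_add_neg, Finset.mul_sum, ← Finset.sum_neg_distrib]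
    congr 1
    refine Finset.sum_congr rfl fun j _ => ?_
    rw [ExteriorAlgebra.ιMulti_succ_apply (v := fun i => Y (j.succ.succAbove i))]
    simp only [Fin.succ_succAbove_zero, mul_smul_comm, mul_neg, mul_one, neg_mul, neg_smul]
    congr 3
    refine congrArg _ (funext fun i => ?_)
    simp [Matrix.vecTail]

variable [FiniteDimensional ℂ M]

lemma extInner_conj (φ ψ : ExteriorAlgebra ℂ M) : starRingEnd ℂ (extInner φ ψ) = extInner ψ φ :=
  extCore.conj_inner_symm ψ φ

lemma extInner_add_left (φ φ' ψ : ExteriorAlgebra ℂ M) :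
    extInner (φ + φ') ψ = extInner φ ψ + extInner φ' ψ := extCore.add_left φ φ' ψ

lemma extInner_smul_left (z : ℂ) (φ ψ : ExteriorAlgebra ℂ M) :
    extInner (z • φ) ψ = starRingEnd ℂ z * extInner φ ψ := extCore.smul_left φ ψ z

lemma extInner_add_right (φ ψ ψ' : ExteriorAlgebra ℂ M) :
    extInner φ (ψ + ψ') = extInner φ ψ + extInner φ ψ' := by
  rw [← extInner_conj, extInner_add_left, map_add, extInner_conj, extInner_conj]

lemma extInner_smul_right (z : ℂ) (φ ψ : ExteriorAlgebra ℂ M) :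
    extInner φ (z • ψ) = z * extInner φ ψ := by
  rw [← extInner_conj, extInner_smul_left, map_mul, extInner_conj, Complex.conj_conj]

/-- The inner product with a fixed element of the exterior algebra. -/
def extInnerRight (φ : ExteriorAlgebra ℂ M) : ExteriorAlgebra ℂ M →ₗ[ℂ] ℂ where
  toFun := extInner φ
  map_add' := extInner_add_right φ
  map_smul' z := extInner_smul_right z φ

lemma extInner_zero_right (φ : ExteriorAlgebra ℂ M) : extInner φ 0 = 0 := (extInnerRight φ).map_zero

lemma extInner_zero_left (φ : ExteriorAlgebra ℂ M) : extInner 0 φ = 0 := by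
  rw [← extInner_conj, extInner_zero_right, map_zero]

/-- Laplace expansion along the row of X: the minors are the inner products with one Y_j removed,
and the signs are those of annihilation. In unequal degrees both sides are zero. -/
lemma extInner_ι_mul_ιMulti (X : M) (p q : ℕ) (W : Fin p → M) (Y : Fin q → M) :
    extInner (ExteriorAlgebra.ι ℂ X * ExteriorAlgebra.ιMulti ℂ p W) (ExteriorAlgebra.ιMulti ℂ q Y) =
      extInner (ExteriorAlgebra.ιMulti ℂ p W) (fockAnnihilate X (ExteriorAlgebra.ιMulti ℂ q Y)) := by
  have h : ExteriorAlgebra.ι ℂ X * ExteriorAlgebra.ιMulti ℂ p W =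
      ExteriorAlgebra.ιMulti ℂ (p + 1) (Fin.cons X W) := by
    rw [ExteriorAlgebra.ιMulti_succ_apply]; rfl
  rw [h, extInner_ιMulti]
  cases q with
  | zero =>
    rw [dif_neg (by omega), ExteriorAlgebra.ιMulti_zero_apply, fockAnnihilate_one,
      extInner_zero_right]
  | succ q =>
    rw [fockAnnihilate_ιMulti]
    change _ = extInnerRight (ExteriorAlgebra.ιMulti ℂ p W) _
    rw [map_sum]
    by_cases e : p = q
    · subst e
      rw [dif_pos rfl, Matrix.det_succ_row_zero]
      refine Finset.sum_congr rfl fun j _ => ?_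
      rw [map_smul, smul_eq_mul]
      change _ = _ * extInner (ExteriorAlgebra.ιMulti ℂ p W) _
      rw [extInner_ιMulti, dif_pos rfl]
      rfl
    · rw [dif_neg (by omega)]
      refine (Finset.sum_eq_zero fun j _ => ?_).symm
      rw [map_smul]
      change _ • extInner (ExteriorAlgebra.ιMulti ℂ p W) _ = _
      rw [extInner_ιMulti, dif_neg e, smul_zero]

omit [FiniteDimensional ℂ M] in
lemma ιMulti_induction {P : ExteriorAlgebra ℂ M → Prop}
    (mem : ∀ p (X : Fin p → M), P (ExteriorAlgebra.ιMulti ℂ p X))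
    (add : ∀ φ ψ, P φ → P ψ → P (φ + ψ)) (smul : ∀ (z : ℂ) φ, P φ → P (z • φ))
    (φ : ExteriorAlgebra ℂ M) : P φ := by
  have h : φ ∈ Submodule.span ℂ
      (Set.range fun x : Σ n, (Fin n → M) => ExteriorAlgebra.ιMulti ℂ x.1 x.2) := by
    rw [ExteriorAlgebra.ιMulti_span]; trivial
  induction h using Submodule.span_induction with
  | mem x hx =>
    obtain ⟨⟨p, X⟩, rfl⟩ := hx
    exact mem p X
  | zero => simpa using smul 0 _ (mem 0 (fun _ => 0))
  | add φ ψ _ _ h1 h2 => exact add φ ψ h1 h2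
  | smul z φ _ h => exact smul z φ h

/-- Creation and annihilation are adjoint. -/
lemma extInner_ι_mul (X : M) (φ ψ : ExteriorAlgebra ℂ M) :
    extInner (ExteriorAlgebra.ι ℂ X * φ) ψ = extInner φ (fockAnnihilate X ψ) := by
  induction φ using ιMulti_induction with
  | mem p W =>
    induction ψ using ιMulti_induction with
    | mem q Y => exact extInner_ι_mul_ιMulti X p q W Y
    | add ψ ψ' h1 h2 => rw [extInner_add_right, h1, h2, map_add, extInner_add_right]
    | smul z ψ h => rw [extInner_smul_right, h, map_smul, extInner_smul_right]
  | add φ φ' h1 h2 => rw [mul_add, extInner_add_left, h1, h2, extInner_add_left]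
  | smul z φ h => rw [mul_smul_comm, extInner_smul_left, h, extInner_smul_left]

lemma extInner_fockAnnihilate (X : M) (φ ψ : ExteriorAlgebra ℂ M) :
    extInner (fockAnnihilate X φ) ψ = extInner φ (ExteriorAlgebra.ι ℂ X * ψ) := by
  rw [← extInner_conj, ← extInner_ι_mul, extInner_conj]

/-- Annihilation plus creation is self-adjoint, and the factor i makes it skew. -/
lemma extInner_fockClifford (X : M) (φ ψ : ExteriorAlgebra ℂ M) :
    extInner (fockClifford X φ) ψ = -extInner φ (fockClifford X ψ) := by
  simp only [fockClifford, fockCreate, LinearMap.smul_apply, LinearMap.add_apply,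
    LinearMap.mulLeft_apply, extInner_smul_left, extInner_add_left, extInner_smul_right,
    extInner_add_right, extInner_ι_mul, extInner_fockAnnihilate, Complex.conj_I]
  ring

/-- Induction on φ: a factor X is moved to the other side as annihilation, where the commutator with
the derivation absorbs the term with TX. -/
lemma extInner_extDeriv {T : M →ₗ[ℂ] M} (h : ∀ X Y, inner ℂ (T X) Y = -inner ℂ X (T Y))
    (φ ψ : ExteriorAlgebra ℂ M) : extInner (extDeriv T φ) ψ = -extInner φ (extDeriv T ψ) := by
  induction φ using exterior_induction generalizing ψ with
  | one =>
    rw [extDeriv_one, extInner_zero_left, eq_comm, neg_eq_zero]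
    -- The unit is orthogonal to every product X ∧ ψ, since annihilation kills it; the derivation
    -- takes values in the span of such products.
    have h1 : ∀ (X : M) ψ, extInner 1 (ExteriorAlgebra.ι ℂ X * ψ) = 0 := fun X ψ => by
      rw [← extInner_conj, extInner_ι_mul, fockAnnihilate_one, extInner_zero_right, map_zero]
    induction ψ using exterior_induction with
    | one => rw [extDeriv_one, extInner_zero_right]
    | add φ ψ h1 h2 => rw [map_add, extInner_add_right, h1, h2, add_zero]
    | smul z φ h => rw [map_smul, extInner_smul_right, h, mul_zero]
    | mul X φ _ => rw [extDeriv_ι_mul, extInner_add_right, h1, h1, add_zero]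
  | add φ φ' h1 h2 => rw [map_add, extInner_add_left, h1, h2, extInner_add_left]; ring
  | smul z φ h => rw [map_smul, extInner_smul_left, h, extInner_smul_left]; ring
  | mul X φ h' =>
    rw [extDeriv_ι_mul, extInner_add_left, extInner_ι_mul, extInner_ι_mul, h', extInner_ι_mul,
      extDeriv_fockAnnihilate h, extInner_add_right]
    ring

end FockSpace

/-! ### The same operators on spinors, indexed by real vectors and endomorphisms. -/

noncomputable section SpinorOperators

set_option linter.unusedSectionVars false

namespace HermitianStructure
variable {V : Type*} [AddCommGroup V] [Module ℝ V] [FiniteDimensional ℝ V]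
  (h : HermitianStructure V)

lemma inner_cliffordAction (X : V) (φ ψ : h.Spinor) :
    inner ℂ (h.cliffordAction X φ) ψ = -inner ℂ φ (h.cliffordAction X ψ) :=
  extInner_fockClifford (h.toCplx X) φ ψ

lemma cliffordAction_add (X Y : V) (φ : h.Spinor) :
    h.cliffordAction (X + Y) φ = h.cliffordAction X φ + h.cliffordAction Y φ :=
  fockClifford_add (h.toCplx X) (h.toCplx Y) φ

lemma ofReal_smul_toCplx (r : ℝ) (X : V) : (r : ℂ) • h.toCplx X = h.toCplx (r • X) := by
  rw [smul_toCplx]; simp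

lemma cliffordAction_smul (r : ℝ) (X : V) (φ : h.Spinor) :
    h.cliffordAction (r • X) φ = (r : ℂ) • h.cliffordAction X φ := by
  have := fockClifford_smul_real r (h.toCplx X) φ
  rw [ofReal_smul_toCplx] at this
  exact this

/-- Clifford multiplication applied to a fixed spinor. -/
def cliffordLeft (φ : h.Spinor) : V →ₗ[ℝ] h.Spinor where
  toFun X := h.cliffordAction X φ
  map_add' X Y := h.cliffordAction_add X Y φ
  map_smul' r X := by
    rw [cliffordAction_smul, Complex.coe_smul]; rfl

/-- Clifford multiplication as a real bilinear map. -/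
def cliffordBilin : V →ₗ[ℝ] h.Spinor →ₗ[ℝ] h.Spinor where
  toFun X := (h.cliffordAction X).restrictScalars ℝ
  map_add' X Y := LinearMap.ext fun φ => (h.cliffordLeft φ).map_add X Y
  map_smul' r X := LinearMap.ext fun φ => (h.cliffordLeft φ).map_smul r X

lemma cplxMap_toCplx {T : V →ₗ[ℝ] V} (hT : ∀ X, T (h.J X) = h.J (T X)) (X : V) :
    h.cplxMap T hT (h.toCplx X) = h.toCplx (T X) := rfl

variable {h} in
-- The imaginary part of the Hermitian product is g(J·, ·), so real skewness together with
-- commutation with J gives complex skewness.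
lemma inner_cplxMap_skew {T : V →ₗ[ℝ] V} (hT : ∀ X, T (h.J X) = h.J (T X))
    (hs : ∀ X Y, h.g (T X) Y = -h.g X (T Y)) (X Y : h.Cplx) :
    inner ℂ (h.cplxMap T hT X) Y = -inner ℂ X (h.cplxMap T hT Y) := by
  obtain ⟨X, rfl⟩ := h.toCplx.surjective X
  obtain ⟨Y, rfl⟩ := h.toCplx.surjective Y
  rw [cplxMap_toCplx, cplxMap_toCplx, inner_toCplx, inner_toCplx, hs, ← hT, hs]
  push_cast; ring

variable {h} in
lemma inner_cplxMap_orth {T : V →ₗ[ℝ] V} (hT : ∀ X, T (h.J X) = h.J (T X))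
    (hs : ∀ X Y, h.g (T X) (T Y) = h.g X Y) (X Y : h.Cplx) :
    inner ℂ (h.cplxMap T hT X) (h.cplxMap T hT Y) = inner ℂ X Y := by
  obtain ⟨X, rfl⟩ := h.toCplx.surjective X
  obtain ⟨Y, rfl⟩ := h.toCplx.surjective Y
  rw [cplxMap_toCplx, cplxMap_toCplx, inner_toCplx, inner_toCplx, ← hT, hs, hs]

variable {h} in
lemma inner_spinorDeriv {T : V →ₗ[ℝ] V} (hT : ∀ X, T (h.J X) = h.J (T X))
    (hs : ∀ X Y, h.g (T X) Y = -h.g X (T Y)) (φ ψ : h.Spinor) :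
    inner ℂ (h.spinorDeriv (h.cplxMap T hT) φ) ψ = -inner ℂ φ (h.spinorDeriv (h.cplxMap T hT) ψ) :=
  extInner_extDeriv (inner_cplxMap_skew hT hs) φ ψ

variable {h} in
lemma spinorDeriv_cliffordAction {T : V →ₗ[ℝ] V} (hT : ∀ X, T (h.J X) = h.J (T X))
    (hs : ∀ X Y, h.g (T X) Y = -h.g X (T Y)) (X : V) (φ : h.Spinor) :
    h.spinorDeriv (h.cplxMap T hT) (h.cliffordAction X φ) =
      h.cliffordAction X (h.spinorDeriv (h.cplxMap T hT) φ) + h.cliffordAction (T X) φ :=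
  extDeriv_fockClifford (inner_cplxMap_skew hT hs) (h.toCplx X) φ

variable {h} in
lemma spinorMap_cliffordAction {T : V →ₗ[ℝ] V} (hT : ∀ X, T (h.J X) = h.J (T X))
    (hs : ∀ X Y, h.g (T X) (T Y) = h.g X Y) (X : V) (φ : h.Spinor) :
    h.spinorMap (h.cplxMap T hT) (h.cliffordAction X φ) =
      h.cliffordAction (T X) (h.spinorMap (h.cplxMap T hT) φ) :=
  fockClifford_map (inner_cplxMap_orth hT hs) (h.toCplx X) φ

variable {h} in
lemma spinorMap_spinorDeriv {S T T' : V →ₗ[ℝ] V} (hS : ∀ X, S (h.J X) = h.J (S X))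
    (hT : ∀ X, T (h.J X) = h.J (T X)) (hT' : ∀ X, T' (h.J X) = h.J (T' X))
    (hc : ∀ X, S (T X) = T' (S X)) (φ : h.Spinor) :
    h.spinorMap (h.cplxMap S hS) (h.spinorDeriv (h.cplxMap T hT) φ) =
      h.spinorDeriv (h.cplxMap T' hT') (h.spinorMap (h.cplxMap S hS) φ) :=
  extDeriv_map (S := h.cplxMap S hS) (T := h.cplxMap T hT) (T' := h.cplxMap T' hT') (fun X => hc X) φ

/-- The action on spinors of a real-linear family of complex endomorphisms of `V_J`. -/
def spinorDerivLeft (A : V →ₗ[ℝ] V →ₗ[ℝ] V) (hA : ∀ X Y, A X (h.J Y) = h.J (A X Y)) (φ : h.Spinor) :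
    V →ₗ[ℝ] h.Spinor where
  toFun X := h.spinorDeriv (h.cplxMap (A X) (hA X)) φ
  map_add' X Y := by
    have e : h.cplxMap (A (X + Y)) (hA (X + Y)) =
        h.cplxMap (A X) (hA X) + h.cplxMap (A Y) (hA Y) := by
      ext Z
      obtain ⟨Z, rfl⟩ := h.toCplx.surjective Z
      rw [LinearMap.add_apply, cplxMap_toCplx, cplxMap_toCplx, cplxMap_toCplx, map_add,
        LinearMap.add_apply, map_add]
    rw [e]
    exact extDeriv_add _ _ φ
  map_smul' r X := by
    have e : h.cplxMap (A (r • X)) (hA (r • X)) = (r : ℂ) • h.cplxMap (A X) (hA X) := by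
      ext Z
      obtain ⟨Z, rfl⟩ := h.toCplx.surjective Z
      rw [LinearMap.smul_apply, cplxMap_toCplx, cplxMap_toCplx, ofReal_smul_toCplx, map_smul, LinearMap.smul_apply]
    rw [e, RingHom.id_apply, ← Complex.coe_smul]
    exact extDeriv_smul _ _ φ

end HermitianStructure
end SpinorOperators

/-! ### Traces over orthonormal bases. -/

noncomputable section OrthonormalSums
variable {V W : Type*} [AddCommGroup V] [Module ℝ V] [AddCommGroup W] [Module ℝ W]
variable {B : V →ₗ[ℝ] V →ₗ[ℝ] ℝ}

lemma IsInner.sum_smul_map {ι : Type*} [Fintype ι] [DecidableEq ι] {b : Module.Basis ι ℝ V}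
    (hb : ∀ i j, B (b i) (b j) = if i = j then 1 else 0) (L : V →ₗ[ℝ] W) (X : V) :
    ∑ i, B (b i) X • L (b i) = L X := by
  conv_rhs => rw [← IsInner.sum_smul_eq hb X, map_sum]
  simp only [map_smul]

/-- The trace of a bilinear map with respect to an inner product does not depend on the basis. -/
lemma sum_orthonormal_eq {ι : Type*} [Fintype ι] [DecidableEq ι] {b b' : Module.Basis ι ℝ V}
    (hb : ∀ i j, B (b i) (b j) = if i = j then 1 else 0)
    (hb' : ∀ i j, B (b' i) (b' j) = if i = j then 1 else 0) (hB : IsInner B)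
    (A : V →ₗ[ℝ] V →ₗ[ℝ] W) : ∑ j, A (b' j) (b' j) = ∑ i, A (b i) (b i) := by
  have h1 : ∀ j, A (b' j) (b' j) = ∑ i, B (b i) (b' j) • A (b i) (b' j) := fun j =>
    (IsInner.sum_smul_map hb (A.flip (b' j)) (b' j)).symm
  have h2 : ∀ i, A (b i) (b i) = ∑ j, B (b i) (b' j) • A (b i) (b' j) := fun i => by
    rw [← IsInner.sum_smul_map hb' (A (b i)) (b i)]
    exact Finset.sum_congr rfl fun j _ => by rw [hB.symm]
  simp only [h1, h2]
  exact Finset.sum_comm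

end OrthonormalSums

/-! ### Global frames of vector fields on G/K. -/

noncomputable section Frames

set_option linter.unusedSectionVars false
set_option linter.style.haveILetI false

variable {E : Type*} [NormedAddCommGroup E] [NormedSpace ℝ E] [FiniteDimensional ℝ E] [CompleteSpace E]
  {G : Type*} [TopologicalSpace G] [ChartedSpace E G] [Group G] [LieGroup 𝓘(ℝ, E) ∞ G]

lemma ContMDiff.linear_comp {F F' : Type*} [NormedAddCommGroup F] [NormedSpace ℝ F]
    [FiniteDimensional ℝ F] [NormedAddCommGroup F'] [NormedSpace ℝ F'] (A : F →ₗ[ℝ] F') {f : G → F}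
    (hf : ContMDiff 𝓘(ℝ, E) 𝓘(ℝ, F) ∞ f) : ContMDiff 𝓘(ℝ, E) 𝓘(ℝ, F') ∞ (fun x => A (f x)) :=
  (LinearMap.toContinuousLinearMap A).contMDiff.comp hf

/-- A real bilinear map between finite-dimensional spaces, as a continuous one. -/
def clmBilin {F F' F'' : Type*} [NormedAddCommGroup F] [NormedSpace ℝ F]
    [FiniteDimensional ℝ F] [NormedAddCommGroup F'] [NormedSpace ℝ F'] [FiniteDimensional ℝ F']
    [NormedAddCommGroup F''] [NormedSpace ℝ F''] (A : F →ₗ[ℝ] F' →ₗ[ℝ] F'') : F →L[ℝ] F' →L[ℝ] F'' :=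
  LinearMap.toContinuousLinearMap (LinearMap.toContinuousLinearMap.toLinearMap ∘ₗ A)

lemma ContMDiff.bilin_comp {F F' F'' : Type*} [NormedAddCommGroup F] [NormedSpace ℝ F]
    [FiniteDimensional ℝ F] [NormedAddCommGroup F'] [NormedSpace ℝ F'] [FiniteDimensional ℝ F']
    [NormedAddCommGroup F''] [NormedSpace ℝ F''] (A : F →ₗ[ℝ] F' →ₗ[ℝ] F'') {f : G → F} {f' : G → F'}
    (hf : ContMDiff 𝓘(ℝ, E) 𝓘(ℝ, F) ∞ f) (hf' : ContMDiff 𝓘(ℝ, E) 𝓘(ℝ, F') ∞ f') :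
    ContMDiff 𝓘(ℝ, E) 𝓘(ℝ, F'') ∞ (fun x => A (f x) (f' x)) :=
  (clmBilin A).isBoundedBilinearMap.contDiff.contMDiff.comp (hf.prodMk_space hf')

lemma dirDeriv_linear (X : E) {F F' : Type*} [NormedAddCommGroup F] [NormedSpace ℝ F]
    [FiniteDimensional ℝ F] [NormedAddCommGroup F'] [NormedSpace ℝ F'] (A : F →ₗ[ℝ] F') {f : G → F}
    (hf : ContMDiff 𝓘(ℝ, E) 𝓘(ℝ, F) ∞ f) (x : G) :
    dirDeriv X (fun y => A (f y)) x = A (dirDeriv X f x) :=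
  dirDeriv_clm_comp X (LinearMap.toContinuousLinearMap A) (hf.mdifferentiable (by simp) x)

lemma dirDeriv_bilinear (X : E) {F F' F'' : Type*} [NormedAddCommGroup F] [NormedSpace ℝ F]
    [FiniteDimensional ℝ F] [NormedAddCommGroup F'] [NormedSpace ℝ F'] [FiniteDimensional ℝ F']
    [NormedAddCommGroup F''] [NormedSpace ℝ F''] (A : F →ₗ[ℝ] F' →ₗ[ℝ] F'') {f : G → F} {f' : G → F'}
    (hf : ContMDiff 𝓘(ℝ, E) 𝓘(ℝ, F) ∞ f) (hf' : ContMDiff 𝓘(ℝ, E) 𝓘(ℝ, F') ∞ f') (x : G) :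
    dirDeriv X (fun y => A (f y) (f' y)) x = A (dirDeriv X f x) (f' x) + A (f x) (dirDeriv X f' x) :=
  dirDeriv_bilin X (clmBilin A) (hf.mdifferentiable (by simp) x) (hf'.mdifferentiable (by simp) x)

lemma adTangent_apply_inv_coe {K : Subgroup G} (s : K) (X : tangent E K) :
    (adTangent s⁻¹ X : E) = adE E (s : G)⁻¹ X := rfl

variable (hK : IsInner (kilE E G)) {K : Subgroup G}

variable (K) in
/-- The orthogonal projection of `𝔤` onto `𝔪`. -/
def projT : E →ₗ[ℝ] tangent E K := Classical.choose (hK.exists_projection (tangent E K))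

lemma kilE_projT (X : E) (w : tangent E K) : kilE E G (projT hK K X : E) w = kilE E G X w :=
  Classical.choose_spec (hK.exists_projection (tangent E K)) X w

lemma projT_ext {X : E} {w : tangent E K} (h : ∀ w' : tangent E K, kilE E G X w' = kilE E G (w : E) w') :
    projT hK K X = w :=
  (kilT_isInner hK K).ext fun w' => (kilE_projT hK X w').trans (h w')

lemma projT_coe (w : tangent E K) : projT hK K (w : E) = w := projT_ext hK fun _ => rfl

lemma projT_adE (s : K) (X : E) : projT hK K (adE E (s : G) X) = adTangent s (projT hK K X) :=
  projT_ext hK fun w => by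
    rw [coe_adTangent]
    have h1 : (w : E) = adE E (s : G) (adTangent s⁻¹ w : tangent E K) :=
      (adE_adE_inv (s : G) (w : E)).symm
    rw [h1, kilE_adE, kilE_adE, kilE_projT]

/-- The vector field on `G/K` given by projecting a fixed vector of `𝔤`. -/
def fieldOf (Y : E) : VectorFields E K :=
  ⟨fun x => projT hK K (adE E x⁻¹ Y),
    ContMDiff.linear_comp (projT hK K) ((contMDiff_Ad Y).comp (contMDiff_inv 𝓘(ℝ, E) ∞)), fun x s => by
      change projT hK K (adE E (x * (s : G))⁻¹ Y) = _
      rw [mul_inv_rev, adE_mul]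
      exact projT_adE hK s⁻¹ _⟩

lemma fieldOf_apply (Y : E) (x : G) : (fieldOf hK Y : VectorFields E K).1 x = projT hK K (adE E x⁻¹ Y) :=
  rfl

lemma fieldOf_one (w : tangent E K) : (fieldOf hK (w : E) : VectorFields E K).1 1 = w := by
  rw [fieldOf_apply, inv_one, adE_one, projT_coe]

/-- Every vector of 𝔪 is the value at any given x of a global field. -/
lemma fieldOf_adE (x : G) (w : tangent E K) :
    (fieldOf hK (adE E x (w : E)) : VectorFields E K).1 x = w := by
  rw [fieldOf_apply, adE_inv_adE, projT_coe]

/-- The function `Kil(V, W)` on `G/K`. -/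
def kilFun (V W : VectorFields E K) : Functions E K :=
  ⟨fun x => kilT E K (V.1 x) (W.1 x), ContMDiff.bilin_comp _ V.2.1 W.2.1, fun x s => by
    change kilT E K (V.1 (x * s)) (W.1 (x * s)) = kilT E K (V.1 x) (W.1 x)
    rw [V.2.2, W.2.2, kilT_adTangent]⟩

/-- Ad_x⁻¹ maps an orthonormal basis of 𝔤 to another, and the projections to 𝔪 of an orthonormal
basis form a Parseval frame. -/
lemma sum_kilT_smul_fieldOf {ι : Type*} [Fintype ι] [DecidableEq ι] {b : Module.Basis ι ℝ E}
    (hb : ∀ i j, kilE E G (b i) (b j) = if i = j then 1 else 0) (x : G) (w : tangent E K) :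
    ∑ k, kilT E K ((fieldOf hK (b k) : VectorFields E K).1 x) w •
      (fieldOf hK (b k) : VectorFields E K).1 x = w := by
  have h := IsInner.sum_smul_map hb (projT hK K ∘ₗ adE E x⁻¹) (adE E x (w : E))
  rw [LinearMap.comp_apply, adE_inv_adE, projT_coe] at h
  refine Eq.trans (Finset.sum_congr rfl fun k _ => ?_) h
  rw [kilT_apply, fieldOf_apply, kilE_projT]
  congr 1
  rw [← kilE_adE x, adE_adE_inv]

/-- The coefficients are K-invariant, so this is an expansion over the functions on G/K: the fields
form a finitely generated module. -/
lemma field_eq_sum {ι : Type*} [Fintype ι] [DecidableEq ι] {b : Module.Basis ι ℝ E}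
    (hb : ∀ i j, kilE E G (b i) (b j) = if i = j then 1 else 0) (V : VectorFields E K) :
    V = ∑ k, mulField (kilFun (fieldOf hK (b k)) V) (fieldOf hK (b k)) := by
  refine Subtype.ext (funext fun x => ?_)
  rw [Submodule.coe_sum, Finset.sum_apply]
  exact (sum_kilT_smul_fieldOf hK hb x (V.1 x)).symm

end Frames

/-! ### Invariant connections as K-equivariant tensors on 𝔪. -/

noncomputable section Connections

set_option linter.unusedSectionVars false
set_option linter.style.haveILetI false

variable {E : Type*} [NormedAddCommGroup E] [NormedSpace ℝ E] [FiniteDimensional ℝ E] [CompleteSpace E]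
  {G : Type*} [TopologicalSpace G] [ChartedSpace E G] [Group G] [LieGroup 𝓘(ℝ, E) ∞ G]
  {K : Subgroup G}

namespace Connection

/-- The difference of `∇` and the canonical connection. -/
def diff (D : Connection E K) (V W : VectorFields E K) (x : G) : tangent E K :=
  (D.toFun V W).1 x - dirDeriv (V.1 x : E) W.1 x

variable (D : Connection E K)

lemma diff_add_left (V V' W : VectorFields E K) (x : G) :
    D.diff (V + V') W x = D.diff V W x + D.diff V' W x := by
  unfold diff
  rw [D.add_left]
  change (D.toFun V W).1 x + (D.toFun V' W).1 x - dirDeriv ((V.1 x : E) + (V'.1 x : E)) W.1 x = _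
  rw [dirDeriv_add_vec]
  abel

lemma diff_add_right (V W W' : VectorFields E K) (x : G) :
    D.diff V (W + W') x = D.diff V W x + D.diff V W' x := by
  unfold diff
  rw [D.add_right]
  change (D.toFun V W).1 x + (D.toFun V W').1 x - dirDeriv (V.1 x : E) (fun y => W.1 y + W'.1 y) x = _
  rw [dirDeriv_add _ (W.2.1.mdifferentiable (by simp) x) (W'.2.1.mdifferentiable (by simp) x)]
  abel

lemma diff_mulField_left (f : Functions E K) (V W : VectorFields E K) (x : G) :
    D.diff (mulField f V) W x = f.1 x • D.diff V W x := by
  unfold diff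
  rw [D.smul_left]
  change f.1 x • (D.toFun V W).1 x - dirDeriv (f.1 x • (V.1 x : E)) W.1 x = _
  rw [dirDeriv_smul_vec, smul_sub]

/-- Both connections obey the same Leibniz rule, so the derivatives of f cancel in their difference.
-/
lemma diff_mulField_right (f : Functions E K) (V W : VectorFields E K) (x : G) :
    D.diff V (mulField f W) x = f.1 x • D.diff V W x := by
  unfold diff
  rw [D.leibniz]
  have h := dirDeriv_bilinear (V.1 x : E) (LinearMap.lsmul ℝ (tangent E K)) f.2.1 W.2.1 x
  have h' : dirDeriv (V.1 x : E) (mulField f W).1 x =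
      diffFun V f x • W.1 x + f.1 x • dirDeriv (V.1 x : E) W.1 x := h
  rw [h', smul_sub]
  abel

lemma diff_sum_left {ι : Type*} (s : Finset ι) (V : ι → VectorFields E K) (W : VectorFields E K)
    (x : G) : D.diff (∑ k ∈ s, V k) W x = ∑ k ∈ s, D.diff (V k) W x :=
  map_sum (AddMonoidHom.mk' (fun V => D.diff V W x) fun V V' => D.diff_add_left V V' W x) V s

lemma diff_sum_right {ι : Type*} (s : Finset ι) (V : VectorFields E K) (W : ι → VectorFields E K)
    (x : G) : D.diff V (∑ k ∈ s, W k) x = ∑ k ∈ s, D.diff V (W k) x :=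
  map_sum (AddMonoidHom.mk' (fun W => D.diff V W x) fun W W' => D.diff_add_right V W W' x) W s

variable (hK : IsInner (kilE E G))

include hK in
-- Linearity over functions and the finite global frame reduce the value at x to the coefficients at
-- x.
lemma diff_congr_left {V V' : VectorFields E K} (W : VectorFields E K) {x : G} (h : V.1 x = V'.1 x) :
    D.diff V W x = D.diff V' W x := by
  obtain ⟨b, hb⟩ := hK.exists_orthonormal_basis
  rw [field_eq_sum hK hb V, field_eq_sum hK hb V', diff_sum_left, diff_sum_left]
  refine Finset.sum_congr rfl fun k _ => ?_
  rw [diff_mulField_left, diff_mulField_left]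
  change kilT E K _ (V.1 x) • _ = kilT E K _ (V'.1 x) • _
  rw [h]

include hK in
lemma diff_congr_right (V : VectorFields E K) {W W' : VectorFields E K} {x : G} (h : W.1 x = W'.1 x) :
    D.diff V W x = D.diff V W' x := by
  obtain ⟨b, hb⟩ := hK.exists_orthonormal_basis
  rw [field_eq_sum hK hb W, field_eq_sum hK hb W', diff_sum_right, diff_sum_right]
  refine Finset.sum_congr rfl fun k _ => ?_
  rw [diff_mulField_right, diff_mulField_right]
  change kilT E K _ (W.1 x) • _ = kilT E K _ (W'.1 x) • _
  rw [h]

/-- The bilinear map on `𝔪` that gives the difference of `∇` and the canonical connection at `1`. -/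
def tensor : tangent E K →ₗ[ℝ] tangent E K →ₗ[ℝ] tangent E K :=
  LinearMap.mk₂ ℝ (fun X Y => D.diff (fieldOf hK (X : E)) (fieldOf hK (Y : E)) 1)
    (fun X X' Y => by
      rw [← diff_add_left]
      refine D.diff_congr_left hK _ ?_
      change _ = (fieldOf hK (X : E) : VectorFields E K).1 1 + (fieldOf hK (X' : E) : VectorFields E K).1 1
      simp only [fieldOf_one])
    (fun c X Y => by
      refine Eq.trans ?_ (D.diff_mulField_left (algebraMap ℝ (Functions E K) c) _ _ 1)
      refine D.diff_congr_left hK _ ?_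
      change _ = c • (fieldOf hK (X : E) : VectorFields E K).1 1
      simp only [fieldOf_one])
    (fun X Y Y' => by
      rw [← diff_add_right]
      refine D.diff_congr_right hK _ ?_
      change _ = (fieldOf hK (Y : E) : VectorFields E K).1 1 + (fieldOf hK (Y' : E) : VectorFields E K).1 1
      simp only [fieldOf_one])
    (fun c X Y => by
      refine Eq.trans ?_ (D.diff_mulField_right (algebraMap ℝ (Functions E K) c) _ _ 1)
      refine D.diff_congr_right hK _ ?_
      change _ = c • (fieldOf hK (Y : E) : VectorFields E K).1 1
      simp only [fieldOf_one])

lemma tensor_apply_one (V W : VectorFields E K) : D.tensor hK (V.1 1) (W.1 1) = D.diff V W 1 := by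
  change D.diff _ _ 1 = _
  rw [D.diff_congr_left hK (V' := V) _ (fieldOf_one hK _), D.diff_congr_right hK V (fieldOf_one hK _)]

variable {D}

/-- Both ∇ and ∂ commute with left translations, so the difference at x is carried to the one at
`1`. -/
lemma IsInvariant.diff_eq (hD : D.IsInvariant) (V W : VectorFields E K) (x : G) :
    D.diff V W x = D.tensor hK (V.1 x) (W.1 x) := by
  have h1 : ∀ V : VectorFields E K, (translate x⁻¹ V).1 1 = V.1 x := fun V => by
    change V.1 (x⁻¹⁻¹ * 1) = V.1 x
    rw [inv_inv, mul_one]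
  have h2 := D.tensor_apply_one hK (translate x⁻¹ V) (translate x⁻¹ W)
  rw [h1, h1] at h2
  rw [h2, diff, diff, ← hD, h1, h1]
  congr 1
  have h3 : (translate x⁻¹ W).1 = fun z => W.1 (x * z) := by
    ext z
    change (W.1 (x⁻¹⁻¹ * z) : E) = _
    rw [inv_inv]
  rw [h3, dirDeriv_comp_mul_left _ _ (W.2.1.mdifferentiable (by simp) _), mul_one]

lemma IsInvariant.apply_eq (hD : D.IsInvariant) (V W : VectorFields E K) (x : G) :
    (D.toFun V W).1 x = dirDeriv (V.1 x : E) W.1 x + D.tensor hK (V.1 x) (W.1 x) := by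
  rw [← hD.diff_eq hK, diff]
  abel

/-- ∇_V W and ∂_V W both transform by Ad_s⁻¹ when the point moves from `1` to s; so does their
difference. -/
lemma IsInvariant.tensor_adTangent (hD : D.IsInvariant) (s : K) (X Y : tangent E K) :
    D.tensor hK (adTangent s⁻¹ X) (adTangent s⁻¹ Y) = adTangent s⁻¹ (D.tensor hK X Y) := by
  let V : VectorFields E K := fieldOf hK (X : E)
  let W : VectorFields E K := fieldOf hK (Y : E)
  have hV : V.1 1 = X := fieldOf_one hK X
  have hW : W.1 1 = Y := fieldOf_one hK Y
  have h1 := hD.apply_eq hK V W (1 * (s : G))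
  rw [V.2.2, W.2.2, (D.toFun V W).2.2, hD.apply_eq hK V W 1, hV, hW, map_add] at h1
  have h2 : dirDeriv (adTangent s⁻¹ X : E) W.1 (1 * (s : G)) =
      adTangent s⁻¹ (dirDeriv (X : E) W.1 1) := by
    rw [adTangent_apply_inv_coe, ← dirDeriv_comp_mul_right _ _ (W.2.1.mdifferentiable (by simp) _),
      ← dirDeriv_linear _ _ W.2.1]
    congr 1
    exact funext fun z => W.2.2 z s
  rw [h2] at h1
  exact (add_left_cancel h1).symm

variable {H : AlmostHermitian E K}

lemma CommutesWithJ.tensor_J (hJ : D.CommutesWithJ H) (hD : D.IsInvariant) (X Y : tangent E K) :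
    D.tensor hK X (H.J Y) = H.J (D.tensor hK X Y) := by
  let V : VectorFields E K := fieldOf hK (X : E)
  let W : VectorFields E K := fieldOf hK (Y : E)
  have hV : V.1 1 = X := fieldOf_one hK X
  have hW : W.1 1 = Y := fieldOf_one hK Y
  have h1 : (D.toFun V (H.JField W)).1 1 = H.J ((D.toFun V W).1 1) :=
    congrFun (congrArg Subtype.val (hJ V W)) 1
  rw [hD.apply_eq hK, hD.apply_eq hK, map_add] at h1
  have h2 : dirDeriv (V.1 1 : E) (H.JField W).1 1 = H.J (dirDeriv (V.1 1 : E) W.1 1) :=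
    dirDeriv_linear _ H.J W.2.1 1
  rw [h2] at h1
  have h3 := add_left_cancel h1
  have h4 : (H.JField W).1 1 = H.J (W.1 1) := rfl
  rwa [h4, hV, hW] at h3

/-- As g is constant on 𝔪, ∂ is already compatible with it; the remaining terms of the compatibility
condition must cancel. -/
lemma IsCompatible.tensor_skew (hg : D.IsCompatible H) (hD : D.IsInvariant) (X Y Z : tangent E K) :
    H.g (D.tensor hK X Y) Z = -H.g Y (D.tensor hK X Z) := by
  let U : VectorFields E K := fieldOf hK (X : E)
  let V : VectorFields E K := fieldOf hK (Y : E)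
  let W : VectorFields E K := fieldOf hK (Z : E)
  have hU : U.1 1 = X := fieldOf_one hK X
  have hV : V.1 1 = Y := fieldOf_one hK Y
  have hW : W.1 1 = Z := fieldOf_one hK Z
  have h1 := hg U V W 1
  rw [dirDeriv_bilinear _ H.g V.2.1 W.2.1, hD.apply_eq hK, hD.apply_eq hK, hU, hV, hW] at h1
  simp only [map_add, LinearMap.add_apply] at h1
  linarith

/-- The tensor satisfies the condition behind the choice in `Connection.form`, and the values of
fields at x exhaust 𝔪, so the choice is forced. -/
lemma form_eq (hJ : D.CommutesWithJ H) (hD : D.IsInvariant) (V : VectorFields E K) (x : G) :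
    D.form H V x = H.cplxMap (D.tensor hK (V.1 x)) (hJ.tensor_J hK hD (V.1 x)) := by
  have hspec : ∀ W : VectorFields E K,
      H.cplxMap (D.tensor hK (V.1 x)) (hJ.tensor_J hK hD (V.1 x)) (H.toCplx (W.1 x)) =
        H.toCplx ((D.toFun V W).1 x - dirDeriv (V.1 x : E) W.1 x) := fun W => by
    rw [HermitianStructure.cplxMap_toCplx, ← hD.diff_eq hK, diff]
  have hform := Classical.epsilon_spec (p := fun T : H.Cplx →ₗ[ℂ] H.Cplx =>
    ∀ W : VectorFields E K,
      T (H.toCplx (W.1 x)) = H.toCplx ((D.toFun V W).1 x - dirDeriv (V.1 x : E) W.1 x)) ⟨_, hspec⟩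
  refine LinearMap.ext fun Y => ?_
  obtain ⟨Y, rfl⟩ := H.toCplx.surjective Y
  rw [← fieldOf_adE hK x Y, hspec]
  exact hform _

end Connection

variable [T2Space G]

/-- The trace of the difference of `∇` and the canonical connection is zero. -/
lemma Connection.IsInvariant.sum_tensor_eq_zero {μ : Module.Dual ℝ (LieAlg E G)}
    (hK : IsInner (kilE E G)) {H : AlmostHermitian E (stabilizer μ)} {D : Connection E (stabilizer μ)}
    (hD : D.IsInvariant) {ι : Type*} [Fintype ι] [DecidableEq ι]
    {e : Module.Basis ι ℝ (tangent E (stabilizer μ))}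
    (he : ∀ i j, H.g (e i) (e j) = if i = j then 1 else 0) : ∑ j, D.tensor hK (e j) (e j) = 0 := by
  -- It suffices that the sum is fixed by K. Ad_s is an isometry, so it maps e to another
  -- orthonormal basis, and by equivariance the sum to the trace over that basis.
  refine Subtype.ext (eq_zero_of_adE_fixed hK (Subtype.prop _) fun s hs => ?_)
  let S : tangent E (stabilizer μ) ≃ₗ[ℝ] tangent E (stabilizer μ) :=
    LinearEquiv.ofLinearMap (adTangent (⟨s, hs⟩ : stabilizer μ)) (adTangent (⟨s, hs⟩ : stabilizer μ)⁻¹)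
      (LinearMap.ext fun X => adTangent_adTangent_inv _ X)
      (LinearMap.ext fun X => adTangent_inv_adTangent _ X)
  have he' : ∀ i j, H.g ((e.map S) i) ((e.map S) j) = if i = j then 1 else 0 := fun i j => by
    rw [← he, Module.Basis.map_apply, Module.Basis.map_apply]
    exact H.g_Ad _ _ _
  have h1 := sum_orthonormal_eq he he' ⟨H.g_symm, H.g_pos⟩ (D.tensor hK)
  have h2 : adTangent (⟨s, hs⟩ : stabilizer μ) (∑ j, D.tensor hK (e j) (e j)) =
      ∑ j, D.tensor hK (e j) (e j) := by
    rw [map_sum, ← h1]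
    refine Finset.sum_congr rfl fun j _ => ?_
    have h3 := hD.tensor_adTangent hK (⟨s, hs⟩ : stabilizer μ)⁻¹ (e j) (e j)
    rw [inv_inv] at h3
    exact h3.symm
  exact congrArg Subtype.val h2

end Connections

/-! ### The real bilinear form underlying the inner product of spinors. -/

noncomputable section SpinorInner

namespace HermitianStructure
variable {V : Type*} [AddCommGroup V] [Module ℝ V] [FiniteDimensional ℝ V]
  (h : HermitianStructure V)

lemma spinor_inner_add_left (a a' b : h.Spinor) :
    inner ℂ (a + a') b = inner ℂ a b + inner ℂ a' b := inner_add_left a a' b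

lemma spinor_inner_add_right (a b b' : h.Spinor) :
    inner ℂ a (b + b') = inner ℂ a b + inner ℂ a b' := inner_add_right a b b'

/-- The inner product of spinors as a real bilinear map. -/
def spinorInner : h.Spinor →ₗ[ℝ] h.Spinor →ₗ[ℝ] ℂ :=
  LinearMap.mk₂ ℝ (fun a b => inner ℂ a b) h.spinor_inner_add_left
    (fun c a b => (inner_smul_left (𝕜 := ℂ) a b (c : ℂ)).trans (by
      rw [Complex.conj_ofReal]; exact Complex.real_smul.symm))
    h.spinor_inner_add_right
    (fun c a b => (inner_smul_right (𝕜 := ℂ) a b (c : ℂ)).trans Complex.real_smul.symm)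

end HermitianStructure
end SpinorInner

/-! ### The Dirac operator: existence, uniqueness, formal self-adjointness. -/

noncomputable section DiracOperator
open MeasureTheory

set_option linter.unusedSectionVars false
set_option linter.style.haveILetI false

variable {E : Type*} [NormedAddCommGroup E] [NormedSpace ℝ E] [FiniteDimensional ℝ E] [CompleteSpace E]
  {G : Type*} [TopologicalSpace G] [ChartedSpace E G] [Group G] [LieGroup 𝓘(ℝ, E) ∞ G]
  {K : Subgroup G}

namespace AlmostHermitian

/-- A bilinear map on `𝔪`, invariant under `K`, whose values are skew-Hermitian operators. -/
structure IsInvariantTensor (H : AlmostHermitian E K)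
    (A : tangent E K →ₗ[ℝ] tangent E K →ₗ[ℝ] tangent E K) : Prop where
  comm : ∀ X Y, A X (H.J Y) = H.J (A X Y)
  skew : ∀ X Y Z, H.g (A X Y) Z = -H.g Y (A X Z)
  equivariant : ∀ (s : K) X Y, A (adTangent s⁻¹ X) (adTangent s⁻¹ Y) = adTangent s⁻¹ (A X Y)

variable (H : AlmostHermitian E K) {A : tangent E K →ₗ[ℝ] tangent E K →ₗ[ℝ] tangent E K}
  (hA : H.IsInvariantTensor A)

/-- The covariant derivative of a spinor-valued function at `x`, as a function of the direction. -/
def nabla (ψ : G → H.Spinor) (x : G) : tangent E K →ₗ[ℝ] H.Spinor :=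
  dirDerivₗ ψ x ∘ₗ (tangent E K).subtype + H.spinorDerivLeft A hA.comm (ψ x)

lemma nabla_apply (ψ : G → H.Spinor) (x : G) (X : tangent E K) :
    H.nabla hA ψ x X = dirDeriv (X : E) ψ x + H.spinorDeriv (H.cplxMap (A X) (hA.comm X)) (ψ x) := rfl

lemma contMDiff_nabla {ψ : G → H.Spinor} (hψ : ContMDiff 𝓘(ℝ, E) 𝓘(ℝ, H.Spinor) ∞ ψ)
    (X : tangent E K) : ContMDiff 𝓘(ℝ, E) 𝓘(ℝ, H.Spinor) ∞ fun x => H.nabla hA ψ x X :=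
  (ContMDiff.dirDeriv (X : E) hψ).add
    (ContMDiff.linear_comp ((H.spinorDeriv (H.cplxMap (A X) (hA.comm X))).restrictScalars ℝ) hψ)

lemma nabla_add {ψ φ : G → H.Spinor} (hψ : ContMDiff 𝓘(ℝ, E) 𝓘(ℝ, H.Spinor) ∞ ψ)
    (hφ : ContMDiff 𝓘(ℝ, E) 𝓘(ℝ, H.Spinor) ∞ φ) (x : G) (X : tangent E K) :
    H.nabla hA (ψ + φ) x X = H.nabla hA ψ x X + H.nabla hA φ x X := by
  have h : dirDeriv (X : E) (ψ + φ) x = dirDeriv (X : E) ψ x + dirDeriv (X : E) φ x :=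
    dirDeriv_add _ (hψ.mdifferentiable (by simp) x) (hφ.mdifferentiable (by simp) x)
  rw [nabla_apply, nabla_apply, nabla_apply, h, Pi.add_apply, map_add]
  abel

lemma nabla_smul {ψ : G → H.Spinor} (hψ : ContMDiff 𝓘(ℝ, E) 𝓘(ℝ, H.Spinor) ∞ ψ) (z : ℂ) (x : G)
    (X : tangent E K) : H.nabla hA (z • ψ) x X = z • H.nabla hA ψ x X := by
  have h : dirDeriv (X : E) (z • ψ) x = z • dirDeriv (X : E) ψ x :=
    dirDeriv_linear _ ((z • LinearMap.id : H.Spinor →ₗ[ℂ] H.Spinor).restrictScalars ℝ) hψ x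
  rw [nabla_apply, nabla_apply, h, Pi.smul_apply, map_smul, smul_add]

lemma dirDeriv_spinor_map {S : H.Spinor →ₗ[ℂ] H.Spinor} {ψ : G → H.Spinor}
    (hψ : ContMDiff 𝓘(ℝ, E) 𝓘(ℝ, H.Spinor) ∞ ψ) (x : G) (X : tangent E K) :
    dirDeriv (X : E) (fun y => S (ψ y)) x = S (dirDeriv (X : E) ψ x) :=
  dirDeriv_linear _ (S.restrictScalars ℝ) hψ x

/-- The derivative part transforms by the rule for right translations, the algebraic part by
equivariance of A; hence covariant derivatives along fields are again spinor fields. -/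
lemma nabla_mul_right {χ : K →ₜ* Circle} (ψ : H.SpinorFields χ) (x : G) (s : K) (X : tangent E K) :
    H.nabla hA ψ.1 (x * s) (adTangent s⁻¹ X) =
      starRingEnd ℂ (χ s : ℂ) • H.spinorAd s⁻¹ (H.nabla hA ψ.1 x X) := by
  have h1 : dirDeriv (adTangent s⁻¹ X : E) ψ.1 (x * s) =
      starRingEnd ℂ (χ s : ℂ) • H.spinorAd s⁻¹ (dirDeriv (X : E) ψ.1 x) := by
    rw [adTangent_apply_inv_coe,
      ← dirDeriv_comp_mul_right _ _ (ψ.2.1.mdifferentiable (by simp) _),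
      ← LinearMap.smul_apply, ← H.dirDeriv_spinor_map ψ.2.1]
    congr 1
    exact funext fun z => ψ.2.2 z s
  have h2 := HermitianStructure.spinorMap_spinorDeriv (fun Y => (H.J_Ad s⁻¹ Y).symm)
    (hA.comm X) (hA.comm (adTangent s⁻¹ X)) (fun Y => (hA.equivariant s X Y).symm) (ψ.1 x)
  have h3 : H.spinorAd s⁻¹ (H.spinorDeriv (H.cplxMap (A X) (hA.comm X)) (ψ.1 x)) =
    H.spinorDeriv (H.cplxMap (A (adTangent s⁻¹ X)) (hA.comm (adTangent s⁻¹ X)))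
      (H.spinorAd s⁻¹ (ψ.1 x)) := h2
  rw [nabla_apply, nabla_apply, h1, ψ.2.2, map_smul, map_add, smul_add, h3]

/-- The Clifford product of spinor fields by a vector field. -/
def cliffordField (χ : K →ₜ* Circle) (U : VectorFields E K) :
    H.SpinorFields χ →ₗ[ℂ] H.SpinorFields χ where
  toFun ψ := ⟨fun x => H.cliffordAction (U.1 x) (ψ.1 x),
    ContMDiff.bilin_comp H.cliffordBilin U.2.1 ψ.2.1, fun x s => by
      change H.cliffordAction (U.1 (x * s)) (ψ.1 (x * s)) =
        _ • H.spinorAd s⁻¹ (H.cliffordAction (U.1 x) (ψ.1 x))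
      rw [U.2.2, ψ.2.2, map_smul]
      congr 1
      exact (HermitianStructure.spinorMap_cliffordAction (fun Y => (H.J_Ad s⁻¹ Y).symm)
        (H.g_Ad s⁻¹) (U.1 x) (ψ.1 x)).symm⟩
  map_add' ψ φ := Subtype.ext (funext fun x => map_add _ _ _)
  map_smul' z ψ := Subtype.ext (funext fun x => map_smul (H.cliffordAction (U.1 x)) z (ψ.1 x))

lemma exists_orthonormal_basis : ∃ e : Module.Basis (Fin (Module.finrank ℝ (tangent E K))) ℝ (tangent E K),
    ∀ i j, H.g (e i) (e j) = if i = j then 1 else 0 :=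
  IsInner.exists_orthonormal_basis ⟨H.g_symm, H.g_pos⟩

lemma contMDiff_nabla_field (V : VectorFields E K) {ψ : G → H.Spinor}
    (hψ : ContMDiff 𝓘(ℝ, E) 𝓘(ℝ, H.Spinor) ∞ ψ) :
    ContMDiff 𝓘(ℝ, E) 𝓘(ℝ, H.Spinor) ∞ fun x => H.nabla hA ψ x (V.1 x) := by
  obtain ⟨e, he⟩ := H.exists_orthonormal_basis
  -- A constant basis of 𝔪 moves the dependence of the direction on x into smooth coefficients.
  have h : (fun x => H.nabla hA ψ x (V.1 x)) =
      fun x => ∑ i, H.g (e i) (V.1 x) • H.nabla hA ψ x (e i) :=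
    funext fun x => (IsInner.sum_smul_map he _ _).symm
  rw [h]
  exact contMDiff_finsetSum fun i _ => (ContMDiff.linear_comp (H.g (e i)) V.2.1).smul
    (H.contMDiff_nabla hA hψ (e i))

/-- The covariant derivative of spinor fields along a vector field. -/
def nablaField (χ : K →ₜ* Circle) (V : VectorFields E K) :
    H.SpinorFields χ →ₗ[ℂ] H.SpinorFields χ where
  toFun ψ := ⟨fun x => H.nabla hA ψ.1 x (V.1 x), H.contMDiff_nabla_field hA V ψ.2.1, fun x s => by
    change H.nabla hA ψ.1 (x * s) (V.1 (x * s)) = _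
    rw [V.2.2, nabla_mul_right]⟩
  map_add' ψ φ := Subtype.ext (funext fun x => H.nabla_add hA ψ.2.1 φ.2.1 x _)
  map_smul' z ψ := Subtype.ext (funext fun x => H.nabla_smul hA ψ.2.1 z x _)

/-- A vector field, transported by the operator that relates the Killing form to the metric. -/
lemma exists_gradField (V : VectorFields E K) :
    ∃ U : VectorFields E K, ∀ x Y, H.g (U.1 x) Y = kilT E K (V.1 x) Y := by
  obtain ⟨e, he⟩ := H.exists_orthonormal_basis
  let S : tangent E K →ₗ[ℝ] tangent E K := ∑ j, ((kilT E K).flip (e j)).smulRight (e j)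
  have hS : ∀ X Y, H.g (S X) Y = kilT E K X Y := fun X Y => by
    rw [← IsInner.sum_smul_map he (kilT E K X) Y]
    simp only [S, LinearMap.sum_apply, LinearMap.smulRight_apply, map_sum, map_smul,
      LinearMap.smul_apply, smul_eq_mul, LinearMap.flip_apply]
    exact Finset.sum_congr rfl fun i _ => mul_comm _ _
  have hg : IsInner H.g := ⟨H.g_symm, H.g_pos⟩
  have hSs : ∀ (s : K) X, S (adTangent s X) = adTangent s (S X) := fun s X => hg.ext fun Y => by
    rw [hS, kilT_adTangent_left, ← hS, ← H.g_Ad s, adTangent_adTangent_inv]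
  exact ⟨⟨fun x => S (V.1 x), ContMDiff.linear_comp S V.2.1, fun x s => by
    change S (V.1 (x * s)) = _
    rw [V.2.2, hSs]⟩, fun x Y => hS _ _⟩

variable {H} {D : Connection E K}

/-- The Clifford contraction of ∑ U_k ⊗ φ_k depends only on the linear map that the metric attaches
to it, not on the chosen decomposition. -/
lemma sum_clifford_eq {ι : Type*} [Fintype ι] [DecidableEq ι] {e : Module.Basis ι ℝ (tangent E K)}
    (he : ∀ i j, H.g (e i) (e j) = if i = j then 1 else 0) {n : ℕ} (U : Fin n → tangent E K)
    (φ : Fin n → H.Spinor) (L : tangent E K →ₗ[ℝ] H.Spinor)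
    (h : ∀ X, L X = ∑ k, (H.g (U k) X : ℂ) • φ k) :
    ∑ k, H.cliffordAction (U k) (φ k) = ∑ j, H.cliffordAction (e j) (L (e j)) := by
  simp only [h, map_sum, map_smul]
  rw [Finset.sum_comm]
  refine Finset.sum_congr rfl fun k _ => ?_
  have h1 := IsInner.sum_smul_map he (H.cliffordLeft (φ k)) (U k)
  refine h1.symm.trans (Finset.sum_congr rfl fun j _ => ?_)
  rw [H.g_symm, Complex.coe_smul]
  rfl

variable (hK : IsInner (kilE E G))
  (hform : ∀ (V : VectorFields E K) x, D.form H V x = H.cplxMap (A (V.1 x)) (hA.comm (V.1 x)))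
include hform

lemma spinorConnection_eq (V : VectorFields E K) (ψ : G → H.Spinor) (x : G) :
    H.spinorConnection D V ψ x = H.nabla hA ψ x (V.1 x) := by
  rw [spinorConnection, nabla_apply, hform]

include hK in
-- The gradient condition is stated for fields only, but every X in 𝔪 is the value at x of a field,
-- so a constant orthonormal basis may be used at all points.
lemma IsDirac.apply_eq {χ : K →ₜ* Circle} {𝒟 : H.SpinorFields χ →ₗ[ℂ] H.SpinorFields χ}
    (h : H.IsDirac D χ 𝒟) {ι : Type*} [Fintype ι] [DecidableEq ι]
    {e : Module.Basis ι ℝ (tangent E K)} (he : ∀ i j, H.g (e i) (e j) = if i = j then 1 else 0)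
    (ψ : H.SpinorFields χ) (x : G) :
    (𝒟 ψ).1 x = ∑ j, H.cliffordAction (e j) (H.nabla hA ψ.1 x (e j)) := by
  obtain ⟨n, U, φ, h1, h2⟩ := h ψ
  rw [h2]
  refine sum_clifford_eq he _ _ _ fun X => ?_
  have h3 := h1 (fieldOf hK (adE E x (X : E))) x
  rw [spinorConnection_eq hA hform, fieldOf_adE] at h3
  exact h3

include hK in
-- For existence, the Parseval frame F_k of fields is paired with the fields U_k such that g(U_k, ·)
-- = Kil(F_k, ·); then ∑ U_k ⊗ ∇_{F_k}ψ is the gradient. Uniqueness is the formula in a constant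
-- basis.
lemma existsUnique_isDirac (χ : K →ₜ* Circle) :
    ∃! 𝒟 : H.SpinorFields χ →ₗ[ℂ] H.SpinorFields χ, H.IsDirac D χ 𝒟 := by
  obtain ⟨e, he⟩ := H.exists_orthonormal_basis
  obtain ⟨b, hb⟩ := hK.exists_orthonormal_basis
  choose U hU using fun k => H.exists_gradField (fieldOf hK (b k))
  have hex : H.IsDirac D χ (∑ k, H.cliffordField χ (U k) ∘ₗ H.nablaField hA χ (fieldOf hK (b k))) := by
    intro ψ
    refine ⟨_, U, fun k => H.nablaField hA χ (fieldOf hK (b k)) ψ, fun V x => ?_, fun x => ?_⟩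
    · rw [spinorConnection_eq hA hform]
      conv_lhs => rw [← sum_kilT_smul_fieldOf hK hb x (V.1 x), map_sum]
      refine Finset.sum_congr rfl fun k _ => ?_
      rw [map_smul, hU, Complex.coe_smul]
      rfl
    · rw [LinearMap.sum_apply, Submodule.coe_sum, Finset.sum_apply]
      exact Finset.sum_congr rfl fun k _ => rfl
  exact ⟨_, hex, fun 𝒟 h𝒟 => LinearMap.ext fun ψ => Subtype.ext (funext fun x => by
    rw [h𝒟.apply_eq hA hK hform he, hex.apply_eq hA hK hform he])⟩

variable [CompactSpace G] [T2Space G] [MeasurableSpace G] [BorelSpace G]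

include hK in
-- Pointwise, the defect of symmetry is a sum of derivatives along left-invariant fields and a term
-- in the trace of A. The former integrate to zero and the latter vanishes by hypothesis.
lemma IsDirac.isFormallySelfAdjoint (ν : Measure G) [ν.IsHaarMeasure] {χ : K →ₜ* Circle}
    {𝒟 : H.SpinorFields χ →ₗ[ℂ] H.SpinorFields χ} (h : H.IsDirac D χ 𝒟)
    (htr : ∀ {ι : Type} [Fintype ι] [DecidableEq ι] {e : Module.Basis ι ℝ (tangent E K)},
      (∀ i j, H.g (e i) (e j) = if i = j then 1 else 0) → ∑ j, A (e j) (e j) = 0) :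
    H.IsFormallySelfAdjoint ν χ 𝒟 := by
  intro ψ φ
  obtain ⟨e, he⟩ := H.exists_orthonormal_basis
  -- A constant e_j need not be a field on G/K, so η_j is treated only as a smooth function on `G`.
  let η := fun j x => H.cliffordAction (e j) (φ.1 x)
  have hη : ∀ j, ContMDiff 𝓘(ℝ, E) 𝓘(ℝ, H.Spinor) ∞ (η j) := fun j =>
    ContMDiff.linear_comp ((H.cliffordAction (e j)).restrictScalars ℝ) φ.2.1
  have hf : ∀ j, ContMDiff 𝓘(ℝ, E) 𝓘(ℝ, ℂ) ∞ fun x => H.spinorInner (ψ.1 x) (η j x) := fun j =>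
    ContMDiff.bilin_comp H.spinorInner ψ.2.1 (hη j)
  have hη' : ∀ j x, H.nabla hA (η j) x (e j) =
      H.cliffordAction (e j) (H.nabla hA φ.1 x (e j)) + H.cliffordAction (A (e j) (e j)) (φ.1 x) :=
    fun j x => by
      rw [nabla_apply, nabla_apply, H.dirDeriv_spinor_map φ.2.1,
        HermitianStructure.spinorDeriv_cliffordAction (hA.comm _) (hA.skew _), map_add, add_assoc]
  -- The terms with A may be added on both sides of the product rule, because they cancel by
  -- skewness.
  have hd : ∀ j x, dirDeriv (e j : E) (fun x => H.spinorInner (ψ.1 x) (η j x)) x =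
      H.spinorInner (H.nabla hA ψ.1 x (e j)) (η j x) +
        H.spinorInner (ψ.1 x) (H.nabla hA (η j) x (e j)) :=
    fun j x => by
      rw [dirDeriv_bilinear _ H.spinorInner ψ.2.1 (hη j), nabla_apply, nabla_apply,
        map_add, LinearMap.add_apply, map_add]
      have hs : H.spinorInner (H.spinorDeriv (H.cplxMap (A (e j)) (hA.comm _)) (ψ.1 x)) (η j x) =
          -H.spinorInner (ψ.1 x) (H.spinorDeriv (H.cplxMap (A (e j)) (hA.comm _)) (η j x)) :=
        HermitianStructure.inner_spinorDeriv (hA.comm _) (hA.skew _) _ _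
      rw [hs]
      ring
  have hA0 : ∀ x, ∑ j, H.cliffordAction (A (e j) (e j)) (φ.1 x) = 0 := fun x => by
    have h1 := congrArg (H.cliffordLeft (φ.1 x)) (htr he)
    rw [map_sum, map_zero] at h1
    exact h1
  have hsk : ∀ X a b, H.spinorInner (H.cliffordAction X a) b = -H.spinorInner a (H.cliffordAction X b) :=
    H.inner_cliffordAction
  -- Summing the product rule over j and moving κ(e_j) across with a sign turns the two remaining
  -- sums into the Dirac operator on ψ and on φ.
  have key : ∀ x, H.spinorInner ((𝒟 ψ).1 x) (φ.1 x) = H.spinorInner (ψ.1 x) ((𝒟 φ).1 x) -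
      ∑ j, dirDeriv (e j : E) (fun x => H.spinorInner (ψ.1 x) (η j x)) x := fun x => by
    simp only [hd, hη', map_add, Finset.sum_add_distrib]
    rw [h.apply_eq hA hK hform he, h.apply_eq hA hK hform he, ← map_sum _
      (fun j => H.cliffordAction (A (e j) (e j)) (φ.1 x)), hA0]
    simp only [map_sum, LinearMap.sum_apply, hsk, map_zero, η, Finset.sum_neg_distrib]
    ring
  have hint : ∀ j, Integrable (dirDeriv (e j : E) fun x => H.spinorInner (ψ.1 x) (η j x)) ν := fun j =>
    integrable_of_continuous ν (ContMDiff.dirDeriv (e j : E) (hf j)).continuous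
  have hint' : Integrable (fun x => H.spinorInner (ψ.1 x) ((𝒟 φ).1 x)) ν :=
    integrable_of_continuous ν (ContMDiff.bilin_comp _ ψ.2.1 (𝒟 φ).2.1).continuous
  change ∫ x, H.spinorInner ((𝒟 ψ).1 x) (φ.1 x) ∂ν = ∫ x, H.spinorInner (ψ.1 x) ((𝒟 φ).1 x) ∂ν
  simp only [key]
  rw [integral_sub hint' (integrable_finsetSum _ fun j _ => hint j),
    integral_finsetSum _ fun j _ => hint j]
  simp only [integral_dirDeriv ν _ (hf _), Finset.sum_const_zero, sub_zero]

end AlmostHermitian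
end DiracOperator

end CoadjointDirac
open CoadjointDirac
theorem corollary7p9 {E : Type*} [NormedAddCommGroup E] [NormedSpace ℝ E] [FiniteDimensional ℝ E]
    [CompleteSpace E] {G : Type*} [TopologicalSpace G] [ChartedSpace E G] [Group G]
    [LieGroup 𝓘(ℝ, E) ∞ G] [T2Space G] [CompactSpace G] [ConnectedSpace G]
    [LieAlgebra.IsSemisimple ℝ (LieAlg E G)]
    [MeasurableSpace G] [BorelSpace G] (ν : MeasureTheory.Measure G) [ν.IsHaarMeasure]
    (μ : Module.Dual ℝ (LieAlg E G)) :
    (∃! H : AlmostHermitian E (stabilizer μ), IsKahler μ H) ∧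
      ∀ H : AlmostHermitian E (stabilizer μ), IsKahler μ H →
        ∀ D : Connection E (stabilizer μ),
          D.IsInvariant → D.IsCompatible H → D.CommutesWithJ H →
            ∀ χ : stabilizer μ →ₜ* Circle,
              (∃! 𝒟 : H.SpinorFields χ →ₗ[ℂ] H.SpinorFields χ, H.IsDirac D χ 𝒟) ∧
                ∀ 𝒟 : H.SpinorFields χ →ₗ[ℂ] H.SpinorFields χ,
                  H.IsDirac D χ 𝒟 → H.IsFormallySelfAdjoint ν χ 𝒟 := by
  have hK : IsInner (kilE E G) := kilE_isInner ν
  refine ⟨existsUnique_isKahler hK μ, fun H _ D hD hg hJ χ => ?_⟩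
  have hA : H.IsInvariantTensor (D.tensor hK) :=
    ⟨hJ.tensor_J hK hD, hg.tensor_skew hK hD, hD.tensor_adTangent hK⟩
  have hform := Connection.form_eq hK hJ hD
  exact ⟨AlmostHermitian.existsUnique_isDirac hA hK hform χ, fun 𝒟 h𝒟 =>
    h𝒟.isFormallySelfAdjoint hA hK hform ν fun he => hD.sum_tensor_eq_zero hK he⟩
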